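/- **Definitions.** A *pair of combinatorial multicones* is a finite cyclically ordered set $\mathbf M$ partitioned into a stable part $\mathbf M_s$ and an unstable part $\mathbf M_u$ that alternate along the cyclic order; its *rank* is $q=\#\mathbf M_s=\#\mathbf M_u$. Write $x^+$ for the element next to $x$. A *correspondence* is a subset of $\mathbf M\times\mathbf M$, and $C\circ C'=\{(x,z):\exists y,\ (x,y)\in C,\ (y,z)\in C'\}$. A correspondence $C\subset(\mathbf M_s\times\mathbf M_s)\sqcup(\mathbf M_u\times\mathbf M_u)$ is *monotonic* if $C\cap(\mathbf M_s\times\mathbf M_s)=\{(C_s(y),y)\}$ and $C\cap(\mathbf M_u\times\mathbf M_u)=\{(x,C_u(x))\}$ for maps $C_s:\mathbf M_s\to\mathbf M_s$, $C_u:\mathbf M_u\to\mathbf M_u$, and $C$ has a cyclic ordering in which the element next to $(x,y)$ is always $(x^{++},y)$, $(x^+,y^+)$ or $(x,y^{++})$. Monotonic correspondences form a monoid $\mathcal C(\mathbf M)$. A *constant* correspondence is one of the form $\mathbf M_u\times\{a_u\}\sqcup\{a_s\}\times\mathbf M_s$ with $a_s\in\mathbf M_s$, $a_u\in\mathbf M_u$.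 Let $\mathcal F_2$ be the free monoid on two generators $a,b$. A morphism $\Phi:\mathcal F_2\to\mathcal C(\mathbf M)$ is *hyperbolic* if for some $\ell\ge1$ every word of length at least $\ell$ is sent to a constant correspondence, and *tight* if $\operatorname{Im}\Phi(a)_u\cup\operatorname{Im}\Phi(b)_u=\mathbf M_u$ and $\operatorname{Im}\Phi(a)_s\cup\operatorname{Im}\Phi(b)_s=\mathbf M_s$. A pair $(A_1,A_2)\in SL(2,\mathbb R)^2$ is *uniformly hyperbolic* if the cocycle $x\mapsto A_{x_0}$ over the full shift on $\{1,2\}^{\mathbb Z}$ has a continuous invariant splitting $e^s\oplus e^u$, with $e^s$ uniformly exponentially contracted in the future and $e^u$ in the past. Let $K^s,K^u\subset\mathbb P^1$ be the images of $e^s,e^u$. The *unstable core* $U$ is the complement of the union of the connected components of $\mathbb P^1\setminus K^u$ that intersect $K^s$; the *stable core* $S$ is obtained by exchanging $K^u$ and $K^s$. The pair *induces* $\Phi$ if there are bijections from $\mathbf M_u$ to the set of connected components of $U$ and from $\mathbf M_s$ to that of $S$, together respecting the cyclic orders of $\mathbf M$ and $\mathbb P^1$, under which the image of the $i$-th generator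 becomes the set of pairs $(x,y)$ of components of the same core such that $A_i(x)\cap y\ne\emptyset$. **Proposition.** Every tight hyperbolic morphism $\Phi:\mathcal F_2\to\mathcal C(\mathbf M)$ is induced by some uniformly hyperbolic pair of matrices $(A,B)$. Moreover, if the rank $q$ of $\mathbf M$ is at least $2$, the pair can be chosen such that the following holds for some $F$ in the monoid of substitutions generated by $F_+:(a\mapsto a,\ b\mapsto ab)$ and $F_-:(a\mapsto ba,\ b\mapsto b)$: the word $F(ab)$ has length $q$ and contains the letter $b$ exactly $p=\#\operatorname{Im}\Phi(b)_u$ times, and the matrices $X$, $Y$ obtained from the words $F(a)$, $F(b)$ by substituting $A$, $B$ for $a$, $b$ satisfy $\operatorname{tr}X>2$, $\operatorname{tr}Y>2$, $\operatorname{tr}XY<-2$. -/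

import Mathlib

open scoped LinearAlgebra.Projectivization MatrixGroups

noncomputable section

/-! ### Combinatorial multicones and monotonic correspondences -/

/-- A pair of combinatorial multicones on the finite set `M`. The cyclic order of `M` is given by
its successor permutation `next` (`next x` is the element next to `x`, written `x⁺`), which runs
through all of `M` in a single cycle. The stable part and its complement, the unstable part,
alternate along the cyclic order (hence they have the same cardinality). -/
structure MulticonePair (M : Type*) [Finite M] where
  next : Equiv.Perm M
  isCycleOn_next : next.IsCycleOn Set.univ
  stable : Set M
  alternate : ∀ x, next x ∈ stable ↔ x ∉ stable

/-- Correspondences on `M`: subsets of `M × M`. -/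
def Correspondence (M : Type*) : Type _ := Set (M × M)

namespace Correspondence

variable {M : Type*}

/-- The pair `(x, y)` belongs to the correspondence `C`. -/
def Rel (C : Correspondence M) (x y : M) : Prop := (x, y) ∈ (show Set (M × M) from C)

/-- The monoid of correspondences: `C * D = {(x, z) | ∃ y, (x, y) ∈ C ∧ (y, z) ∈ D}`, with the
diagonal as identity. -/
instance : Monoid (Correspondence M) where
  mul C D := {p : M × M | ∃ y, C.Rel p.1 y ∧ D.Rel y p.2}
  one := {p : M × M | p.1 = p.2}
  mul_assoc C D E := by
    refine Set.ext fun p => ⟨?_, ?_⟩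
    · rintro ⟨z, ⟨y, h1, h2⟩, h3⟩
      exact ⟨y, h1, z, h2, h3⟩
    · rintro ⟨y, h1, z, h2, h3⟩
      exact ⟨z, ⟨y, h1, h2⟩, h3⟩
  one_mul C := by
    refine Set.ext fun p => ⟨?_, fun h => ⟨p.1, rfl, h⟩⟩
    rintro ⟨y, h1, h2⟩
    obtain rfl : p.1 = y := h1
    exact h2
  mul_one C := by
    refine Set.ext fun p => ⟨?_, fun h => ⟨p.2, h, rfl⟩⟩
    rintro ⟨y, h1, h2⟩
    obtain rfl : y = p.2 := h2
    exact h1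

end Correspondence

namespace MulticonePair

variable {M : Type*} [Finite M] (P : MulticonePair M)

/-- The unstable combinatorial multicone. -/
def unstable : Set M := P.stableᶜ

/-- The rank, i.e. the common cardinality of the stable and unstable parts. -/
def rank : ℕ := P.stable.ncard

/-- Monotonic correspondences. The conditions `stable_map` and `unstable_map` say that
`C ∩ (Mₛ × Mₛ) = {(Cₛ y, y)}` and `C ∩ (Mᵤ × Mᵤ) = {(x, Cᵤ x)}` for maps `Cₛ : Mₛ → Mₛ` and
`Cᵤ : Mᵤ → Mᵤ`. The last condition says that `C` can be endowed with a cyclic ordering (with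
successor permutation `σ`) such that the element next to `(x, y)` is `(x⁺⁺, y)`, `(x⁺, y⁺)` or
`(x, y⁺⁺)`. -/
structure IsMonotonic (C : Correspondence M) : Prop where
  subset : ∀ x y, C.Rel x y → (x ∈ P.stable ∧ y ∈ P.stable) ∨ (x ∈ P.unstable ∧ y ∈ P.unstable)
  stable_map : ∀ y ∈ P.stable, ∃! x, x ∈ P.stable ∧ C.Rel x y
  unstable_map : ∀ x ∈ P.unstable, ∃! y, y ∈ P.unstable ∧ C.Rel x y
  cyclic : ∃ σ : Equiv.Perm {p : M × M // C.Rel p.1 p.2}, σ.IsCycleOn Set.univ ∧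
    ∀ p, (σ p).1 = (P.next (P.next p.1.1), p.1.2) ∨ (σ p).1 = (P.next p.1.1, P.next p.1.2) ∨
      (σ p).1 = (p.1.1, P.next (P.next p.1.2))

/-- The image of the map `Cₛ : Mₛ → Mₛ` of a monotonic correspondence. -/
def imStable (C : Correspondence M) : Set M :=
  {x | x ∈ P.stable ∧ ∃ y ∈ P.stable, C.Rel x y}

/-- The image of the map `Cᵤ : Mᵤ → Mᵤ` of a monotonic correspondence. -/
def imUnstable (C : Correspondence M) : Set M :=
  {y | y ∈ P.unstable ∧ ∃ x ∈ P.unstable, C.Rel x y}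

/-- Constant correspondences `Mᵤ × {a_u} ⊔ {a_s} × Mₛ`. -/
def IsConstant (C : Correspondence M) : Prop :=
  ∃ a_s ∈ P.stable, ∃ a_u ∈ P.unstable, ∀ x y,
    C.Rel x y ↔ (x ∈ P.unstable ∧ y = a_u) ∨ (x = a_s ∧ y ∈ P.stable)

variable {N : ℕ}

/-- `Φ` is a morphism from the free monoid on `N` generators to the monoid of monotonic
correspondences on `M`. -/
def IsMonotonicMorphism (Φ : FreeMonoid (Fin N) →* Correspondence M) : Prop :=
  ∀ w, P.IsMonotonic (Φ w)

/-- All sufficiently long words are sent to constant correspondences. -/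
def IsHyperbolic (Φ : FreeMonoid (Fin N) →* Correspondence M) : Prop :=
  ∃ l : ℕ, 1 ≤ l ∧ ∀ w : FreeMonoid (Fin N), l ≤ w.length → P.IsConstant (Φ w)

/-- The images of the unstable (resp. stable) maps of the generators cover the unstable
(resp. stable) combinatorial multicone. -/
def IsTight (Φ : FreeMonoid (Fin N) →* Correspondence M) : Prop :=
  (⋃ i, P.imUnstable (Φ (FreeMonoid.of i))) = P.unstable ∧
    (⋃ i, P.imStable (Φ (FreeMonoid.of i))) = P.stable

end MulticonePair

/-! ### The projective line -/

/-- The projective line of `ℝ²`, on which `SL(2, ℝ)` acts (Mathlib's action). -/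
abbrev RP1 : Type := ℙ ℝ (Fin 2 → ℝ)

namespace RP1

/-- The quotient topology from `ℝ² ∖ {0}`. -/
instance : TopologicalSpace RP1 :=
  TopologicalSpace.coinduced
    (fun v : {v : Fin 2 → ℝ // v ≠ 0} => Projectivization.mk ℝ v.1 v.2) inferInstance

/-- The determinant of two vectors of the plane. -/
def det2 (v w : Fin 2 → ℝ) : ℝ := v 0 * w 1 - v 1 * w 0

/-- The strict cyclic order of the projective line: `p, q, r` are distinct and are met in this
order when the line is turned in one fixed direction. The sign does not depend on the
representing vectors, since each of them occurs twice. -/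
def CyclicLT (p q r : RP1) : Prop :=
  0 < det2 p.rep q.rep * det2 q.rep r.rep * det2 r.rep p.rep

/-- The induced strict cyclic order on (disjoint connected) subsets. -/
def SetCyclicLT (X Y Z : Set RP1) : Prop :=
  ∀ p ∈ X, ∀ q ∈ Y, ∀ r ∈ Z, CyclicLT p q r

/-- The set of connected components of a subset `U`. -/
def components (U : Set RP1) : Set (Set RP1) :=
  {c | ∃ p ∈ U, c = connectedComponentIn U p}

/-- The complement of the union of the connected components of `Kᶜ` that intersect `L`. -/
def fill (K L : Set RP1) : Set RP1 := (⋃ p ∈ L, connectedComponentIn Kᶜ p)ᶜ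

end RP1

/-! ### Uniformly hyperbolic tuples over the full shift -/

namespace SL2Cocycle

variable {N : ℕ}

/-- The full shift on `N` symbols. -/
def shift (x : ℤ → Fin N) : ℤ → Fin N := fun i => x (i + 1)

/-- `Aⁿ(x) = A_{x_{n-1}} ⋯ A_{x_0}`. -/
def forward (A : Fin N → SL(2, ℝ)) (x : ℤ → Fin N) : ℕ → SL(2, ℝ)
  | 0 => 1
  | n + 1 => A (x n) * forward A x n

/-- `A⁻ⁿ(x) = A_{x_{-n}}⁻¹ ⋯ A_{x_{-1}}⁻¹`. -/
def backward (A : Fin N → SL(2, ℝ)) (x : ℤ → Fin N) : ℕ → SL(2, ℝ)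
  | 0 => 1
  | n + 1 => (A (x (-((n : ℤ) + 1))))⁻¹ * backward A x n

/-- `es`, `eu` form the invariant continuous splitting of a uniformly hyperbolic tuple: `es` is
uniformly exponentially contracted in the future and `eu` in the past. (The norm is the sup norm
of `ℝ²`; another norm only changes the constant `c`.) -/
structure IsHyperbolicSplitting (A : Fin N → SL(2, ℝ)) (es eu : (ℤ → Fin N) → RP1) : Prop where
  continuous_es : Continuous es
  continuous_eu : Continuous eu
  invariant_es : ∀ x, A (x 0) • es x = es (shift x)
  invariant_eu : ∀ x, A (x 0) • eu x = eu (shift x)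
  transverse : ∀ x, es x ≠ eu x
  contraction : ∃ c : ℝ, 0 < c ∧ ∃ lam : ℝ, 1 < lam ∧ ∀ (x : ℤ → Fin N) (n : ℕ),
    (∀ v ∈ (es x).submodule,
      ‖(forward A x n : Matrix (Fin 2) (Fin 2) ℝ).mulVec v‖ ≤ c * (lam ^ n)⁻¹ * ‖v‖) ∧
    (∀ v ∈ (eu x).submodule,
      ‖(backward A x n : Matrix (Fin 2) (Fin 2) ℝ).mulVec v‖ ≤ c * (lam ^ n)⁻¹ * ‖v‖)

/-- Uniform hyperbolicity with respect to the full shift. -/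
def UniformlyHyperbolic (A : Fin N → SL(2, ℝ)) : Prop :=
  ∃ es eu, IsHyperbolicSplitting A es eu

/-- The set of all unstable directions (the splitting is unique when it exists). -/
def Ku (A : Fin N → SL(2, ℝ)) : Set RP1 :=
  {p | ∃ es eu, IsHyperbolicSplitting A es eu ∧ p ∈ Set.range eu}

/-- The set of all stable directions. -/
def Ks (A : Fin N → SL(2, ℝ)) : Set RP1 :=
  {p | ∃ es eu, IsHyperbolicSplitting A es eu ∧ p ∈ Set.range es}

/-- The unstable core. -/
def unstableCore (A : Fin N → SL(2, ℝ)) : Set RP1 := RP1.fill (Ku A) (Ks A)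

/-- The stable core. -/
def stableCore (A : Fin N → SL(2, ℝ)) : Set RP1 := RP1.fill (Ks A) (Ku A)

/-- `Φ` is the morphism induced by the uniformly hyperbolic tuple `A`, up to the identification
`e` of `M` with the set of connected components of the two cores: `e` maps the stable (unstable)
multicone bijectively to the components of the stable (unstable) core, it respects the cyclic
orders (`e x⁺` is the component next to `e x`), and it turns the image of the `i`-th generator
into the correspondence of all pairs `(x, y)` of components of the same core such that
`Aᵢ(x)` meets `y`. -/
def Induces {M : Type*} [Finite M] (A : Fin N → SL(2, ℝ)) (P : MulticonePair M)
    (Φ : FreeMonoid (Fin N) →* Correspondence M) : Prop :=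
  UniformlyHyperbolic A ∧ ∃ e : M → Set RP1,
    Function.Injective e ∧
    e '' P.stable = RP1.components (stableCore A) ∧
    e '' P.unstable = RP1.components (unstableCore A) ∧
    (∀ x y, ¬ RP1.SetCyclicLT (e x) (e y) (e (P.next x))) ∧
    ∀ i x y, (Φ (FreeMonoid.of i)).Rel x y ↔
      ((x ∈ P.stable ∧ y ∈ P.stable) ∨ (x ∈ P.unstable ∧ y ∈ P.unstable)) ∧
        (((fun p => A i • p) '' e x) ∩ e y).Nonempty

end SL2Cocycle

/-! ### Substitutions on two letters and the associated pairs of matrices -/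

namespace Farey

/-- The substitution `a ↦ a`, `b ↦ ab`, where `a`, `b` are the letters `0`, `1`. -/
def substPlus : Monoid.End (FreeMonoid (Fin 2)) :=
  FreeMonoid.lift ![FreeMonoid.of 0, FreeMonoid.of 0 * FreeMonoid.of 1]

/-- The substitution `a ↦ ba`, `b ↦ b`. -/
def substMinus : Monoid.End (FreeMonoid (Fin 2)) :=
  FreeMonoid.lift ![FreeMonoid.of 1 * FreeMonoid.of 0, FreeMonoid.of 1]

/-- The monoid of substitutions generated by `substPlus` and `substMinus`. -/
def substMonoid : Submonoid (Monoid.End (FreeMonoid (Fin 2))) :=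
  Submonoid.closure {substPlus, substMinus}

/-- `j(F) = p / q`: the word `F(ab)` has length `q` and contains the letter `b` exactly `p`
times. -/
def HasFraction (F : Monoid.End (FreeMonoid (Fin 2))) (p q : ℕ) : Prop :=
  (F (FreeMonoid.of 0 * FreeMonoid.of 1)).length = q ∧
    (F (FreeMonoid.of 0 * FreeMonoid.of 1)).toList.count 1 = p

/-- A pair `(X, Y)` in the positive free component or in its mirror image. -/
def IsFreePair (X Y : SL(2, ℝ)) : Prop :=
  2 < (X : Matrix (Fin 2) (Fin 2) ℝ).trace ∧ 2 < (Y : Matrix (Fin 2) (Fin 2) ℝ).trace ∧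
    ((X * Y : SL(2, ℝ)) : Matrix (Fin 2) (Fin 2) ℝ).trace < -2

/-- `(F(A), F(B))` is a free pair, where the words `F(a)`, `F(b)` are evaluated by substituting
the matrices `A 0`, `A 1` for the letters `a`, `b`. -/
def InTwistedFree (F : Monoid.End (FreeMonoid (Fin 2))) (A : Fin 2 → SL(2, ℝ)) : Prop :=
  IsFreePair (FreeMonoid.lift A (F (FreeMonoid.of 0))) (FreeMonoid.lift A (F (FreeMonoid.of 1)))

end Farey

end

/-! Number the unstable elements by `ℤ` along the cyclic order, with period `q`; the stable elements
are then the gaps `(n, n + 1)`. A monotonic correspondence unrolls to a monotone map `F : ℤ → ℤ`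
with `F (x + q) = F x + q`, which lifts `C_u`, while its upper adjoint lifts `C_s`
(`exists_represents`). A tight hyperbolic morphism becomes a pair `f`, `g` satisfying `TightSystem`,
and passing to adjoints exchanges the stable and unstable sides (`TightSystem.dual`).

The pair is simplified by induction on `q`. Hyperbolicity forces a "sink": two points, distinct
modulo `q`, that both maps identify (`exists_sink`). As every gap is a jump of `f` or `g`, the
circle splits into two arcs, with `f` constant on one and injective on the other, and `g` the other
way round. Dually, the two images are disjoint complementary arcs. For `q ≥ 3` a second sink
argument puts both division points in the image of one map, say `f`. A count then shows that the
complement of that image lies where `g` is constant and `f` injective. Hence `f` and `f ∘ g`,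
restricted to the image of `f`, form a tight system of rank `#Im f < q` (`exists_reduction`,
`IsReduction.exists_system`).

The induction is undone on matrices. If `A`, `C` realize the reduced system by arcs on the
projective line, then `A`, `B = A⁻¹ C` realize the original one: the arcs of the image of `f` are
kept, the others are preimages under `A`, slightly shrunk (`IsReduction.exists_arcs`). Since `C = A
B`, this step composes the substitution with `F_+`, or with `F_-` if the roles of `f` and `g` are
exchanged. The letter counts of `F (ab)` follow the sizes of the images, because `#Im f = #Im f' +
#Im g'` and `#Im g = #Im g'`. In rank two, explicit conjugates of a hyperbolic matrix by rotations,
a quarter turn apart, form the free pair; rank one is treated directly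
(`TightSystem.exists_realizes`).

It remains to see that arcs mapped strictly inside arcs give hyperbolicity and the prescribed
morphism. The quadratic form vanishing at the ends of an arc strictly increases when the arc is
enlarged, so it grows by a uniform factor under each matrix. This gives exponential expansion on the
arcs (`exists_expansion`), contraction of their images, and limit directions `e^u`. The inverses act
in the same way on the complementary gaps, through the adjoint maps (`Realizes.dual`), which gives
`e^s`. Each arc contains unstable directions and each gap stable ones, so the components of a core
are the convex hulls of `K^u` in the arcs, respectively of `K^s` in the gaps (`components_fill`).
These components are permuted and overlapped exactly as `f`, `g` prescribe (`Realizes.induces`). -/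

/-! ### Tight hyperbolic systems of monotone maps of degree one -/

/-- The composition of the maps `f i` along a word; the last letter acts first. -/
def evalWord {ι α : Type*} (f : ι → α → α) : List ι → α → α
  | [] => id
  | i :: w => f i ∘ evalWord f w

theorem evalWord_append {ι α : Type*} (f : ι → α → α) (v w : List ι) (x : α) :
    evalWord f (v ++ w) x = evalWord f v (evalWord f w x) := by
  induction v with
  | nil => rfl
  | cons i v ih => simp [evalWord, ih]

/-- Monotone self-maps of `ℤ` commuting with the translation by `q`. -/
structure IsDegOne (q : ℕ) (f : ℤ → ℤ) : Prop where
  mono : Monotone f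
  shift : ∀ x, f (x + q) = f x + q

namespace IsDegOne

variable {q : ℕ} {f g : ℤ → ℤ}

theorem shift_mul (hf : IsDegOne q f) (x k : ℤ) : f (x + k * q) = f x + k * q := by
  induction k using Int.induction_on with
  | zero => simp
  | succ k ih =>
    have := hf.shift (x + k * q)
    rw [ih] at this
    rw [show x + ((k : ℤ) + 1) * q = x + k * q + q by ring, this]; ring
  | pred k ih =>
    have := hf.shift (x + (-(k : ℤ) - 1) * q)
    rw [show x + (-(k : ℤ) - 1) * q + q = x + (-(k : ℤ)) * q by ring, ih] at this
    linarith

theorem comp (hf : IsDegOne q f) (hg : IsDegOne q g) : IsDegOne q (f ∘ g) :=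
  ⟨hf.mono.comp hg.mono, fun x => by simp [hg.shift, hf.shift]⟩

theorem id (q : ℕ) : IsDegOne q (id : ℤ → ℤ) := ⟨monotone_id, fun _ => rfl⟩

theorem evalWord {ι : Type*} {f : ι → ℤ → ℤ} (hf : ∀ i, IsDegOne q (f i)) (w : List ι) :
    IsDegOne q (evalWord f w) := by
  induction w with
  | nil => exact IsDegOne.id q
  | cons i w ih => exact (hf i).comp ih

theorem dvd (hf : IsDegOne q f) {x y : ℤ} (h : (q : ℤ) ∣ x - y) : (q : ℤ) ∣ f x - f y := by
  obtain ⟨k, hk⟩ := h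
  obtain rfl : x = y + k * q := by linarith
  rw [hf.shift_mul]; simp

theorem exists_adj (hq : 0 < q) (hf : IsDegOne q f) (m : ℤ) : ∃ n, ∀ x, f x ≤ m ↔ x ≤ n := by
  have hq' : (1 : ℤ) ≤ q := by exact_mod_cast hq
  have hb : ∃ b : ℤ, ∀ z : ℤ, f z ≤ m → z ≤ b := by
    -- At this point `f` equals `f 0 + (|m - f 0| + 1) * q`, which exceeds `m` because `q ≥ 1`.
    refine ⟨(|m - f 0| + 1) * q, fun z hz => ?_⟩
    by_contra hlt
    have h1 := hf.mono (not_le.mp hlt).le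
    have h2 := hf.shift_mul 0 (|m - f 0| + 1)
    rw [zero_add] at h2
    have h3 := le_abs_self (m - f 0)
    nlinarith [abs_nonneg (m - f 0)]
  have hne : ∃ z : ℤ, f z ≤ m := by
    refine ⟨(-|m - f 0|) * q, ?_⟩
    have h2 := hf.shift_mul 0 (-|m - f 0|)
    rw [zero_add] at h2
    have h3 := neg_abs_le (m - f 0)
    nlinarith [abs_nonneg (m - f 0)]
  obtain ⟨n, hn, hmax⟩ := Int.exists_greatest_of_bdd hb hne
  exact ⟨n, fun x => ⟨fun h => hmax x h, fun h => (hf.mono h).trans hn⟩⟩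

end IsDegOne

open Classical in
/-- The upper adjoint of a map of degree one. -/
noncomputable def upperAdj (f : ℤ → ℤ) (m : ℤ) : ℤ :=
  -- The default `0` never occurs for maps of degree one with `q > 0`, by `exists_adj`.
  if h : ∃ n, ∀ x, f x ≤ m ↔ x ≤ n then h.choose else 0

theorem IsDegOne.gc {q : ℕ} {f : ℤ → ℤ} (hq : 0 < q) (hf : IsDegOne q f) :
    GaloisConnection f (upperAdj f) := fun x m => by
  have h := hf.exists_adj hq m
  rw [upperAdj, dif_pos h]
  exact h.choose_spec x

theorem IsDegOne.upperAdj {q : ℕ} {f : ℤ → ℤ} (hq : 0 < q) (hf : IsDegOne q f) :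
    IsDegOne q (upperAdj f) := by
  refine ⟨(hf.gc hq).monotone_u, fun m => ?_⟩
  refine eq_of_forall_le_iff fun x => ?_
  have h1 := hf.gc hq x (m + q)
  have h2 := hf.gc hq (x - q) m
  have h3 := hf.shift (x - q)
  rw [sub_add_cancel] at h3
  rw [← h1, h3]
  constructor
  · intro h
    have := h2.1 (by linarith)
    linarith
  · intro h
    have := h2.2 (by linarith)
    linarith

/-- A tight hyperbolic system: every gap `(n, n + 1)` is a jump of some map, every point is a
value, and all long compositions are constant modulo `q`. -/
structure TightSystem {ι : Type*} (q : ℕ) (f : ι → ℤ → ℤ) : Prop where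
  pos : 0 < q
  deg : ∀ i, IsDegOne q (f i)
  stable : ∀ n, ∃ i, f i n < f i (n + 1)
  unstable : ∀ m, ∃ i n, f i n = m
  hyp : ∃ k, ∀ w : List ι, k ≤ w.length → ∀ x y, (q : ℤ) ∣ evalWord f w x - evalWord f w y

namespace TightSystem

variable {ι : Type*} {q : ℕ} {f : ι → ℤ → ℤ}

theorem gc_evalWord (h : TightSystem q f) (w : List ι) :
    GaloisConnection (evalWord f w) (evalWord (fun i => upperAdj (f i)) w.reverse) := by
  induction w with
  | nil => exact GaloisConnection.id
  | cons i w ih =>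
    have h1 := ih.compose ((h.deg i).gc h.pos)
    intro x y
    rw [List.reverse_cons, evalWord_append]
    exact h1 x y

/-- Adjunction trades jumps for values: the adjoint jumps across `(n, n + 1)` when `n + 1` is a
value of the map, and attains `m` when the map jumps across `(m, m + 1)`. Thus the two covering
conditions change places. Words are reversed, which is harmless since hyperbolicity concerns all
long words. -/
theorem dual (h : TightSystem q f) : TightSystem q (fun i => upperAdj (f i)) where
  pos := h.pos
  deg i := (h.deg i).upperAdj h.pos
  stable n := by
    obtain ⟨i, x, hx⟩ := h.unstable (n + 1)
    have gc := (h.deg i).gc h.pos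
    refine ⟨i, ?_⟩
    have h1 := (gc x (n + 1)).1 hx.le
    have h2 := mt (gc x n).2 (by omega)
    omega
  unstable m := by
    obtain ⟨i, hi⟩ := h.stable m
    have gc := (h.deg i).gc h.pos
    refine ⟨i, f i m, ?_⟩
    have h1 := (gc m (f i m)).1 le_rfl
    have h2 := mt (gc (m + 1) (f i m)).2 (by omega)
    omega
  hyp := by
    obtain ⟨k, hk⟩ := h.hyp
    refine ⟨k, fun w hw => ?_⟩
    have gc := h.gc_evalWord w.reverse
    rw [List.reverse_reverse] at gc
    have hd := IsDegOne.evalWord h.deg w.reverse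
    have hc := hk w.reverse (by simpa using hw)
    set v := evalWord f w.reverse
    set u := evalWord (fun i => upperAdj (f i)) w
    have hu : IsDegOne q u := IsDegOne.evalWord (fun i => (h.deg i).upperAdj h.pos) w
    have hq : (0 : ℤ) < q := by exact_mod_cast h.pos
    -- All values of `v` lie in `v 0 + qℤ`, so the condition `v x ≤ m` depends on `m` only through
    -- the integer part of `(m - v 0) / q`; hence so does `u m`.
    have key : ∀ m, (q : ℤ) ∣ u m - u (v 0) := by
      intro m
      have e : u m = u (v 0 + ((m - v 0) / q) * q) := by
        refine eq_of_forall_le_iff fun x => ?_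
        rw [← gc x m, ← gc x]
        obtain ⟨t, ht⟩ := hc x 0
        have e1 : v x = v 0 + q * t := by linarith
        have e3 : t ≤ (m - v 0) / q ↔ t * q ≤ m - v 0 := Int.le_ediv_iff_mul_le hq
        rw [e1]
        constructor
        · intro h
          have := e3.2 (by linarith)
          nlinarith
        · intro h
          have : t ≤ (m - v 0) / q := by nlinarith
          have := e3.1 this
          linarith
      rw [e, hu.shift_mul]
      simp
    intro x y
    have := dvd_sub (key x) (key y)
    rwa [sub_sub_sub_cancel_right] at this

/-- Otherwise every pair outside `E` is sent outside `E` by some map. Iterating produces arbitrarily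
long words whose values at `x`, `y` are not `E`-related, whereas long words have congruent values.
-/
theorem exists_sink (h : TightSystem q f) (E : ℤ → ℤ → Prop)
    (hE : ∀ x y, (q : ℤ) ∣ x - y → E x y) (hne : ∃ x y, ¬ E x y) :
    ∃ x y, ¬ E x y ∧ ∀ i, E (f i x) (f i y) := by
  by_contra hcon
  push Not at hcon
  obtain ⟨x, y, hxy⟩ := hne
  have : ∀ n : ℕ, ∃ w : List ι, w.length = n ∧ ¬ E (evalWord f w x) (evalWord f w y) := by
    intro n
    induction n with
    | zero => exact ⟨[], rfl, hxy⟩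
    | succ n ih =>
      obtain ⟨w, hw, hn⟩ := ih
      obtain ⟨i, hi⟩ := hcon _ _ hn
      exact ⟨i :: w, by simp [hw], hi⟩
  obtain ⟨k, hk⟩ := h.hyp
  obtain ⟨w, hw, hn⟩ := this k
  exact hn (hE _ _ (hk w hw.ge x y))

end TightSystem

/-! ### Sinks, arcs of constancy and complementary images -/

/-- `f` is constant exactly on the arc `[y, x + q]` and `g` exactly on the arc `[x, y]`. -/
structure IsArcSplit (q : ℕ) (f g : ℤ → ℤ) (x y : ℤ) : Prop where
  lt : x < y
  lt' : y < x + q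
  f_eq : f y = f (x + q)
  g_eq : g x = g y
  f_lt : ∀ n, x ≤ n → n < y → f n < f (n + 1)
  g_lt : ∀ n, y ≤ n → n < x + q → g n < g (n + 1)

section Pair

variable {q : ℕ} {f g : ℤ → ℤ}

theorem Monotone.not_lt_of_eq {f : ℤ → ℤ} (hf : Monotone f) {a b n : ℤ} (h : f a = f b)
    (h1 : a ≤ n) (h2 : n < b) : ¬ f n < f (n + 1) := by
  have e1 := hf h1
  have e2 := hf (show n + 1 ≤ b by omega)
  omega

theorem eq_or_eq_of_dvd (hf : IsDegOne q f) {x y : ℤ} (h1 : x < y) (h2 : y < x + q)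
    (h : (q : ℤ) ∣ f x - f y) : f x = f y ∨ f y = f (x + q) := by
  have e1 := hf.mono h1.le
  have e2 := hf.mono h2.le
  rw [hf.shift] at e2 ⊢
  obtain ⟨k, hk⟩ := h
  have h0 : (0 : ℤ) < q := by omega
  have hk1 : k ≤ 0 := by nlinarith
  have hk2 : -1 ≤ k := by nlinarith
  obtain rfl | rfl : k = 0 ∨ k = -1 := by omega
  · left; linarith
  · right; linarith

/-- By monotonicity and degree one, a map identifying `x` and `y` modulo `q` is constant on `[x, y]`
or on `[y, x + q]`. Both maps cannot be constant on the same arc, since its first gap is a jump of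
one of them; and where one is constant, the other must jump at every gap. -/
theorem isArcSplit_of_sink (hf : IsDegOne q f) (hg : IsDegOne q g)
    (hs : ∀ n, f n < f (n + 1) ∨ g n < g (n + 1)) {x y : ℤ} (h1 : x < y) (h2 : y < x + q)
    (h3 : (q : ℤ) ∣ f x - f y) (h4 : (q : ℤ) ∣ g x - g y) :
    IsArcSplit q f g x y ∨ IsArcSplit q f g y (x + q) := by
  have hx := hs x
  have hy := hs y
  rcases eq_or_eq_of_dvd hf h1 h2 h3 with a | a <;> rcases eq_or_eq_of_dvd hg h1 h2 h4 with b | b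
  · exact absurd hx (by simpa using ⟨not_lt.1 (hf.mono.not_lt_of_eq a le_rfl h1),
      not_lt.1 (hg.mono.not_lt_of_eq b le_rfl h1)⟩)
  · right
    refine ⟨h2, by omega, by rw [hf.shift, hf.shift, a], b, fun n hn hn' => ?_, fun n hn hn' => ?_⟩
    · exact (hs n).resolve_right (hg.mono.not_lt_of_eq b hn hn')
    · have hn2 := (hs (n - q)).resolve_left
        (hf.mono.not_lt_of_eq a (show x ≤ n - q by omega) (by omega))
      have e1 := hg.shift (n - q)
      have e2 := hg.shift (n - q + 1)
      rw [show n - q + 1 + q = n + 1 by ring] at e2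
      rw [show n - q + q = n by ring] at e1
      omega
  · left
    exact ⟨h1, h2, a, b, fun n hn hn' => (hs n).resolve_right (hg.mono.not_lt_of_eq b hn hn'),
      fun n hn hn' => (hs n).resolve_left (hf.mono.not_lt_of_eq a hn hn')⟩
  · exact absurd hy (by simpa using ⟨not_lt.1 (hf.mono.not_lt_of_eq a le_rfl h2),
      not_lt.1 (hg.mono.not_lt_of_eq b le_rfl h2)⟩)

theorem IsDegOne.lt_shift (hf : IsDegOne q f) {n : ℤ} (k : ℤ) (h : f n < f (n + 1)) :
    f (n + k * q) < f (n + k * q + 1) := by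
  rw [show n + k * q + 1 = n + 1 + k * q by ring, hf.shift_mul, hf.shift_mul]
  omega

theorem IsArcSplit.shift_mul (hf : IsDegOne q f) (hg : IsDegOne q g) {x y : ℤ}
    (h : IsArcSplit q f g x y) (k : ℤ) : IsArcSplit q f g (x + k * q) (y + k * q) := by
  refine ⟨by linarith [h.lt], by linarith [h.lt'], ?_, ?_, fun n h1 h2 => ?_, fun n h1 h2 => ?_⟩
  · rw [show x + k * q + q = x + q + k * q by ring, hf.shift_mul, hf.shift_mul, h.f_eq]
  · rw [hg.shift_mul, hg.shift_mul, h.g_eq]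
  · have := hf.lt_shift k (h.f_lt (n - k * q) (by linarith) (by linarith))
    rwa [sub_add_cancel] at this
  · have := hg.lt_shift k (h.g_lt (n - k * q) (by linarith) (by linarith))
    rwa [sub_add_cancel] at this

theorem exists_shift_mem {q : ℕ} (hq : 0 < q) (c x : ℤ) :
    ∃ k : ℤ, c ≤ x + k * q ∧ x + k * q < c + q := by
  have hq' : (0 : ℤ) < q := by exact_mod_cast hq
  refine ⟨-((x - c) / q), ?_, ?_⟩
  · have := Int.ediv_mul_le (x - c) hq'.ne'
    linarith
  · have := Int.lt_ediv_add_one_mul_self (x - c) hq'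
    linarith

/-- A split can be read off from the gaps where `f` jumps and those where it does not, so its ends
are determined modulo `q`. This identifies the ends of the split with any sink found later. -/
theorem IsArcSplit.unique (hf : IsDegOne q f) (hg : IsDegOne q g) {x y u v : ℤ}
    (h : IsArcSplit q f g x y) (h' : IsArcSplit q f g u v) :
    ∃ k : ℤ, x = u + k * q ∧ y = v + k * q := by
  have hq : 0 < q := by have := h.lt; have := h.lt'; omega
  obtain ⟨k, hk1, hk2⟩ := exists_shift_mem hq x u
  have h2 := h'.shift_mul hf hg k
  refine ⟨k, ?_⟩
  set u' := u + k * q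
  set v' := v + k * q
  have hu : x = u' := by
    by_contra hne
    rcases lt_or_ge u' y with hy | hy
    · have a := h.f_lt (u' - 1) (by omega) (by omega)
      have b := hf.lt_shift 1 a
      exact hf.mono.not_lt_of_eq h2.f_eq (by have := h2.lt'; omega) (by omega) b
    · exact hg.mono.not_lt_of_eq h2.g_eq le_rfl h2.lt (h.g_lt u' hy hk2)
  refine ⟨hu, ?_⟩
  have h3 := h2.lt
  have h4 := h2.lt'
  rcases lt_trichotomy y v' with hv | hv | hv
  · exact absurd (h.g_lt y le_rfl h.lt') (hg.mono.not_lt_of_eq h2.g_eq (by have := h.lt; omega) hv)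
  · exact hv
  · exact absurd (h.f_lt v' (by omega) hv) (hf.mono.not_lt_of_eq h2.f_eq le_rfl h4)

end Pair

namespace TightSystem

variable {q : ℕ} {f g : ℤ → ℤ}

theorem deg_left (h : TightSystem q ![f, g]) : IsDegOne q f := h.deg 0

theorem deg_right (h : TightSystem q ![f, g]) : IsDegOne q g := h.deg 1

theorem lt_or_lt (h : TightSystem q ![f, g]) (n : ℤ) : f n < f (n + 1) ∨ g n < g (n + 1) := by
  simpa [Fin.exists_fin_two] using h.stable n

theorem mem_or_mem (h : TightSystem q ![f, g]) (m : ℤ) : m ∈ Set.range f ∨ m ∈ Set.range g := by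
  simpa [Fin.exists_fin_two] using h.unstable m

theorem swap (h : TightSystem q ![f, g]) : TightSystem q ![g, f] where
  pos := h.pos
  deg i := by
    fin_cases i
    · exact h.deg 1
    · exact h.deg 0
  stable n := by
    have := h.lt_or_lt n
    simpa [Fin.exists_fin_two] using this.symm
  unstable m := by
    have := h.mem_or_mem m
    simpa [Fin.exists_fin_two] using this.symm
  hyp := by
    obtain ⟨k, hk⟩ := h.hyp
    refine ⟨k, fun w hw => ?_⟩
    have : evalWord ![g, f] w = evalWord ![f, g] (w.map (Equiv.swap 0 1)) := by
      clear hw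
      induction w with
      | nil => rfl
      | cons i w ih =>
        rw [List.map_cons, evalWord, evalWord, ih]
        fin_cases i <;> rfl
    rw [this]
    exact hk _ (by simpa using hw)

theorem exists_shift_of_not_dvd {q : ℕ} (hq : 0 < q) {x y : ℤ} (h : ¬ (q : ℤ) ∣ x - y) :
    ∃ k : ℤ, x < y + k * q ∧ y + k * q < x + q := by
  obtain ⟨k, h1, h2⟩ := exists_shift_mem hq x y
  refine ⟨k, lt_of_le_of_ne h1 fun e => h ⟨k, by linarith⟩, h2⟩

theorem arcSplit_of_sink (h : TightSystem q ![f, g]) {x y : ℤ} (hne : ¬ (q : ℤ) ∣ x - y)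
    (hf : (q : ℤ) ∣ f x - f y) (hg : (q : ℤ) ∣ g x - g y) :
    ∃ k : ℤ, IsArcSplit q f g x (y + k * q) ∨ IsArcSplit q f g (y + k * q) (x + q) := by
  obtain ⟨k, h1, h2⟩ := exists_shift_of_not_dvd h.pos hne
  refine ⟨k, isArcSplit_of_sink h.deg_left h.deg_right h.lt_or_lt h1 h2 ?_ ?_⟩
  · rw [h.deg_left.shift_mul, ← sub_sub]
    exact dvd_sub hf (dvd_mul_left _ _)
  · rw [h.deg_right.shift_mul, ← sub_sub]
    exact dvd_sub hg (dvd_mul_left _ _)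

theorem exists_arcSplit (h : TightSystem q ![f, g]) (hq : 2 ≤ q) :
    ∃ x y, IsArcSplit q f g x y := by
  obtain ⟨x, y, hne, hi⟩ := h.exists_sink (fun x y => (q : ℤ) ∣ x - y) (fun _ _ h => h)
    ⟨1, 0, by
      rw [sub_zero]
      intro hd
      have := Int.le_of_dvd one_pos hd
      omega⟩
  obtain ⟨k, hk | hk⟩ := h.arcSplit_of_sink hne (hi 0) (hi 1)
  · exact ⟨_, _, hk⟩
  · exact ⟨_, _, hk⟩

/-- The two images are complementary arcs. -/
theorem exists_range_split (h : TightSystem q ![f, g]) (hq : 2 ≤ q) :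
    ∃ c d : ℤ, c ≤ d ∧ d + 1 < c + q ∧
      (∀ m, c ≤ m → m ≤ d → m ∈ Set.range f ∧ m ∉ Set.range g) ∧
      (∀ m, d < m → m < c + q → m ∈ Set.range g ∧ m ∉ Set.range f) := by
  have hd : TightSystem q ![upperAdj f, upperAdj g] := by
    have := h.dual
    have e : (fun i => upperAdj (![f, g] i)) = ![upperAdj f, upperAdj g] := by
      funext i; fin_cases i <;> rfl
    rwa [e] at this
  obtain ⟨x, y, hxy⟩ := hd.exists_arcSplit hq
  -- A point `m` is a value of `φ` exactly when the upper adjoint jumps across `(m - 1, m)`; the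
  -- split of the dual system therefore describes the two images.
  have mem : ∀ {φ : ℤ → ℤ}, IsDegOne q φ → ∀ m, upperAdj φ (m - 1) < upperAdj φ m →
      m ∈ Set.range φ := by
    intro φ hφ m hm
    have gc := hφ.gc h.pos
    refine ⟨upperAdj φ m, ?_⟩
    have h1 := (gc _ m).2 le_rfl
    have h2 := mt (gc (upperAdj φ m) (m - 1)).1 (by omega)
    omega
  have notMem : ∀ {φ : ℤ → ℤ}, IsDegOne q φ → ∀ m, ¬ upperAdj φ (m - 1) < upperAdj φ m →
      m ∉ Set.range φ := by
    rintro φ hφ m hm ⟨n, rfl⟩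
    have gc := hφ.gc h.pos
    have h1 := (gc n _).1 le_rfl
    have h2 := (gc n (φ n - 1)).2 (by omega)
    omega
  have hf := hd.deg_left.mono
  have hg := hd.deg_right.mono
  have := hxy.lt
  have := hxy.lt'
  -- The dual gap `(m - 1, m)` corresponds to the value `m`, so the gaps of `[x, y]` give the values
  -- `x + 1, …, y`.
  refine ⟨x + 1, y, by omega, by omega, fun m h1 h2 => ⟨mem h.deg_left m ?_, notMem h.deg_right m ?_⟩,
    fun m h1 h2 => ⟨mem h.deg_right m ?_, notMem h.deg_left m ?_⟩⟩
  · have := hxy.f_lt (m - 1) (by omega) (by omega)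
    rwa [sub_add_cancel] at this
  · have := hg.not_lt_of_eq hxy.g_eq (n := m - 1) (by omega) (by omega)
    rwa [sub_add_cancel] at this
  · have := hxy.g_lt (m - 1) (by omega) (by omega)
    rwa [sub_add_cancel] at this
  · have := hf.not_lt_of_eq hxy.f_eq (n := m - 1) (by omega) (by omega)
    rwa [sub_add_cancel] at this

theorem range_shift {φ : ℤ → ℤ} (hφ : IsDegOne q φ) {m : ℤ} (k : ℤ) :
    m + k * q ∈ Set.range φ ↔ m ∈ Set.range φ := by
  constructor
  · rintro ⟨n, hn⟩
    exact ⟨n + (-k) * q, by rw [hφ.shift_mul, hn]; ring⟩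
  · rintro ⟨n, rfl⟩
    exact ⟨n + k * q, by rw [hφ.shift_mul]⟩

theorem disjoint_range (h : TightSystem q ![f, g]) (hq : 2 ≤ q) :
    Disjoint (Set.range f) (Set.range g) := by
  obtain ⟨c, d, -, -, h3, h4⟩ := h.exists_range_split hq
  rw [Set.disjoint_left]
  intro m hm hm'
  obtain ⟨k, h1, h2⟩ := exists_shift_mem h.pos c m
  rw [← range_shift h.deg_left k] at hm
  rw [← range_shift h.deg_right k] at hm'
  rcases le_or_gt (m + k * q) d with h5 | h5
  · exact (h3 _ h1 h5).2 hm'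
  · exact (h4 _ h5 h2).2 hm

/-- For rank at least three, both ends of the arcs of constancy belong to the same image. -/
theorem exists_ends_mem (h : TightSystem q ![f, g]) (hq : 3 ≤ q) :
    ∃ x y, IsArcSplit q f g x y ∧ ((x ∈ Set.range f ∧ y ∈ Set.range f) ∨
      (x ∈ Set.range g ∧ y ∈ Set.range g)) := by
  obtain ⟨x, y, hxy⟩ := h.exists_arcSplit (by omega)
  refine ⟨x, y, hxy, ?_⟩
  have hf := h.deg_left
  have hg := h.deg_right
  -- A second use of sinks, for the coarser relation "identified by both maps". At such a sink one
  -- of the maps, `φ`, separates `u` and `v`, and then `φ u`, `φ v` form a sink for congruence. By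
  -- uniqueness these are the ends of the split, so both ends are values of `φ`.
  set E : ℤ → ℤ → Prop := fun u v => (q : ℤ) ∣ f u - f v ∧ (q : ℤ) ∣ g u - g v with hE
  obtain ⟨u, v, hne, hi⟩ := h.exists_sink E (fun u v huv => ⟨hf.dvd huv, hg.dvd huv⟩) (by
    by_contra hall
    push Not at hall
    -- If `E` held everywhere, each map would be constant modulo `q`, each of its jumps would be at
    -- least `q`, and it would jump only once per period. For `q ≥ 3` one of the two arcs has two
    -- gaps, on which the same map jumps.
    have key : ∀ {φ : ℤ → ℤ}, IsDegOne q φ → (∀ u v, (q : ℤ) ∣ φ u - φ v) →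
        ∀ a b : ℤ, a < b → b < a + q → φ a < φ (a + 1) → φ b < φ (b + 1) → False := by
      intro φ hφ hc a b h1 h2 h3 h4
      have e1 := Int.le_of_dvd (by linarith) (hc (a + 1) a)
      have e2 := Int.le_of_dvd (by linarith) (hc (b + 1) b)
      have e3 := hφ.mono (show a + 1 ≤ b by omega)
      have e4 := hφ.mono (show b + 1 ≤ a + q by omega)
      rw [hφ.shift] at e4
      omega
    have k1 := key hf (fun u v => (hall u v).1)
    have k2 := key hg (fun u v => (hall u v).2)
    have := hxy.lt
    have := hxy.lt'
    rcases lt_or_ge (x + 1) y with hy | hy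
    · exact k1 x (x + 1) (by omega) (by omega) (hxy.f_lt x le_rfl (by omega))
        (hxy.f_lt (x + 1) (by omega) hy)
    · exact k2 y (y + 1) (by omega) (by omega) (hxy.g_lt y le_rfl (by omega))
        (hxy.g_lt (y + 1) (by omega) (by omega)))
  have ends : ∀ {φ : ℤ → ℤ}, IsDegOne q φ → ¬ (q : ℤ) ∣ φ u - φ v → E (φ u) (φ v) →
      x ∈ Set.range φ ∧ y ∈ Set.range φ := by
    intro φ hφ hn he
    obtain ⟨k, hk | hk⟩ := h.arcSplit_of_sink hn he.1 he.2
    · obtain ⟨j, e1, e2⟩ := hxy.unique hf hg hk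
      rw [e1, e2, range_shift hφ, range_shift hφ, range_shift hφ]
      exact ⟨⟨u, rfl⟩, ⟨v, rfl⟩⟩
    · obtain ⟨j, e1, e2⟩ := hxy.unique hf hg hk
      rw [e1, e2, range_shift hφ, range_shift hφ, range_shift hφ]
      refine ⟨⟨v, rfl⟩, ⟨u + q, hφ.shift u⟩⟩
  have hn : ¬ (q : ℤ) ∣ f u - f v ∨ ¬ (q : ℤ) ∣ g u - g v := by
    by_contra hcon
    push Not at hcon
    exact hne hcon
  rcases hn with hn | hn
  · exact Or.inl (ends hf hn (hi 0))
  · exact Or.inr (ends hg hn (hi 1))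

end TightSystem

/-! ### Reduction to the image of one map -/

/-- `ι` enumerates the image of `f`; its complement is an image under `g` and lies, together with
the adjacent points, in arcs where `g` is constant and `f` is injective. -/
structure IsReduction (q q' : ℕ) (f g ι : ℤ → ℤ) : Prop where
  two_le : 2 ≤ q'
  lt : q' < q
  strictMono : StrictMono ι
  shift : ∀ n, ι (n + q') = ι n + q
  f_mem : ∀ x, f x ∈ Set.range ι
  mem_range_f : ∀ n, ι n ∈ Set.range f
  g_notMem : ∀ x, g x ∉ Set.range ι
  exists_g : ∀ x ∉ Set.range ι, ∃ n, g (ι n) = x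
  f_lt : ∀ x, ¬ (x ∈ Set.range ι ∧ x + 1 ∈ Set.range ι) → f x < f (x + 1)
  g_const : ∀ x ∉ Set.range ι, ∃ n, ι n < x ∧ x < ι (n + 1) ∧ g (ι n) = g x ∧ g x = g (ι (n + 1))

/-- The increasing enumeration of the integers congruent modulo `q` to one of
`c, …, c + q' - 1`. -/
def blockEnum (q q' : ℕ) (c n : ℤ) : ℤ := c + n % q' + q * (n / q')

section BlockEnum

variable {q q' : ℕ} (c : ℤ)

theorem blockEnum_shift (h0 : 0 < q') (n : ℤ) :
    blockEnum q q' c (n + q') = blockEnum q q' c n + q := by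
  have : (q' : ℤ) ≠ 0 := by exact_mod_cast h0.ne'
  unfold blockEnum
  rw [Int.add_emod_right, Int.add_ediv_of_dvd_right dvd_rfl, Int.ediv_self this]
  ring

theorem blockEnum_eq (h0 : 0 < q') {r k : ℤ} (h1 : 0 ≤ r) (h2 : r < q') :
    blockEnum q q' c (r + k * q') = c + r + k * q := by
  have : (q' : ℤ) ≠ 0 := by exact_mod_cast h0.ne'
  unfold blockEnum
  rw [Int.add_mul_emod_self_right, Int.add_mul_ediv_right _ _ this, Int.emod_eq_of_lt h1 h2,
    Int.ediv_eq_zero_of_lt h1 h2]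
  ring

theorem exists_rep (h0 : 0 < q') (n : ℤ) : ∃ r k : ℤ, 0 ≤ r ∧ r < q' ∧ n = r + k * q' := by
  have h0' : (0 : ℤ) < q' := by exact_mod_cast h0
  exact ⟨n % q', n / q', Int.emod_nonneg _ h0'.ne', Int.emod_lt_of_pos _ h0',
    by rw [mul_comm]; exact (Int.emod_add_mul_ediv n q').symm⟩

theorem blockEnum_strictMono (h0 : 0 < q') (hq : q' ≤ q) : StrictMono (blockEnum q q' c) := by
  refine strictMono_int_of_lt_succ fun n => ?_
  obtain ⟨r, k, h1, h2, rfl⟩ := exists_rep h0 n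
  rw [blockEnum_eq c h0 h1 h2]
  rcases lt_or_ge (r + 1) q' with h | h
  · rw [show r + k * q' + 1 = (r + 1) + k * q' by ring, blockEnum_eq c h0 (by omega) h]
    omega
  · rw [show r + k * q' + 1 = 0 + (k + 1) * q' by nlinarith, blockEnum_eq c h0 le_rfl (by omega)]
    nlinarith

theorem mem_range_blockEnum (h0 : 0 < q') {x : ℤ} :
    x ∈ Set.range (blockEnum q q' c) ↔ ∃ k : ℤ, c ≤ x + k * q ∧ x + k * q < c + q' := by
  constructor
  · rintro ⟨n, rfl⟩
    obtain ⟨r, k, h1, h2, rfl⟩ := exists_rep h0 n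
    exact ⟨-k, by rw [blockEnum_eq c h0 h1 h2]; constructor <;> linarith⟩
  · rintro ⟨k, h1, h2⟩
    exact ⟨(x + k * q - c) + (-k) * q', by
      rw [blockEnum_eq c h0 (by linarith) (by linarith)]; ring⟩

end BlockEnum

namespace TightSystem

variable {q : ℕ} {f g : ℤ → ℤ}

/-- The image of `f` is a block `[c, d]` modulo `q`, placed so as to contain `x`. It has at most `y
- x` elements, so the value `y` must belong to the next copy of the block. The whole complementary
block, with its two neighbours, then lies in `[x, y]`, where `g` is constant and `f` injective. -/
theorem exists_reduction_of_mem (h : TightSystem q ![f, g]) (hq : 3 ≤ q) {x y : ℤ}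
    (hxy : IsArcSplit q f g x y) (hx : x ∈ Set.range f) (hy : y ∈ Set.range f) :
    ∃ q' ι, IsReduction q q' f g ι := by
  obtain ⟨c₀, d₀, h1₀, h2₀, h3₀, h4₀⟩ := h.exists_range_split (by omega)
  have hf := h.deg_left
  have hg := h.deg_right
  obtain ⟨k₀, hk1, hk2⟩ := exists_shift_mem h.pos (x - q + 1) c₀
  obtain ⟨c, d, h1, h2, hcx, hxc, h3, h4⟩ : ∃ c d : ℤ, c ≤ d ∧ d + 1 < c + q ∧ c ≤ x ∧ x < c + q ∧
      (∀ m, c ≤ m → m ≤ d → m ∈ Set.range f ∧ m ∉ Set.range g) ∧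
      (∀ m, d < m → m < c + q → m ∈ Set.range g ∧ m ∉ Set.range f) := by
    refine ⟨c₀ + k₀ * q, d₀ + k₀ * q, by linarith, by linarith, by linarith, by linarith,
      fun m e1 e2 => ?_, fun m e1 e2 => ?_⟩
    · have := h3₀ (m - k₀ * q) (by linarith) (by linarith)
      rw [← range_shift hf k₀, ← range_shift hg k₀, sub_add_cancel] at this
      exact this
    · have := h4₀ (m - k₀ * q) (by linarith) (by linarith)
      rw [← range_shift hf k₀, ← range_shift hg k₀, sub_add_cancel] at this
      exact this
  have hxd : x ≤ d := by
    by_contra hcon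
    exact (h4 x (by omega) hxc).2 hx
  have hq0 : (0 : ℤ) < q := by exact_mod_cast h.pos
  have l1 := hxy.lt
  have l2 := hxy.lt'
  -- Every value of `f` modulo `q` is attained on `[x, y)`: on the rest of the period `f` is
  -- constant, equal to `f (x + q)`, which is congruent to `f x`.
  have hcard : d + 1 - c ≤ y - x := by
    have hle : (Finset.Ico c (d + 1)).card ≤ (Finset.Ico x y).card := by
      refine Finset.card_le_card_of_surjOn (fun n => c + (f n - c) % q) ?_
      intro m hm
      simp only [Finset.coe_Ico, Set.mem_Ico] at hm
      obtain ⟨n, hn⟩ := (h3 m hm.1 (by omega)).1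
      obtain ⟨k, e1, e2⟩ := exists_shift_mem h.pos x n
      have hfk := hf.shift_mul n k
      have hmod : ∀ j : ℤ, c + (m + j * q - c) % q = m := by
        intro j
        rw [show m + j * q - c = m - c + j * q by ring, Int.add_mul_emod_self_right,
          Int.emod_eq_of_lt (by omega) (by omega)]
        ring
      rcases lt_or_ge (n + k * q) y with hlt | hge
      · refine ⟨n + k * q, by simpa using ⟨e1, hlt⟩, ?_⟩
        simp only
        rw [hfk, hn, hmod]
      · refine ⟨x, by simpa using l1, ?_⟩
        have e3 := hf.mono hge
        have e4 := hf.mono e2.le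
        have e5 := hxy.f_eq
        rw [hf.shift] at e4 e5
        have : f x = m + (k - 1) * q := by
          rw [← hn]
          linarith
        simp only
        rw [this, hmod]
    rw [Int.card_Ico, Int.card_Ico] at hle
    omega
  -- If `y ≤ d`, then `y - x ≤ d - c`, against the count; and `d < y < c + q` would put `y` in the
  -- image of `g` only.
  have hyc : c + q ≤ y := by
    by_contra hcon
    rcases le_or_gt y d with hyd | hyd
    · omega
    · exact (h4 y hyd (by omega)).2 hy
  obtain ⟨q', hq'⟩ : ∃ q' : ℕ, (q' : ℤ) = d + 1 - c := ⟨(d + 1 - c).toNat, by omega⟩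
  have h0 : 0 < q' := by omega
  have hlt : q' < q := by omega
  have hsm := blockEnum_strictMono (q := q) c h0 hlt.le
  have hmem : ∀ m, m ∈ Set.range (blockEnum q q' c) ↔ m ∈ Set.range f := by
    intro m
    rw [mem_range_blockEnum c h0]
    constructor
    · rintro ⟨k, e1, e2⟩
      rw [← range_shift hf k]
      exact (h3 _ e1 (by omega)).1
    · intro hm
      obtain ⟨k, e1, e2⟩ := exists_shift_mem h.pos c m
      refine ⟨k, e1, ?_⟩
      by_contra hcon
      rw [← range_shift hf k] at hm
      exact (h4 _ (by omega) e2).2 hm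
  have hdisj := h.disjoint_range (by omega)
  have hgm : ∀ m, m ∉ Set.range (blockEnum q q' c) → m ∈ Set.range g := fun m hm =>
    (h.mem_or_mem m).resolve_left fun e => hm ((hmem m).2 e)
  have gap : ∀ m, m ∉ Set.range (blockEnum q q' c) → ∃ k : ℤ, d < m + k * q ∧ m + k * q < c + q := by
    intro m hm
    obtain ⟨k, e1, e2⟩ := exists_shift_mem h.pos c m
    refine ⟨k, ?_, e2⟩
    by_contra hcon
    exact hm ((mem_range_blockEnum c h0).2 ⟨k, e1, by omega⟩)
  have hend : ∀ k : ℤ, blockEnum q q' c (q' - 1 + k * q') = d + k * q := fun k => by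
    rw [blockEnum_eq c h0 (by omega) (by omega)]
    linarith
  have hbeg : ∀ k : ℤ, blockEnum q q' c (q' - 1 + k * q' + 1) = c + q + k * q := fun k => by
    rw [show (q' : ℤ) - 1 + k * q' + 1 = 0 + (k + 1) * q' by ring,
      blockEnum_eq c h0 le_rfl (by omega)]
    ring
  have gconst : ∀ m, m ∉ Set.range (blockEnum q q' c) → ∃ n, blockEnum q q' c n < m ∧
      m < blockEnum q q' c (n + 1) ∧ g (blockEnum q q' c n) = g m ∧
      g m = g (blockEnum q q' c (n + 1)) := by
    intro m hm
    obtain ⟨k, e1, e2⟩ := gap m hm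
    refine ⟨q' - 1 + (-k) * q', ?_⟩
    have gk : g m + k * q = g x := by
      rw [← hg.shift_mul]
      refine le_antisymm ?_ ?_
      · rw [hxy.g_eq]; exact hg.mono (by omega)
      · exact hg.mono (by omega)
    have gd : g d = g x := le_antisymm (by rw [hxy.g_eq]; exact hg.mono (by omega))
      (hg.mono hxd)
    have gc : g (c + q) = g x := le_antisymm (by rw [hxy.g_eq]; exact hg.mono (by omega))
      (hg.mono (by omega))
    rw [hend, hbeg, hg.shift_mul, hg.shift_mul, gd, gc]
    refine ⟨?_, ?_, ?_, ?_⟩ <;> linarith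
  refine ⟨q', blockEnum q q' c, ⟨by omega, hlt, hsm, blockEnum_shift c h0,
    fun z => (hmem _).2 ⟨z, rfl⟩, fun n => (hmem _).1 ⟨n, rfl⟩,
    fun z hz => Set.disjoint_left.1 hdisj ((hmem _).1 hz) ⟨z, rfl⟩, ?_, ?_, gconst⟩⟩
  · intro m hm
    obtain ⟨z, rfl⟩ := hgm m hm
    by_cases hz : z ∈ Set.range (blockEnum q q' c)
    · obtain ⟨n, rfl⟩ := hz
      exact ⟨n, rfl⟩
    · obtain ⟨n, -, -, e, -⟩ := gconst z hz
      exact ⟨n, e⟩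
  · intro z hz
    obtain ⟨k, e1, e2⟩ : ∃ k : ℤ, d ≤ z + k * q ∧ z + k * q < c + q := by
      by_cases hz1 : z ∈ Set.range (blockEnum q q' c)
      · obtain ⟨k, e1, e2⟩ := gap (z + 1) fun e => hz ⟨hz1, e⟩
        exact ⟨k, by omega, by omega⟩
      · obtain ⟨k, e1, e2⟩ := gap z hz1
        exact ⟨k, by omega, by omega⟩
    have := hf.lt_shift (-k) (hxy.f_lt (z + k * q) (by omega) (by omega))
    rwa [neg_mul, add_neg_cancel_right] at this

theorem exists_reduction (h : TightSystem q ![f, g]) (hq : 3 ≤ q) :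
    (∃ q' ι, IsReduction q q' f g ι) ∨ ∃ q' ι, IsReduction q q' g f ι := by
  obtain ⟨x, y, hxy, ⟨hx, hy⟩ | ⟨hx, hy⟩⟩ := h.exists_ends_mem hq
  · exact Or.inl (h.exists_reduction_of_mem hq hxy hx hy)
  · refine Or.inr (h.swap.exists_reduction_of_mem hq (x := y) (y := x + q)
      ⟨hxy.lt', by linarith [hxy.lt], ?_, hxy.f_eq, hxy.g_lt, ?_⟩ hy ?_)
    · rw [h.deg_right.shift, h.deg_right.shift, hxy.g_eq]
    · intro n h1 h2
      have := h.deg_left.lt_shift 1 (hxy.f_lt (n - q) (by omega) (by omega))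
      rwa [one_mul, sub_add_cancel] at this
    · have := (range_shift h.deg_right (m := x) 1).2 hx
      rwa [one_mul] at this

end TightSystem

/-! ### Counting values modulo `q` -/

/-- The number of values modulo `q`. -/
noncomputable def imCard (q : ℕ) (f : ℤ → ℤ) : ℕ := (Set.range fun n => (f n : ZMod q)).ncard

theorem TightSystem.imCard_add {q : ℕ} {f g : ℤ → ℤ} (h : TightSystem q ![f, g]) (hq : 2 ≤ q) :
    imCard q f + imCard q g = q := by
  have : NeZero q := ⟨by omega⟩
  rw [imCard, imCard, ← Set.ncard_union_eq]
  · have : (Set.range fun n => (f n : ZMod q)) ∪ (Set.range fun n => (g n : ZMod q)) = Set.univ := by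
      refine Set.eq_univ_of_forall fun z => ?_
      obtain ⟨m, rfl⟩ := ZMod.intCast_surjective z
      rcases h.mem_or_mem m with ⟨n, hn⟩ | ⟨n, hn⟩
      · exact Or.inl ⟨n, by simp [hn]⟩
      · exact Or.inr ⟨n, by simp [hn]⟩
    rw [this, Set.ncard_univ, Nat.card_zmod]
  · rw [Set.disjoint_left]
    rintro z ⟨n, rfl⟩ ⟨m, hm⟩
    obtain ⟨k, hk⟩ := (ZMod.intCast_eq_intCast_iff_dvd_sub (g m) (f n) q).1 hm
    refine Set.disjoint_left.1 (h.disjoint_range hq) ⟨n, rfl⟩ ?_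
    rw [show f n = g m + k * q by linarith, range_shift h.deg_right]
    exact ⟨m, rfl⟩

theorem one_le_imCard {q : ℕ} (hq : 0 < q) (f : ℤ → ℤ) : 1 ≤ imCard q f := by
  have : NeZero q := ⟨hq.ne'⟩
  exact (Set.ncard_pos (Set.toFinite _)).2 ⟨_, 0, rfl⟩

/-- The assignment `f n ↦ f' (F n)` is well defined and injective on residues by `h1`, and
surjective by `h2`. The function `s` selects a preimage of each residue. -/
theorem imCard_eq_of_bij {q q' : ℕ} {f f' : ℤ → ℤ} (F : ℤ → ℤ)
    (h1 : ∀ n m, (q : ℤ) ∣ f n - f m ↔ (q' : ℤ) ∣ f' (F n) - f' (F m))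
    (h2 : ∀ m, ∃ n, (q' : ℤ) ∣ f' (F n) - f' m) : imCard q f = imCard q' f' := by
  have hs : ∀ z : ZMod q, ∃ n, z ∈ (Set.range fun n => (f n : ZMod q)) → (f n : ZMod q) = z := by
    intro z
    by_cases hz : z ∈ Set.range fun n => (f n : ZMod q)
    · obtain ⟨n, hn⟩ := hz
      exact ⟨n, fun _ => hn⟩
    · exact ⟨0, fun h => absurd h hz⟩
  choose s hs using hs
  refine Set.ncard_congr (fun z _ => (f' (F (s z)) : ZMod q')) (fun z _ => ⟨_, rfl⟩) ?_ ?_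
  · intro z w hz hw e
    rw [ZMod.intCast_eq_intCast_iff_dvd_sub, ← h1, ← ZMod.intCast_eq_intCast_iff_dvd_sub] at e
    rw [← hs z hz, ← hs w hw, e]
  · rintro w ⟨m, rfl⟩
    obtain ⟨n, hn⟩ := h2 m
    refine ⟨(f n : ZMod q), ⟨n, rfl⟩, ?_⟩
    have e1 := hs (f n) ⟨n, rfl⟩
    rw [ZMod.intCast_eq_intCast_iff_dvd_sub, h1] at e1
    rw [ZMod.intCast_eq_intCast_iff_dvd_sub, ← dvd_neg]
    have := dvd_sub hn e1
    rwa [sub_sub_sub_cancel_left, ← neg_sub] at this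

namespace IsReduction

variable {q q' : ℕ} {f g ι : ℤ → ℤ}

theorem shift_mul (R : IsReduction q q' f g ι) (n k : ℤ) : ι (n + k * q') = ι n + k * q := by
  induction k using Int.induction_on with
  | zero => simp
  | succ k ih =>
    have := R.shift (n + k * q')
    rw [ih] at this
    rw [show n + ((k : ℤ) + 1) * q' = n + k * q' + q' by ring, this]; ring
  | pred k ih =>
    have := R.shift (n + (-(k : ℤ) - 1) * q')
    rw [show n + (-(k : ℤ) - 1) * q' + q' = n + (-(k : ℤ)) * q' by ring, ih] at this
    linarith

theorem dvd_iff (R : IsReduction q q' f g ι) (a b : ℤ) :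
    (q : ℤ) ∣ ι a - ι b ↔ (q' : ℤ) ∣ a - b := by
  constructor
  · rintro ⟨k, hk⟩
    have : ι a = ι (b + k * q') := by rw [R.shift_mul]; linarith
    have := R.strictMono.injective this
    exact ⟨k, by rw [this]; ring⟩
  · rintro ⟨k, hk⟩
    rw [show a = b + k * q' by linarith, R.shift_mul]
    exact ⟨k, by ring⟩

theorem lt_of_lt (R : IsReduction q q' f g ι) (hf : IsDegOne q f) {u v : ℤ} (hu : u ∉ Set.range ι)
    (h : u < v) : f u < f v :=
  (R.f_lt u fun e => hu e.1).trans_le (hf.mono (by omega))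

/-- The image of `f` is preserved by `f` and by `f ∘ g`; these are the reduced maps. The values lost
by restricting `f` are recovered by `f ∘ g`, because the removed points are images `g (ι n)`. Long
words stay long under `a ↦ a`, `b ↦ ab`, which preserves hyperbolicity. -/
theorem exists_system (R : IsReduction q q' f g ι) (h : TightSystem q ![f, g]) :
    ∃ f' g' : ℤ → ℤ, (∀ n, ι (f' n) = f (ι n)) ∧ (∀ n, ι (g' n) = f (g (ι n))) ∧
      TightSystem q' ![f', g'] := by
  choose ρ hρ using R.f_mem
  have hf := h.deg_left
  have hg := h.deg_right
  have hdeg : ∀ (φ φ' : ℤ → ℤ), IsDegOne q φ → (∀ n, ι (φ' n) = φ (ι n)) → IsDegOne q' φ' := by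
    intro φ φ' hφ he
    refine ⟨fun a b hab => ?_, fun x => ?_⟩
    · rw [← R.strictMono.le_iff_le, he, he]
      exact hφ.mono (R.strictMono.monotone hab)
    · apply R.strictMono.injective
      rw [he, R.shift, hφ.shift, R.shift, he]
  have hf' : ∀ n, ι (ρ (ι n)) = f (ι n) := fun n => hρ _
  have hg' : ∀ n, ι (ρ (g (ι n))) = f (g (ι n)) := fun n => hρ _
  refine ⟨fun n => ρ (ι n), fun n => ρ (g (ι n)), hf', hg', ⟨by have := R.two_le; omega, ?_, ?_, ?_, ?_⟩⟩
  · intro i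
    fin_cases i
    · exact hdeg f _ hf hf'
    · exact hdeg (f ∘ g) _ (hf.comp hg) hg'
  · intro n
    rw [Fin.exists_fin_two]
    simp only [Matrix.cons_val_zero, Matrix.cons_val_one]
    rw [← R.strictMono.lt_iff_lt, ← R.strictMono.lt_iff_lt (a := ρ (g (ι n))), hf', hf', hg', hg']
    -- If `ι n` and `ι (n + 1)` are adjacent, one of `f`, `g` jumps between them, and a jump of `g`
    -- survives composition with `f`, which is strictly increasing to the right of removed points.
    -- If they are not adjacent, `f` itself jumps at `ι n`.
    by_cases h1 : ι n + 1 ∈ Set.range ι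
    · obtain ⟨m, hm⟩ := h1
      have : m = n + 1 := by
        have e1 : n < m := by rw [← R.strictMono.lt_iff_lt]; omega
        have e2 : m ≤ n + 1 := by
          rw [← R.strictMono.le_iff_le]
          have := R.strictMono (show n < n + 1 by omega)
          omega
        omega
      subst this
      rw [hm]
      rcases h.lt_or_lt (ι n) with e | e
      · exact Or.inl e
      · exact Or.inr (R.lt_of_lt hf (R.g_notMem _) e)
    · left
      have := R.strictMono (show n < n + 1 by omega)
      exact (R.f_lt (ι n) fun e => h1 e.2).trans_le (hf.mono (by omega))
  · intro m
    rw [Fin.exists_fin_two]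
    simp only [Matrix.cons_val_zero, Matrix.cons_val_one]
    obtain ⟨z, hz⟩ := R.mem_range_f m
    by_cases hzι : z ∈ Set.range ι
    · obtain ⟨n, rfl⟩ := hzι
      exact Or.inl ⟨n, R.strictMono.injective (by rw [hf', hz])⟩
    · obtain ⟨n, hn⟩ := R.exists_g z hzι
      exact Or.inr ⟨n, R.strictMono.injective (by rw [hg', hn, hz])⟩
  · obtain ⟨k, hk⟩ := h.hyp
    refine ⟨k, fun w hw x y => ?_⟩
    have key : ∀ w : List (Fin 2), ∃ v : List (Fin 2), w.length ≤ v.length ∧ ∀ n,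
        ι (evalWord ![fun n => ρ (ι n), fun n => ρ (g (ι n))] w n) = evalWord ![f, g] v (ι n) := by
      intro w
      induction w with
      | nil => exact ⟨[], le_rfl, fun n => rfl⟩
      | cons i w ih =>
        obtain ⟨v, hv, he⟩ := ih
        fin_cases i
        · refine ⟨0 :: v, by simpa using hv, fun n => ?_⟩
          simp only [evalWord, Function.comp, Fin.zero_eta, Matrix.cons_val_zero]
          rw [hf', he]
        · refine ⟨0 :: 1 :: v, by simp; omega, fun n => ?_⟩
          simp only [evalWord, Function.comp, Fin.mk_one, Matrix.cons_val_zero, Matrix.cons_val_one]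
          rw [hg', he]
    obtain ⟨v, hv, he⟩ := key w
    rw [← R.dvd_iff, he, he]
    exact hk v (hw.trans hv) _ _

theorem imCard_left (R : IsReduction q q' f g ι) : imCard q f = q' := by
  have h0 : 0 < q' := by have := R.two_le; omega
  have : NeZero q' := ⟨h0.ne'⟩
  choose ρ hρ using R.f_mem
  have : imCard q f = imCard q' id := imCard_eq_of_bij ρ
    (fun n m => by rw [← hρ n, ← hρ m, R.dvd_iff]; rfl)
    (fun m => by
      obtain ⟨n, hn⟩ := R.mem_range_f m
      refine ⟨n, ?_⟩
      rw [show ρ n = m from R.strictMono.injective (by rw [hρ, hn])]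
      simp)
  rw [this, imCard]
  have : (Set.range fun n : ℤ => ((id n : ℤ) : ZMod q')) = Set.univ :=
    Set.range_eq_univ.2 ZMod.intCast_surjective
  rw [this, Set.ncard_univ, Nat.card_zmod]

/-- The values of `g` are removed points, on which `f` is injective modulo `q`, so composing with
`f` merges none of them; and each is already taken on the image of `ι`. -/
theorem imCard_right (R : IsReduction q q' f g ι) (hf : IsDegOne q f)
    (hg : IsDegOne q g) {g' : ℤ → ℤ}
    (hg' : ∀ n, ι (g' n) = f (g (ι n))) : imCard q' g' = imCard q g := by
  refine imCard_eq_of_bij ι (fun n m => ?_) fun m => ?_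
  · rw [← R.dvd_iff, hg', hg']
    constructor
    · rintro ⟨k, hk⟩
      have e : f (g (ι n)) = f (g (ι (m + k * q'))) := by
        rw [R.shift_mul, hg.shift_mul, hf.shift_mul]; linarith
      have e2 : g (ι n) = g (ι (m + k * q')) := by
        rcases lt_trichotomy (g (ι n)) (g (ι (m + k * q'))) with h | h | h
        · exact absurd (R.lt_of_lt hf (R.g_notMem _) h) (by omega)
        · exact h
        · exact absurd (R.lt_of_lt hf (R.g_notMem _) h) (by omega)
      rw [R.shift_mul, hg.shift_mul] at e2
      exact ⟨k, by linarith⟩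
    · exact fun hd => hf.dvd hd
  · obtain ⟨n, hn⟩ := R.exists_g (g m) (R.g_notMem m)
    exact ⟨n, by rw [hn]; simp⟩

end IsReduction

/-! ### Angles on the projective line and lifts of matrices -/

namespace RP1

open Real

/-- The unit vector of angle `θ`, measured clockwise from the second axis. -/
noncomputable def angleVec (θ : ℝ) : Fin 2 → ℝ := ![sin θ, cos θ]

theorem angleVec_zero (θ : ℝ) : angleVec θ 0 = sin θ := rfl

theorem angleVec_one (θ : ℝ) : angleVec θ 1 = cos θ := rfl

theorem vec_ext {v w : Fin 2 → ℝ} (h0 : v 0 = w 0) (h1 : v 1 = w 1) : v = w := by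
  ext i
  fin_cases i
  · exact h0
  · exact h1

theorem angleVec_ne_zero (θ : ℝ) : angleVec θ ≠ 0 := fun h => by
  have h0 : sin θ = 0 := congrFun h 0
  have h1 : cos θ = 0 := congrFun h 1
  have := sin_sq_add_cos_sq θ
  rw [h0, h1] at this
  norm_num at this

/-- The line of angle `θ`. -/
noncomputable def line (θ : ℝ) : RP1 := Projectivization.mk ℝ (angleVec θ) (angleVec_ne_zero θ)

theorem det2_angleVec (s t : ℝ) : det2 (angleVec s) (angleVec t) = sin (s - t) := by
  simp [det2, angleVec, sin_sub]

theorem line_eq_iff_sin {s t : ℝ} : line s = line t ↔ sin (s - t) = 0 := by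
  rw [line, line, Projectivization.mk_eq_mk_iff']
  constructor
  · rintro ⟨a, ha⟩
    rw [← det2_angleVec, ← ha]
    simp [det2]; ring
  · intro h
    refine ⟨cos (s - t), ?_⟩
    have e : s = (s - t) + t := by ring
    ext i
    fin_cases i
    · simp only [angleVec, Pi.smul_apply, smul_eq_mul, Fin.zero_eta, Matrix.cons_val_zero]
      conv_rhs => rw [e, sin_add, h]
      ring
    · simp only [angleVec, Pi.smul_apply, smul_eq_mul, Fin.mk_one, Matrix.cons_val_one]
      conv_rhs => rw [e, cos_add, h]
      simp

theorem line_eq_iff {s t : ℝ} : line s = line t ↔ ∃ k : ℤ, s = t + k * π := by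
  rw [line_eq_iff_sin, sin_eq_zero_iff]
  constructor
  · rintro ⟨k, hk⟩; exact ⟨k, by linarith⟩
  · rintro ⟨k, hk⟩; exact ⟨k, by linarith⟩

theorem line_add_mul_pi (s : ℝ) (k : ℤ) : line (s + k * π) = line s := line_eq_iff.2 ⟨k, rfl⟩

theorem line_add_pi (s : ℝ) : line (s + π) = line s := line_eq_iff.2 ⟨1, by simp⟩

theorem mk_eq_line {v : Fin 2 → ℝ} (hv : v ≠ 0) {θ c : ℝ} (h : v = c • angleVec θ) :
    Projectivization.mk ℝ v hv = line θ := by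
  rw [line, Projectivization.mk_eq_mk_iff']
  exact ⟨c, h.symm⟩

theorem line_surjective : Function.Surjective line := by
  intro p
  induction p using Projectivization.ind with
  | h v hv =>
    by_cases h1 : v 1 = 0
    · refine ⟨π / 2, (mk_eq_line hv (c := v 0) ?_).symm⟩
      ext i; fin_cases i <;> simp [angleVec, h1]
    · refine ⟨arctan (v 0 / v 1), (mk_eq_line hv (c := v 1 / cos (arctan (v 0 / v 1))) ?_).symm⟩
      have hc := (cos_arctan_pos (v 0 / v 1)).ne'
      have ht := tan_arctan (v 0 / v 1)
      rw [tan_eq_sin_div_cos] at ht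
      refine vec_ext ?_ ?_
      · rw [Pi.smul_apply, smul_eq_mul, angleVec_zero, div_mul_eq_mul_div, mul_div_assoc, ht]
        field_simp
      · rw [Pi.smul_apply, smul_eq_mul, angleVec_one, div_mul_cancel₀ _ hc]

theorem smul_line_eq (A : SL(2, ℝ)) {θ φ c : ℝ}
    (h : (A : Matrix (Fin 2) (Fin 2) ℝ).mulVec (angleVec θ) = c • angleVec φ) :
    A • line θ = line φ :=
  mk_eq_line _ h

theorem exists_of_smul_line_eq {A : SL(2, ℝ)} {θ φ : ℝ} (h : A • line θ = line φ) :
    ∃ c : ℝ, (A : Matrix (Fin 2) (Fin 2) ℝ).mulVec (angleVec θ) = c • angleVec φ := by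
  have h' : Projectivization.mk ℝ (A • angleVec θ) ((smul_ne_zero_iff_ne A).mpr
    (angleVec_ne_zero θ)) = line φ := h
  rw [line, Projectivization.mk_eq_mk_iff'] at h'
  obtain ⟨c, hc⟩ := h'
  exact ⟨c, hc.symm⟩

/-- An increasing homeomorphism of the line of angles lifting the projective action of `A`. -/
structure IsLift (A : SL(2, ℝ)) (a : ℝ ≃o ℝ) : Prop where
  add_pi : ∀ θ, a (θ + π) = a θ + π
  smul_line : ∀ θ, A • line θ = line (a θ)

namespace IsLift

variable {A B : SL(2, ℝ)} {a b : ℝ ≃o ℝ}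

theorem add_mul_pi (h : IsLift A a) (θ : ℝ) (k : ℤ) : a (θ + k * π) = a θ + k * π := by
  induction k using Int.induction_on with
  | zero => simp
  | succ k ih =>
    have := h.add_pi (θ + (k : ℤ) * π)
    rw [ih] at this
    rw [show θ + ((k + 1 : ℤ) : ℝ) * π = θ + (k : ℤ) * π + π by push_cast; ring, this]
    push_cast; ring
  | pred k ih =>
    have := h.add_pi (θ + ((-(k : ℤ) - 1 : ℤ) : ℝ) * π)
    rw [show θ + ((-(k : ℤ) - 1 : ℤ) : ℝ) * π + π = θ + ((-(k : ℤ) : ℤ) : ℝ) * π by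
      push_cast; ring, ih] at this
    push_cast at this ⊢
    linarith

theorem one : IsLift 1 (OrderIso.refl ℝ) := ⟨fun _ => rfl, fun _ => one_smul _ _⟩

theorem mul (ha : IsLift A a) (hb : IsLift B b) : IsLift (A * B) (b.trans a) :=
  ⟨fun θ => by simp [hb.add_pi, ha.add_pi],
    fun θ => by rw [mul_smul, hb.smul_line, ha.smul_line]; rfl⟩

theorem inv (ha : IsLift A a) : IsLift A⁻¹ a.symm := by
  refine ⟨fun θ => ?_, fun θ => ?_⟩
  · rw [OrderIso.symm_apply_eq, ha.add_pi, OrderIso.apply_symm_apply]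
  · rw [inv_smul_eq_iff, ha.smul_line, OrderIso.apply_symm_apply]

theorem translate (ha : IsLift A a) (k : ℤ) :
    IsLift A (a.trans (OrderIso.addRight ((k : ℝ) * π))) :=
  ⟨fun θ => by simp [ha.add_pi]; ring,
    fun θ => by simp [ha.smul_line, line_add_mul_pi]⟩

end IsLift

/-- The rotation by the angle `φ`. -/
noncomputable def rotSL (φ : ℝ) : SL(2, ℝ) :=
  ⟨!![cos φ, sin φ; -sin φ, cos φ], by
    rw [Matrix.det_fin_two_of]; nlinarith [sin_sq_add_cos_sq φ]⟩

theorem isLift_rotSL (φ : ℝ) : IsLift (rotSL φ) (OrderIso.addRight φ) := by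
  refine ⟨fun θ => by simp; ring, fun θ => smul_line_eq _ (c := 1) ?_⟩
  ext i
  fin_cases i
  · simp [rotSL, angleVec, Matrix.mulVec, dotProduct, Fin.sum_univ_two, sin_add]; ring
  · simp [rotSL, angleVec, Matrix.mulVec, dotProduct, Fin.sum_univ_two, cos_add]; ring

/-- A matrix with positive symmetric part has a lift with displacement less than `π / 2`. -/
theorem exists_isLift_of_pos (A : SL(2, ℝ))
    (h : ∀ θ, 0 < (A : Matrix (Fin 2) (Fin 2) ℝ).mulVec (angleVec θ) ⬝ᵥ angleVec θ) :
    ∃ a : ℝ ≃o ℝ, IsLift A a ∧ ∀ θ, |a θ - θ| < π / 2 := by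
  set M := (A : Matrix (Fin 2) (Fin 2) ℝ) with hM
  set u : ℝ → ℝ := fun θ => M.mulVec (angleVec θ) ⬝ᵥ angleVec θ with hu
  set w : ℝ → ℝ := fun θ => M.mulVec (angleVec θ) ⬝ᵥ angleVec (θ + π / 2) with hw
  -- Here `u` and `w` are the components of the image vector along the directions `θ` and `θ + π /
  -- 2`. As `u > 0`, the rotation angle is `arctan (w / u)`, with no choice of branch.
  set F : ℝ → ℝ := fun θ => θ + arctan (w θ / u θ) with hF
  have hvec : Continuous angleVec := by
    refine continuous_pi fun i => ?_
    fin_cases i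
    · exact continuous_sin
    · exact continuous_cos
  have hcont : Continuous F := by
    have hMv : Continuous fun θ => M.mulVec (angleVec θ) := continuous_const.matrix_mulVec hvec
    have hcu : Continuous u := hMv.dotProduct hvec
    have hcw : Continuous w := hMv.dotProduct (hvec.comp (continuous_id.add continuous_const))
    exact continuous_id.add (continuous_arctan.comp (hcw.div hcu fun θ => (h θ).ne'))
  have hneg : ∀ θ, angleVec (θ + π) = -angleVec θ := fun θ => by
    ext i; fin_cases i <;> simp [angleVec, sin_add_pi, cos_add_pi]
  have hpi : ∀ θ, F (θ + π) = F θ + π := fun θ => by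
    simp only [hF, hu, hw]
    rw [show θ + π + π / 2 = θ + π / 2 + π by ring, hneg, hneg, Matrix.mulVec_neg,
      neg_dotProduct_neg, neg_dotProduct_neg]
    ring
  have hpik : ∀ θ (k : ℤ), F (θ + k * π) = F θ + k * π := fun θ k => by
    induction k using Int.induction_on with
    | zero => simp
    | succ k ih =>
      have := hpi (θ + (k : ℤ) * π)
      rw [ih] at this
      rw [show θ + ((k + 1 : ℤ) : ℝ) * π = θ + (k : ℤ) * π + π by push_cast; ring, this]
      push_cast; ring
    | pred k ih =>
      have := hpi (θ + ((-(k : ℤ) - 1 : ℤ) : ℝ) * π)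
      rw [show θ + ((-(k : ℤ) - 1 : ℤ) : ℝ) * π + π = θ + ((-(k : ℤ) : ℤ) : ℝ) * π by
        push_cast; ring, ih] at this
      push_cast at this ⊢
      linarith
  have hline : ∀ θ, A • line θ = line (F θ) := fun θ => by
    have hc := cos_arctan_pos (w θ / u θ)
    have ht := tan_arctan (w θ / u θ)
    rw [tan_eq_sin_div_cos, div_eq_div_iff hc.ne' (h θ).ne'] at ht
    have h1 := sin_sq_add_cos_sq θ
    refine smul_line_eq A (c := u θ / cos (arctan (w θ / u θ))) ?_
    change M.mulVec (angleVec θ) = _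
    have e0 : M.mulVec (angleVec θ) 0 = u θ * sin θ + w θ * cos θ := by
      simp only [hu, hw, dotProduct, Fin.sum_univ_two, angleVec, sin_add_pi_div_two,
        cos_add_pi_div_two, Matrix.cons_val_zero, Matrix.cons_val_one]
      linear_combination (-(M.mulVec ![sin θ, cos θ] 0)) * h1
    have e1 : M.mulVec (angleVec θ) 1 = u θ * cos θ - w θ * sin θ := by
      simp only [hu, hw, dotProduct, Fin.sum_univ_two, angleVec, sin_add_pi_div_two,
        cos_add_pi_div_two, Matrix.cons_val_zero, Matrix.cons_val_one]
      linear_combination (-(M.mulVec ![sin θ, cos θ] 1)) * h1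
    set δ := arctan (w θ / u θ)
    have e2 : u θ / cos δ * sin δ = w θ := by
      field_simp
      linarith
    have e3 : u θ / cos δ * cos δ = u θ := by field_simp
    refine vec_ext ?_ ?_
    · rw [Pi.smul_apply, smul_eq_mul, angleVec_zero, e0, sin_add]
      linear_combination (-cos θ) * e2 - sin θ * e3
    · rw [Pi.smul_apply, smul_eq_mul, angleVec_one, e1, cos_add]
      linear_combination (sin θ) * e2 - cos θ * e3
  have hdisp : ∀ θ, |F θ - θ| < π / 2 := fun θ => by
    simp only [hF, add_sub_cancel_left]
    exact abs_lt.2 ⟨neg_pi_div_two_lt_arctan _, arctan_lt_pi_div_two _⟩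
  have hinj : Function.Injective F := fun s t hst => by
    have e : line s = line t := by
      have : A • line s = A • line t := by rw [hline, hline, hst]
      exact smul_left_cancel A this
    obtain ⟨k, rfl⟩ := line_eq_iff.1 e
    rw [hpik] at hst
    linarith
  -- A continuous injective function on the line is strictly monotone, and `F (θ + π) = F θ + π`
  -- excludes the decreasing case.
  have hmono : StrictMono F := by
    rcases hcont.strictMono_of_inj hinj with hm | hm
    · exact hm
    · have := hm (show (0 : ℝ) < 0 + π by linarith [pi_pos])
      rw [hpi] at this
      linarith [pi_pos]
  have hsurj : Function.Surjective F := fun y => by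
    have h1 := abs_lt.1 (hdisp (y - π))
    have h2 := abs_lt.1 (hdisp (y + π))
    have hp := pi_pos
    obtain ⟨θ, -, hθ⟩ := intermediate_value_Icc (show y - π ≤ y + π by linarith)
      hcont.continuousOn (show y ∈ Set.Icc (F (y - π)) (F (y + π)) from
        ⟨by linarith, by linarith⟩)
    exact ⟨θ, hθ⟩
  exact ⟨hmono.orderIsoOfSurjective F hsurj, ⟨hpi, hline⟩, hdisp⟩

theorem line_injOn {s t : ℝ} (h : line s = line t) (hst : |s - t| < π) : s = t := by
  obtain ⟨k, rfl⟩ := line_eq_iff.1 h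
  rw [add_sub_cancel_left, abs_mul, abs_of_pos pi_pos] at hst
  have : |(k : ℝ)| < 1 := by
    by_contra hcon
    have := pi_pos
    nlinarith [not_lt.1 hcon]
  have : k = 0 := by
    rw [← Int.cast_abs] at this
    exact Int.abs_lt_one_iff.1 (by exact_mod_cast this)
  simp [this]

/-! ### Hyperbolic matrices for rank one and two -/

/-- The hyperbolic matrix whose attracting line has angle `0` and whose repelling line has slope
`σ⁻¹`. -/
noncomputable def wedge (σ : ℝ) : SL(2, ℝ) :=
  ⟨!![1 / 3, 0; -(8 * σ / 3), 3], by rw [Matrix.det_fin_two_of]; norm_num⟩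

theorem angleVec_arctan (t : ℝ) : angleVec (arctan t) = cos (arctan t) • ![t, 1] := by
  have h := tan_mul_cos (cos_arctan_pos t).ne'
  rw [tan_arctan] at h
  ext i
  fin_cases i
  · simp [angleVec, ← h, mul_comm]
  · simp [angleVec]

theorem wedge_smul {σ t : ℝ} (h : 9 - 8 * σ * t ≠ 0) :
    wedge σ • line (arctan t) = line (arctan (t / (9 - 8 * σ * t))) := by
  refine smul_line_eq _ (c := cos (arctan t) * ((9 - 8 * σ * t) / 3) /
    cos (arctan (t / (9 - 8 * σ * t)))) ?_
  rw [angleVec_arctan, angleVec_arctan]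
  rw [smul_smul, div_mul_cancel₀ _ (cos_arctan_pos _).ne', Matrix.mulVec_smul, mul_smul]
  congr 1
  refine vec_ext ?_ ?_
  · simp only [wedge, Matrix.mulVec, dotProduct, Fin.sum_univ_two, Matrix.of_apply,
      Matrix.cons_val_zero, Matrix.cons_val_one, Pi.smul_apply, smul_eq_mul]
    generalize 9 - 8 * σ * t = e at h
    field_simp
    ring
  · simp only [wedge, Matrix.mulVec, dotProduct, Fin.sum_univ_two, Matrix.of_apply,
      Matrix.cons_val_zero, Matrix.cons_val_one, Pi.smul_apply, smul_eq_mul]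
    ring

/-- The symmetric part of `wedge σ` is indefinite when `|σ| = 1`, so the criterion
`exists_isLift_of_pos` is applied to a diagonal and a unipotent factor separately. Both fix the line
of angle `0`, and small displacement makes their lifts fix the angle `0` itself. -/
theorem exists_isLift_wedge {σ : ℝ} (hσ : |σ| ≤ 1) :
    ∃ a : ℝ ≃o ℝ, IsLift (wedge σ) a ∧ a 0 = 0 := by
  set D : SL(2, ℝ) := ⟨!![1 / 3, 0; 0, 3], by rw [Matrix.det_fin_two_of]; norm_num⟩ with hD
  set U : SL(2, ℝ) := ⟨!![1, 0; -(8 * σ / 9), 1], by rw [Matrix.det_fin_two_of]; norm_num⟩ with hU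
  obtain ⟨d, hd, hd'⟩ := exists_isLift_of_pos D fun θ => by
    have := sin_sq_add_cos_sq θ
    simp [hD, angleVec, Matrix.mulVec, dotProduct, Fin.sum_univ_two]
    nlinarith [sq_nonneg (sin θ), sq_nonneg (cos θ)]
  obtain ⟨u, hu, hu'⟩ := exists_isLift_of_pos U fun θ => by
    have := sin_sq_add_cos_sq θ
    have h1 := abs_le.1 hσ
    have h2 : |σ * (sin θ * cos θ)| ≤ 1 / 2 := by
      rw [abs_mul]
      have : |sin θ * cos θ| ≤ 1 / 2 := abs_le.2 ⟨by nlinarith [sq_nonneg (sin θ + cos θ)],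
        by nlinarith [sq_nonneg (sin θ - cos θ)]⟩
      nlinarith [abs_nonneg σ, abs_nonneg (sin θ * cos θ)]
    have h3 := abs_le.1 h2
    simp [hU, angleVec, Matrix.mulVec, dotProduct, Fin.sum_univ_two]
    nlinarith
  have fix : ∀ (B : SL(2, ℝ)) (b : ℝ ≃o ℝ), IsLift B b → (∀ θ, |b θ - θ| < π / 2) →
      B.1 0 1 = 0 → b 0 = 0 := by
    intro B b hb hb' h01
    refine line_injOn (s := b 0) (t := 0) ?_ (by have := hb' 0; have := pi_pos; linarith)
    rw [← hb.smul_line]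
    refine smul_line_eq B (c := B.1 1 1) ?_
    ext i
    fin_cases i <;> simp [angleVec, Matrix.mulVec, dotProduct, Fin.sum_univ_two, h01]
  have hDU : D * U = wedge σ := by
    apply Subtype.ext
    rw [Matrix.SpecialLinearGroup.coe_mul]
    simp only [hD, hU, wedge, Matrix.mul_fin_two]
    congr <;> ring
  refine ⟨u.trans d, hDU ▸ hd.mul hu, ?_⟩
  have e1 := fix U u hu hu' (by simp [hU])
  have e2 := fix D d hd hd' (by simp [hD])
  simp [e1, e2]

/-- A lift fixing `0` also fixes `π` and `-π`, hence preserves the intervals between them. This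
selects the right representative of the image line. -/
theorem IsLift.apply_arctan {A : SL(2, ℝ)} {a : ℝ ≃o ℝ} (h : IsLift A a) (h0 : a 0 = 0) {θ t : ℝ}
    (hA : A • line θ = line (arctan t)) (hθ : (0 < θ ∧ θ < π ∧ 0 < t) ∨ (-π < θ ∧ θ < 0 ∧ t < 0)) :
    a θ = arctan t := by
  have hp : a π = π := by have := h.add_pi 0; rwa [zero_add, h0, zero_add] at this
  have hm : a (-π) = -π := by
    have := h.add_pi (-π); rw [neg_add_cancel, h0] at this; linarith
  rw [h.smul_line] at hA
  refine line_injOn hA (abs_lt.2 ?_)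
  have e1 := arctan_lt_pi_div_two t
  have e2 := neg_pi_div_two_lt_arctan t
  have := pi_pos
  rcases hθ with ⟨h1, h2, h3⟩ | ⟨h1, h2, h3⟩
  · have k1 := a.strictMono h1
    have k2 := a.strictMono h2
    have k3 := arctan_pos.2 h3
    rw [h0] at k1
    rw [hp] at k2
    constructor <;> linarith
  · have k1 := a.strictMono h1
    have k2 := a.strictMono h2
    have k3 := arctan_lt_zero.2 h3
    rw [h0] at k2
    rw [hm] at k1
    constructor <;> linarith

theorem arctan_two : arctan 2 = π / 2 - arctan (1 / 2) := by
  have := arctan_inv_of_pos (show (0 : ℝ) < 1 / 2 by norm_num)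
  rwa [show ((1 : ℝ) / 2)⁻¹ = 2 by norm_num] at this

/-- The arcs of radius `arctan (1 / 2)` centered at the multiples of `π / 2` are mapped into the
arc around `0` modulo `π`, on either side of the repelling line. -/
theorem wedge_one_lift {a : ℝ ≃o ℝ} (h : IsLift (wedge 1) a) (h0 : a 0 = 0) :
    a (arctan (1 / 2)) < arctan (1 / 2) ∧ -arctan (1 / 2) < a (-(π / 2) - arctan (1 / 2)) := by
  have hε : 0 < arctan (1 / 2) := arctan_pos.2 (by norm_num)
  have hε2 := arctan_lt_pi_div_two (1 / 2)
  have hp := pi_pos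
  constructor
  · rw [h.apply_arctan h0 (wedge_smul (t := 1 / 2) (by norm_num))
      (Or.inl ⟨hε, by linarith, by norm_num⟩)]
    exact arctan_strictMono (by norm_num)
  -- This angle has slope `2` modulo `π`, on the far side of the repelling slope `1`. Its image has
  -- slope `2 / (9 - 16) = -2 / 7 > -1 / 2`, so it enters the arc around `0` from below.
  · have e : line (-(π / 2) - arctan (1 / 2)) = line (arctan 2) := by
      rw [← line_add_pi, arctan_two]; congr 1; ring
    rw [h.apply_arctan (t := 2 / (9 - 8 * 1 * 2)) h0 (by rw [e, wedge_smul (by norm_num)])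
      (Or.inr ⟨by linarith, by linarith, by norm_num⟩), ← arctan_neg]
    exact arctan_strictMono (by norm_num)

theorem wedge_neg_one_lift {a : ℝ ≃o ℝ} (h : IsLift (wedge (-1)) a) (h0 : a 0 = 0) :
    -arctan (1 / 2) < a (-arctan (1 / 2)) ∧ a (π / 2 + arctan (1 / 2)) < arctan (1 / 2) := by
  have hε : 0 < arctan (1 / 2) := arctan_pos.2 (by norm_num)
  have hε2 := arctan_lt_pi_div_two (1 / 2)
  have hp := pi_pos
  constructor
  · rw [h.apply_arctan (t := (-(1 / 2)) / (9 - 8 * (-1) * (-(1 / 2)))) h0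
      (by rw [← arctan_neg, wedge_smul (by norm_num)])
      (Or.inr ⟨by linarith, by linarith, by norm_num⟩), ← arctan_neg]
    exact arctan_strictMono (by norm_num)
  · have e : line (π / 2 + arctan (1 / 2)) = line (arctan (-2)) := by
      rw [arctan_neg, arctan_two, ← line_add_pi (-(π / 2 - arctan (1 / 2)))]; congr 1; ring
    rw [h.apply_arctan (t := (-2) / (9 - 8 * (-1) * (-2))) h0 (by rw [e, wedge_smul (by norm_num)])
      (Or.inl ⟨by linarith, by linarith, by norm_num⟩)]
    exact arctan_strictMono (by norm_num)

end RP1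

section

/-! ### Realization of tight systems by arcs on the projective line -/

open Real RP1

/-- Disjoint arcs `[l n, r n]` in increasing order, `q` of them in each period. -/
structure IsArcFamily (q : ℕ) (l r : ℤ → ℝ) : Prop where
  lt : ∀ n, l n < r n
  lt_succ : ∀ n, r n < l (n + 1)
  l_shift : ∀ n, l (n + q) = l n + π
  r_shift : ∀ n, r (n + q) = r n + π

/-- `a` maps the arc of index `n` into the interior of the arc of index `f n`. -/
structure MapsArcs (a : ℝ ≃o ℝ) (f : ℤ → ℤ) (l r : ℤ → ℝ) : Prop where
  left : ∀ n, l (f n) < a (l n)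
  right : ∀ n, a (r n) < r (f n)

/-- The lifts `a i` of the matrices `A i` act on a family of arcs as the maps `f i`. -/
structure Realizes {ι : Type*} (q : ℕ) (f : ι → ℤ → ℤ) (A : ι → SL(2, ℝ)) (a : ι → ℝ ≃o ℝ)
    (l r : ℤ → ℝ) : Prop where
  arcs : IsArcFamily q l r
  isLift : ∀ i, IsLift (A i) (a i)
  maps : ∀ i, MapsArcs (a i) (f i) l r

namespace IsArcFamily

variable {q : ℕ} {l r : ℤ → ℝ}

theorem l_strictMono (h : IsArcFamily q l r) : StrictMono l :=
  strictMono_int_of_lt_succ fun n => (h.lt n).trans (h.lt_succ n)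

theorem r_strictMono (h : IsArcFamily q l r) : StrictMono r :=
  strictMono_int_of_lt_succ fun n => (h.lt_succ n).trans (h.lt (n + 1))

theorem r_lt_l (h : IsArcFamily q l r) {m n : ℤ} (hmn : m < n) : r m < l n :=
  (h.lt_succ m).trans_le (h.l_strictMono.monotone hmn)

end IsArcFamily

theorem exists_pos_le_of_periodic {q : ℕ} (hq : 0 < q) {φ : ℤ → ℝ} (hp : ∀ n, φ (n + q) = φ n)
    (h : ∀ n, 0 < φ n) : ∃ ε > 0, ∀ n, ε ≤ φ n := by
  obtain ⟨m, -, hm⟩ := Finset.exists_min_image (Finset.Ico (0 : ℤ) q) φ ⟨0, by simpa using hq⟩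
  refine ⟨φ m, h m, fun n => ?_⟩
  have hpk : ∀ k : ℤ, φ (n + k * q) = φ n := fun k => by
    have := (show Function.Periodic φ (q : ℤ) from hp).int_mul k n
    exact this
  obtain ⟨k, h1, h2⟩ := exists_shift_mem hq 0 n
  rw [← hpk k]
  exact hm _ (by simp only [Finset.mem_Ico]; omega)

section Step

variable {q q' : ℕ} {f g f' g' ι : ℤ → ℤ} {l' r' : ℤ → ℝ} {a b' : ℝ ≃o ℝ}

/-- From arcs for the reduced system to arcs for the original one. -/
theorem IsReduction.exists_arcs {A B' : SL(2, ℝ)} (R : IsReduction q q' f g ι)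
    (hf : IsDegOne q f) (hg : IsDegOne q g) (hf' : ∀ n, ι (f' n) = f (ι n))
    (hg' : ∀ n, ι (g' n) = f (g (ι n)))
    (arcs : IsArcFamily q' l' r') (hA : IsLift A a) (hB : IsLift B' b')
    (ma : MapsArcs a f' l' r') (mb : MapsArcs b' g' l' r') :
    ∃ l r, IsArcFamily q l r ∧ MapsArcs a f l r ∧ MapsArcs (b'.trans a.symm) g l r := by
  classical
  choose ρ hρ using R.f_mem
  have hρι : ∀ n, ρ (ι n) = f' n := fun n => R.strictMono.injective (by rw [hρ, hf'])
  have hρg : ∀ n, ρ (g (ι n)) = g' n := fun n => R.strictMono.injective (by rw [hρ, hg'])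
  have hρs : ∀ x, ρ (x + q) = ρ x + q' := fun x => R.strictMono.injective (by
    rw [hρ, R.shift, hρ, hf.shift])
  have hρlt : ∀ {x y}, f x < f y → ρ x < ρ y := fun h => by
    rw [← hρ, ← hρ] at h; exact R.strictMono.lt_iff_lt.1 h
  have hmem : ∀ x : ℤ, x + q ∈ Set.range ι ↔ x ∈ Set.range ι := fun x => by
    constructor
    · rintro ⟨n, hn⟩
      exact ⟨n - q', by have := R.shift (n - q'); rw [sub_add_cancel] at this; linarith⟩
    · rintro ⟨n, rfl⟩
      exact ⟨n + q', R.shift n⟩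
  -- `L` turns end points of reduced arcs into end points of all arcs: it keeps them at `ι n`, and
  -- elsewhere pulls back by `a` the end of the arc of index `ρ x`, where `ι (ρ x) = f x`.
  obtain ⟨L, hLι, hLn⟩ : ∃ L : (ℤ → ℝ) → ℤ → ℝ, (∀ s n, L s (ι n) = s n) ∧
      ∀ s, ∀ x ∉ Set.range ι, a (L s x) = s (ρ x) := by
    refine ⟨fun s x => if h : x ∈ Set.range ι then s h.choose else a.symm (s (ρ x)),
      fun s n => ?_, fun s x hx => ?_⟩
    · have h : ι n ∈ Set.range ι := ⟨n, rfl⟩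
      simp only
      rw [dif_pos h, R.strictMono.injective h.choose_spec]
    · simp only
      rw [dif_neg hx, OrderIso.apply_symm_apply]
  have hLs : ∀ s, (∀ n, s (n + q') = s n + π) → ∀ x, L s (x + q) = L s x + π := by
    intro s hs x
    by_cases hx : x ∈ Set.range ι
    · obtain ⟨n, rfl⟩ := hx
      rw [← R.shift, hLι, hLι, hs]
    · apply a.injective
      rw [hLn s _ (mt (hmem x).1 hx), hA.add_pi, hLn s _ hx, hρs, hs]
  have c1 : ∀ x, L l' x < L r' x := by
    intro x
    by_cases hx : x ∈ Set.range ι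
    · obtain ⟨n, rfl⟩ := hx
      rw [hLι, hLι]; exact arcs.lt n
    · rw [← a.lt_iff_lt, hLn _ _ hx, hLn _ _ hx]; exact arcs.lt _
  -- Consecutive arcs not both kept have images under `a` in distinct arcs in increasing order,
  -- because `f` jumps there by `R.f_lt`; so the arcs themselves are ordered.
  have c2 : ∀ x, L r' x < L l' (x + 1) := by
    intro x
    by_cases hx : x ∈ Set.range ι ∧ x + 1 ∈ Set.range ι
    · obtain ⟨⟨n, hn⟩, ⟨m, hm⟩⟩ := hx
      rw [← hm, ← hn, hLι, hLι]
      exact arcs.r_lt_l (R.strictMono.lt_iff_lt.1 (by omega))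
    · have hlt := hρlt (R.f_lt x hx)
      rw [← a.lt_iff_lt]
      by_cases h1 : x ∈ Set.range ι
      · have h2 : x + 1 ∉ Set.range ι := fun e => hx ⟨h1, e⟩
        rw [hLn _ _ h2]
        obtain ⟨n, rfl⟩ := h1
        rw [hLι]
        rw [hρι] at hlt
        exact (ma.right n).trans (arcs.r_lt_l hlt)
      · rw [hLn _ _ h1]
        by_cases h2 : x + 1 ∈ Set.range ι
        · obtain ⟨n, hn⟩ := h2
          rw [← hn, hLι]
          rw [← hn, hρι] at hlt
          exact (arcs.r_lt_l hlt).trans (ma.left n)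
        · rw [hLn _ _ h2]
          exact arcs.r_lt_l hlt
  have arcs0 : IsArcFamily q (L l') (L r') :=
    ⟨c1, c2, hLs l' arcs.l_shift, hLs r' arcs.r_shift⟩
  have fl : ∀ x, L l' (f x) = l' (ρ x) := fun x => by rw [← hρ, hLι]
  have fr : ∀ x, L r' (f x) = r' (ρ x) := fun x => by rw [← hρ, hLι]
  -- Since `g x` is a removed point, its arc is a preimage under `a`, and the claim concerns `b'`
  -- and the arc `ρ (g x)`. For `x = ι n` this is the hypothesis on `g'`. A removed `x` lies between
  -- two kept indices on which `g` has the same value, and monotonicity of `b'` applies.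
  have gl : ∀ x, L l' (g x) < a.symm (b' (L l' x)) := by
    intro x
    rw [OrderIso.lt_symm_apply, hLn _ _ (R.g_notMem x)]
    by_cases hx : x ∈ Set.range ι
    · obtain ⟨n, rfl⟩ := hx
      rw [hρg, hLι]; exact mb.left n
    · obtain ⟨n, h1, -, h3, -⟩ := R.g_const x hx
      rw [← h3, hρg]
      refine (mb.left n).trans (b'.strictMono ?_)
      rw [← hLι l' n]
      exact arcs0.l_strictMono h1
  have gr : ∀ x, a.symm (b' (L r' x)) < L r' (g x) := by
    intro x
    rw [OrderIso.symm_apply_lt, hLn _ _ (R.g_notMem x)]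
    by_cases hx : x ∈ Set.range ι
    · obtain ⟨n, rfl⟩ := hx
      rw [hρg, hLι]; exact mb.right n
    · obtain ⟨n, -, h2, -, h4⟩ := R.g_const x hx
      rw [h4, hρg]
      refine lt_trans (b'.strictMono ?_) (mb.right (n + 1))
      rw [← hLι r' (n + 1)]
      exact arcs0.r_strictMono h2
  have hBA : ∀ θ, a.symm (b' (θ + π)) = a.symm (b' θ) + π := fun θ => by
    rw [hB.add_pi, hA.inv.add_pi]
  have q0 : 0 < q := by have := R.lt; omega
  -- The map `a` sends the added arcs onto, not strictly inside, their targets. They are therefore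
  -- shrunk by `δ / 3` at each end, where `δ` bounds from below both the widths of the arcs and the
  -- room left by `a⁻¹ b'`.
  obtain ⟨δ, hδ, hδ'⟩ := exists_pos_le_of_periodic q0
    (φ := fun x => min (a.symm (b' (L l' x)) - L l' (g x))
      (min (L r' (g x) - a.symm (b' (L r' x))) (L r' x - L l' x)))
    (fun x => by
      simp only [arcs0.l_shift, arcs0.r_shift, hg.shift, hBA, add_sub_add_right_eq_sub])
    (fun x => lt_min (by have := gl x; linarith)
      (lt_min (by have := gr x; linarith) (by have := c1 x; linarith)))
  have d1 : ∀ x, δ ≤ a.symm (b' (L l' x)) - L l' (g x) := fun x => (hδ' x).trans (min_le_left _ _)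
  have d2 : ∀ x, δ ≤ L r' (g x) - a.symm (b' (L r' x)) := fun x =>
    (hδ' x).trans ((min_le_right _ _).trans (min_le_left _ _))
  have d3 : ∀ x, δ ≤ L r' x - L l' x := fun x =>
    (hδ' x).trans ((min_le_right _ _).trans (min_le_right _ _))
  obtain ⟨e, he, he'⟩ : ∃ e : ℤ → ℝ, (∀ n, e (ι n) = 0) ∧ ∀ x ∉ Set.range ι, e x = δ / 3 :=
    ⟨fun x => if x ∈ Set.range ι then 0 else δ / 3, fun n => if_pos ⟨n, rfl⟩,
      fun x hx => if_neg hx⟩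
  have e0 : ∀ x, 0 ≤ e x := fun x => by
    by_cases hx : x ∈ Set.range ι
    · obtain ⟨n, rfl⟩ := hx; rw [he]
    · rw [he' x hx]; linarith
  have e1 : ∀ x, e x ≤ δ / 3 := fun x => by
    by_cases hx : x ∈ Set.range ι
    · obtain ⟨n, rfl⟩ := hx; rw [he]; linarith
    · rw [he' x hx]
  have es : ∀ x, e (x + q) = e x := fun x => by
    by_cases hx : x ∈ Set.range ι
    · obtain ⟨n, rfl⟩ := hx; rw [← R.shift, he, he]
    · rw [he' x hx, he' _ (mt (hmem x).1 hx)]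
  refine ⟨fun x => L l' x + e x, fun x => L r' x - e x, ⟨fun x => ?_, fun x => ?_, fun x => ?_,
    fun x => ?_⟩, ⟨fun x => ?_, fun x => ?_⟩, ⟨fun x => ?_, fun x => ?_⟩⟩
  · have := d3 x; have := e1 x
    linarith
  · have := c2 x; have := e0 x; have := e0 (x + 1)
    linarith
  · simp only [es, arcs0.l_shift]; ring
  · simp only [es, arcs0.r_shift]; ring
  · rw [← hρ x, hLι, he, add_zero]
    by_cases hx : x ∈ Set.range ι
    · obtain ⟨n, rfl⟩ := hx
      rw [hLι, he, hρι, add_zero]; exact ma.left n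
    · rw [← hLn l' x hx, he' x hx]
      exact a.strictMono (by linarith)
  · rw [← hρ x, hLι, he, sub_zero]
    by_cases hx : x ∈ Set.range ι
    · obtain ⟨n, rfl⟩ := hx
      rw [hLι, he, hρι, sub_zero]; exact ma.right n
    · rw [← hLn r' x hx, he' x hx]
      exact a.strictMono (by linarith)
  · have := d1 x; have := e1 (g x)
    have hle : a.symm (b' (L l' x)) ≤ a.symm (b' (L l' x + e x)) :=
      a.symm.monotone (b'.monotone (by linarith [e0 x]))
    simp only [OrderIso.trans_apply]
    linarith
  · have := d2 x; have := e1 (g x)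
    have hle : a.symm (b' (L r' x - e x)) ≤ a.symm (b' (L r' x)) :=
      a.symm.monotone (b'.monotone (by linarith [e0 x]))
    simp only [OrderIso.trans_apply]
    linarith

end Step

/-! ### Systems of rank one and two -/

/-- The arcs of radius `arctan (1 / 2)` centered at the multiples of `π / 2`. -/
theorem isArcFamily_two : IsArcFamily 2 (fun n => n * (π / 2) - arctan (1 / 2))
    (fun n => n * (π / 2) + arctan (1 / 2)) := by
  have hε : 0 < arctan (1 / 2) := arctan_pos.2 (by norm_num)
  have hε2 : arctan (1 / 2) < π / 4 := by
    rw [← arctan_one]; exact arctan_strictMono (by norm_num)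
  refine ⟨fun n => ?_, fun n => ?_, fun n => ?_, fun n => ?_⟩
  · linarith
  · push_cast; linarith
  · push_cast; ring
  · push_cast; ring

/-- The lift conjugated by the translation by `t` and translated by `k * π`. -/
theorem isLift_conj {W : SL(2, ℝ)} {w : ℝ ≃o ℝ} (h : IsLift W w) (t : ℝ) (k : ℤ) :
    ∃ a : ℝ ≃o ℝ, IsLift (rotSL t * W * (rotSL t)⁻¹) a ∧
      ∀ θ, a (t + θ) = t + w θ + k * π := by
  refine ⟨_, (((isLift_rotSL t).mul h).mul (isLift_rotSL t).inv).translate k, fun θ => ?_⟩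
  simp
  ring

theorem mapsArcs_two {f : ℤ → ℤ} {x F : ℤ} (h0 : ∀ k : ℤ, f (x + 2 * k) = F + 2 * k)
    (h1 : ∀ k : ℤ, f (x + 1 + 2 * k) = F + 2 + 2 * k) {a : ℝ ≃o ℝ} {A : SL(2, ℝ)}
    (ha : IsLift A a)
    (e0 : F * (π / 2) - arctan (1 / 2) < a (x * (π / 2) - arctan (1 / 2)))
    (e1 : a (x * (π / 2) + arctan (1 / 2)) < F * (π / 2) + arctan (1 / 2))
    (e2 : (F + 2) * (π / 2) - arctan (1 / 2) < a ((x + 1) * (π / 2) - arctan (1 / 2)))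
    (e3 : a ((x + 1) * (π / 2) + arctan (1 / 2)) < (F + 2) * (π / 2) + arctan (1 / 2)) :
    MapsArcs a f (fun n => n * (π / 2) - arctan (1 / 2))
      (fun n => n * (π / 2) + arctan (1 / 2)) := by
  have par : ∀ n : ℤ, ∃ k : ℤ, n = x + 2 * k ∨ n = x + 1 + 2 * k := fun n =>
    ⟨(n - x) / 2, by omega⟩
  constructor
  · intro n
    obtain ⟨k, rfl | rfl⟩ := par n
    · simp only [h0]
      have := ha.add_mul_pi (x * (π / 2) - arctan (1 / 2)) k
      push_cast
      rw [show (x + 2 * (k : ℝ)) * (π / 2) - arctan (1 / 2) =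
        x * (π / 2) - arctan (1 / 2) + k * π by ring, this]
      linarith
    · simp only [h1]
      have := ha.add_mul_pi ((x + 1) * (π / 2) - arctan (1 / 2)) k
      push_cast
      rw [show (x + 1 + 2 * (k : ℝ)) * (π / 2) - arctan (1 / 2) =
        (x + 1) * (π / 2) - arctan (1 / 2) + k * π by ring, this]
      linarith
  · intro n
    obtain ⟨k, rfl | rfl⟩ := par n
    · simp only [h0]
      have := ha.add_mul_pi (x * (π / 2) + arctan (1 / 2)) k
      push_cast
      rw [show (x + 2 * (k : ℝ)) * (π / 2) + arctan (1 / 2) =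
        x * (π / 2) + arctan (1 / 2) + k * π by ring, this]
      linarith
    · simp only [h1]
      have := ha.add_mul_pi ((x + 1) * (π / 2) + arctan (1 / 2)) k
      push_cast
      rw [show (x + 1 + 2 * (k : ℝ)) * (π / 2) + arctan (1 / 2) =
        (x + 1) * (π / 2) + arctan (1 / 2) + k * π by ring, this]
      linarith

/-- Such an `f` sends the neighbouring arcs `x - 1` and `x` to the arc of `x` modulo `π`. The
rotated `wedge 1` attracts to the centre of the arc `x` and repels from the middle of the gap
between `x` and `x + 1`; `j` is the number of half turns to add to its lift. -/
theorem exists_mapsArcs_even {f : ℤ → ℤ} {x j : ℤ} (h0 : ∀ k : ℤ, f (x + 2 * k) = x + 2 * j + 2 * k)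
    (h1 : ∀ k : ℤ, f (x + 1 + 2 * k) = x + 2 * j + 2 + 2 * k) :
    ∃ a : ℝ ≃o ℝ, IsLift (rotSL (x * (π / 2)) * wedge 1 * (rotSL (x * (π / 2)))⁻¹) a ∧
      MapsArcs a f (fun n => n * (π / 2) - arctan (1 / 2))
        (fun n => n * (π / 2) + arctan (1 / 2)) := by
  obtain ⟨w, hw, hw0⟩ := exists_isLift_wedge (σ := 1) (by simp)
  obtain ⟨k1, k2⟩ := wedge_one_lift hw hw0
  obtain ⟨a, ha, hat⟩ := isLift_conj hw (x * (π / 2)) j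
  have hε : 0 < arctan (1 / 2) := arctan_pos.2 (by norm_num)
  have hp := pi_pos
  refine ⟨a, ha, mapsArcs_two h0 h1 ha ?_ ?_ ?_ ?_⟩ <;> push_cast
  · rw [sub_eq_add_neg (x * (π / 2)), hat]
    have := w.monotone (show -(π / 2) - arctan (1 / 2) ≤ -arctan (1 / 2) by linarith)
    linarith
  · rw [hat]; linarith
  · rw [show ((x : ℝ) + 1) * (π / 2) - arctan (1 / 2) =
      x * (π / 2) + (-(π / 2) - arctan (1 / 2) + π) by ring, hat, hw.add_pi]
    linarith
  · rw [add_mul, add_assoc, hat]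
    have := w.monotone (show 1 * (π / 2) + arctan (1 / 2) ≤ arctan (1 / 2) + π by linarith)
    rw [hw.add_pi] at this
    linarith

/-- Here the arcs `x + 1` and `x + 2` go to the arc of `x + 1` modulo `π`. The repelling line is
still between `x` and `x + 1`, hence before the attracting one, which is the mirror image `wedge
(-1)`. -/
theorem exists_mapsArcs_odd {f : ℤ → ℤ} {x j : ℤ}
    (h0 : ∀ k : ℤ, f (x + 2 * k) = x + 1 + 2 * j + 2 * k)
    (h1 : ∀ k : ℤ, f (x + 1 + 2 * k) = x + 1 + 2 * j + 2 + 2 * k) :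
    ∃ a : ℝ ≃o ℝ, IsLift (rotSL (((x + 1 : ℤ) : ℝ) * (π / 2)) * wedge (-1) *
        (rotSL (((x + 1 : ℤ) : ℝ) * (π / 2)))⁻¹) a ∧
      MapsArcs a f (fun n => n * (π / 2) - arctan (1 / 2))
        (fun n => n * (π / 2) + arctan (1 / 2)) := by
  obtain ⟨w, hw, hw0⟩ := exists_isLift_wedge (σ := -1) (by simp)
  obtain ⟨k1, k2⟩ := wedge_neg_one_lift hw hw0
  obtain ⟨a, ha, hat⟩ := isLift_conj hw (((x + 1 : ℤ) : ℝ) * (π / 2)) (j + 1)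
  have hε : 0 < arctan (1 / 2) := arctan_pos.2 (by norm_num)
  have hp := pi_pos
  push_cast at hat
  refine ⟨a, ha, mapsArcs_two h0 h1 ha ?_ ?_ ?_ ?_⟩ <;> push_cast
  · rw [show (x : ℝ) * (π / 2) - arctan (1 / 2) =
      (x + 1) * (π / 2) + (π / 2 - arctan (1 / 2) + ((-1 : ℤ) : ℝ) * π) by push_cast; ring, hat,
      hw.add_mul_pi]
    have := w.monotone (show -arctan (1 / 2) ≤ π / 2 - arctan (1 / 2) by linarith)
    push_cast
    linarith
  · rw [show (x : ℝ) * (π / 2) + arctan (1 / 2) =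
      (x + 1) * (π / 2) + (π / 2 + arctan (1 / 2) + ((-1 : ℤ) : ℝ) * π) by push_cast; ring, hat,
      hw.add_mul_pi]
    push_cast
    linarith
  · rw [sub_eq_add_neg (((x : ℝ) + 1) * (π / 2)), hat]
    linarith
  · rw [hat]
    have := w.monotone (show arctan (1 / 2) ≤ π / 2 + arctan (1 / 2) by linarith)
    linarith

theorem trace_conj (ρ X : SL(2, ℝ)) :
    ((ρ * X * ρ⁻¹ : SL(2, ℝ)) : Matrix (Fin 2) (Fin 2) ℝ).trace =
      (X : Matrix (Fin 2) (Fin 2) ℝ).trace := by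
  have : (ρ⁻¹ * (ρ * X) : SL(2, ℝ)) = X := by group
  rw [Matrix.SpecialLinearGroup.coe_mul, Matrix.trace_mul_comm, ← Matrix.SpecialLinearGroup.coe_mul,
    this]

theorem rotSL_coe (t : ℝ) :
    (rotSL t : Matrix (Fin 2) (Fin 2) ℝ) = !![cos t, sin t; -sin t, cos t] := rfl

theorem wedge_coe (σ : ℝ) :
    (wedge σ : Matrix (Fin 2) (Fin 2) ℝ) = !![1 / 3, 0; -(8 * σ / 3), 3] := rfl

theorem rotSL_add (s t : ℝ) : rotSL (s + t) = rotSL s * rotSL t := by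
  apply Subtype.ext
  rw [Matrix.SpecialLinearGroup.coe_mul, rotSL_coe, rotSL_coe, rotSL_coe, Matrix.mul_fin_two,
    cos_add, sin_add]
  ext i j
  fin_cases i <;> fin_cases j <;> simp <;> ring

/-- Both matrices have trace `10 / 3`. With `R` the quarter turn, the product is conjugate to `W R W
R⁻¹`, of trace `2 - 64 σ² / 9 = -46 / 9`. -/
theorem isFreePair_conj {σ : ℝ} (hσ : σ ^ 2 = 1) (t : ℝ) :
    Farey.IsFreePair (rotSL t * wedge σ * (rotSL t)⁻¹)
      (rotSL (t + π / 2) * wedge σ * (rotSL (t + π / 2))⁻¹) := by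
  have htr : (wedge σ : Matrix (Fin 2) (Fin 2) ℝ).trace = 1 / 3 + 3 := by
    simp [wedge, Matrix.trace_fin_two]
  refine ⟨?_, ?_, ?_⟩
  · rw [trace_conj, htr]; norm_num
  · rw [trace_conj, htr]; norm_num
  · rw [rotSL_add, show rotSL t * wedge σ * (rotSL t)⁻¹ *
      (rotSL t * rotSL (π / 2) * wedge σ * (rotSL t * rotSL (π / 2))⁻¹) =
      rotSL t * (wedge σ * rotSL (π / 2) * wedge σ * (rotSL (π / 2))⁻¹) * (rotSL t)⁻¹ by
      group, trace_conj]
    rw [Matrix.SpecialLinearGroup.coe_mul, Matrix.SpecialLinearGroup.coe_mul,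
      Matrix.SpecialLinearGroup.coe_mul, Matrix.SpecialLinearGroup.coe_inv, rotSL_coe, wedge_coe,
      cos_pi_div_two, sin_pi_div_two, Matrix.adjugate_fin_two_of, Matrix.mul_fin_two,
      Matrix.mul_fin_two, Matrix.mul_fin_two, Matrix.trace_fin_two_of]
    nlinarith

theorem TightSystem.exists_realizes_two {f g : ℤ → ℤ} (h : TightSystem 2 ![f, g]) :
    ∃ (A B : SL(2, ℝ)) (a b : ℝ ≃o ℝ) (l r : ℤ → ℝ),
      Realizes 2 ![f, g] ![A, B] ![a, b] l r ∧ Farey.IsFreePair A B := by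
  obtain ⟨x, y, hxy⟩ := h.exists_arcSplit le_rfl
  have hf := h.deg_left
  have hg := h.deg_right
  obtain rfl : y = x + 1 := by
    have := hxy.lt; have := hxy.lt'; push_cast at *; omega
  have fs : ∀ z k : ℤ, f (z + 2 * k) = f z + 2 * k := fun z k => by
    have := hf.shift_mul z k
    push_cast at this
    rw [mul_comm, this]
  have gs : ∀ z k : ℤ, g (z + 2 * k) = g z + 2 * k := fun z k => by
    have := hg.shift_mul z k
    push_cast at this
    rw [mul_comm, this]
  have f1 : ∀ k : ℤ, f (x + 1 + 2 * k) = f x + 2 + 2 * k := fun k => by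
    have := hxy.f_eq
    rw [hf.shift] at this
    rw [fs, this]; simp
  have g1 : ∀ k : ℤ, g (x + 1 + 1 + 2 * k) = g (x + 1) + 2 + 2 * k := fun k => by
    rw [show x + 1 + 1 + 2 * k = x + 2 * (k + 1) by ring, gs, hxy.g_eq]; ring
  have hne : ∀ k : ℤ, g (x + 1) ≠ f x + 2 * k := fun k hk =>
    Set.disjoint_left.1 (h.disjoint_range le_rfl) ⟨x + 2 * k, fs x k⟩ ⟨x + 1, hk⟩
  have mk : ∀ {A B : SL(2, ℝ)} {a b : ℝ ≃o ℝ}, IsLift A a → IsLift B b →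
      MapsArcs a f (fun n => n * (π / 2) - arctan (1 / 2))
        (fun n => n * (π / 2) + arctan (1 / 2)) →
      MapsArcs b g (fun n => n * (π / 2) - arctan (1 / 2))
        (fun n => n * (π / 2) + arctan (1 / 2)) →
      Realizes 2 ![f, g] ![A, B] ![a, b] (fun n => n * (π / 2) - arctan (1 / 2))
        (fun n => n * (π / 2) + arctan (1 / 2)) := by
    intro A B a b h1 h2 h3 h4
    refine ⟨isArcFamily_two, fun i => ?_, fun i => ?_⟩ <;> fin_cases i <;> assumption
  -- The two images are disjoint and have one residue modulo `2` each, so the parity of `f x`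
  -- determines that of `g (x + 1)`. Both maps then have the same type, and one `σ` serves for both
  -- matrices.
  rcases Int.even_or_odd (f x - x) with ⟨j, hj⟩ | ⟨j, hj⟩
  · obtain ⟨i, hi⟩ : ∃ i : ℤ, g (x + 1) = x + 1 + 2 * i := by
      rcases Int.even_or_odd (g (x + 1) - x) with ⟨i, hi⟩ | ⟨i, hi⟩
      · exact absurd (show g (x + 1) = f x + 2 * (i - j) by linarith) (hne _)
      · exact ⟨i, by linarith⟩
    obtain ⟨a, ha, ha'⟩ := exists_mapsArcs_even (f := f) (x := x) (j := j)
      (fun k => by rw [fs]; linarith) (fun k => by rw [f1]; linarith)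
    obtain ⟨b, hb, hb'⟩ := exists_mapsArcs_even (f := g) (x := x + 1) (j := i)
      (fun k => by rw [gs]; linarith) (fun k => by rw [g1]; linarith)
    refine ⟨_, _, _, _, _, _, mk ha hb ha' hb', ?_⟩
    have := isFreePair_conj (σ := 1) (by norm_num) (x * (π / 2))
    rwa [show (x : ℝ) * (π / 2) + π / 2 = ((x + 1 : ℤ) : ℝ) * (π / 2) by push_cast; ring] at this
  · obtain ⟨i, hi⟩ : ∃ i : ℤ, g (x + 1) = x + 1 + 1 + 2 * i := by
      rcases Int.even_or_odd (g (x + 1) - x) with ⟨i, hi⟩ | ⟨i, hi⟩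
      · exact ⟨i - 1, by linarith⟩
      · exact absurd (show g (x + 1) = f x + 2 * (i - j) by linarith) (hne _)
    obtain ⟨a, ha, ha'⟩ := exists_mapsArcs_odd (f := f) (x := x) (j := j)
      (fun k => by rw [fs]; linarith) (fun k => by rw [f1]; linarith)
    obtain ⟨b, hb, hb'⟩ := exists_mapsArcs_odd (f := g) (x := x + 1) (j := i)
      (fun k => by rw [gs]; linarith) (fun k => by rw [g1]; linarith)
    refine ⟨_, _, _, _, _, _, mk ha hb ha' hb', ?_⟩
    have := isFreePair_conj (σ := -1) (by norm_num) (((x + 1 : ℤ) : ℝ) * (π / 2))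
    rwa [show ((x + 1 : ℤ) : ℝ) * (π / 2) + π / 2 = ((x + 1 + 1 : ℤ) : ℝ) * (π / 2) by
      push_cast; ring] at this

/-- For `q = 1` every map of degree one is a translation, so both generators may be the same
diagonal matrix, with suitably translated lifts. -/
theorem TightSystem.exists_realizes_one {f g : ℤ → ℤ} (h : TightSystem 1 ![f, g]) :
    ∃ (A B : SL(2, ℝ)) (a b : ℝ ≃o ℝ) (l r : ℤ → ℝ),
      Realizes 1 ![f, g] ![A, B] ![a, b] l r := by
  obtain ⟨w, hw, hw0⟩ := exists_isLift_wedge (σ := 0) (by simp)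
  have hε : 0 < arctan (1 / 2) := arctan_pos.2 (by norm_num)
  have hε2 := arctan_lt_pi_div_two (1 / 2)
  have hp := pi_pos
  have k1 : w (arctan (1 / 2)) < arctan (1 / 2) := by
    rw [hw.apply_arctan hw0 (wedge_smul (t := 1 / 2) (by norm_num))
      (Or.inl ⟨hε, by linarith, by norm_num⟩)]
    exact arctan_strictMono (by norm_num)
  have k2 : -arctan (1 / 2) < w (-arctan (1 / 2)) := by
    rw [hw.apply_arctan (t := (-(1 / 2)) / (9 - 8 * 0 * (-(1 / 2)))) hw0
      (by rw [← arctan_neg, wedge_smul (by norm_num)])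
      (Or.inr ⟨by linarith, by linarith, by norm_num⟩), ← arctan_neg]
    exact arctan_strictMono (by norm_num)
  have key : ∀ φ : ℤ → ℤ, IsDegOne 1 φ →
      ∃ a : ℝ ≃o ℝ, IsLift (wedge 0) a ∧
        MapsArcs a φ (fun n => n * π - arctan (1 / 2)) (fun n => n * π + arctan (1 / 2)) := by
    intro φ hφ
    have e : ∀ n, φ n = n + φ 0 := fun n => by
      have := hφ.shift_mul 0 n
      simp at this
      linarith
    refine ⟨_, hw.translate (φ 0), fun n => ?_, fun n => ?_⟩
    · rw [e n]
      simp only [OrderIso.trans_apply, OrderIso.addRight_apply]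
      rw [sub_eq_add_neg ((n : ℝ) * π), add_comm ((n : ℝ) * π) (-_), hw.add_mul_pi]
      push_cast
      linarith
    · rw [e n]
      simp only [OrderIso.trans_apply, OrderIso.addRight_apply]
      rw [add_comm ((n : ℝ) * π), hw.add_mul_pi]
      push_cast
      linarith
  obtain ⟨a, ha, ha'⟩ := key f h.deg_left
  obtain ⟨b, hb, hb'⟩ := key g h.deg_right
  refine ⟨wedge 0, wedge 0, a, b, fun n => n * π - arctan (1 / 2), fun n => n * π + arctan (1 / 2),
    ⟨⟨fun n => ?_, fun n => ?_, fun n => ?_, fun n => ?_⟩, fun i => ?_, fun i => ?_⟩⟩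
  · linarith
  · push_cast; linarith
  · push_cast; ring
  · push_cast; ring
  · fin_cases i <;> assumption
  · fin_cases i <;> assumption

end

section

/-! ### Existence of realizations -/

open RP1

namespace Farey

theorem substPlus_of_zero : substPlus (FreeMonoid.of 0) = FreeMonoid.of 0 :=
  FreeMonoid.lift_eval_of _ _

theorem substPlus_of_one : substPlus (FreeMonoid.of 1) = FreeMonoid.of 0 * FreeMonoid.of 1 :=
  FreeMonoid.lift_eval_of _ _

theorem substMinus_of_zero : substMinus (FreeMonoid.of 0) = FreeMonoid.of 1 * FreeMonoid.of 0 :=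
  FreeMonoid.lift_eval_of _ _

theorem substMinus_of_one : substMinus (FreeMonoid.of 1) = FreeMonoid.of 1 :=
  FreeMonoid.lift_eval_of _ _

theorem count_substPlus (w : FreeMonoid (Fin 2)) :
    (substPlus w).toList.count 0 = w.toList.count 0 + w.toList.count 1 ∧
      (substPlus w).toList.count 1 = w.toList.count 1 := by
  induction w using FreeMonoid.recOn with
  | one => simp
  | of_mul x w ih =>
    rw [map_mul, FreeMonoid.toList_mul, FreeMonoid.toList_mul, List.count_append, List.count_append,
      List.count_append, List.count_append, ih.1, ih.2]
    fin_cases x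
    · simp [substPlus_of_zero]; omega
    · simp [substPlus_of_one]; omega

theorem count_substMinus (w : FreeMonoid (Fin 2)) :
    (substMinus w).toList.count 0 = w.toList.count 0 ∧
      (substMinus w).toList.count 1 = w.toList.count 0 + w.toList.count 1 := by
  induction w using FreeMonoid.recOn with
  | one => simp
  | of_mul x w ih =>
    rw [map_mul, FreeMonoid.toList_mul, FreeMonoid.toList_mul, List.count_append, List.count_append,
      List.count_append, List.count_append, ih.1, ih.2]
    fin_cases x
    · simp [substMinus_of_zero]; omega
    · simp [substMinus_of_one]; omega

theorem lift_substPlus {G : Type*} [Monoid G] (A B : G) (w : FreeMonoid (Fin 2)) :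
    FreeMonoid.lift ![A, B] (substPlus w) = FreeMonoid.lift ![A, A * B] w := by
  induction w using FreeMonoid.recOn with
  | one => simp
  | of_mul x w ih =>
    rw [map_mul, map_mul, map_mul, ih]
    fin_cases x <;> simp [substPlus_of_zero, substPlus_of_one]

theorem lift_substMinus {G : Type*} [Monoid G] (A B : G) (w : FreeMonoid (Fin 2)) :
    FreeMonoid.lift ![A, B] (substMinus w) = FreeMonoid.lift ![B * A, B] w := by
  induction w using FreeMonoid.recOn with
  | one => simp
  | of_mul x w ih =>
    rw [map_mul, map_mul, map_mul, ih]
    fin_cases x <;> simp [substMinus_of_zero, substMinus_of_one]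

end Farey

theorem monoidEnd_mul_apply {M : Type*} [Monoid M] (F G : Monoid.End M) (x : M) :
    (F * G) x = F (G x) := rfl

theorem Realizes.pair {q : ℕ} {f g : ℤ → ℤ} {A B : SL(2, ℝ)} {a b : ℝ ≃o ℝ} {l r : ℤ → ℝ}
    (h : IsArcFamily q l r) (hA : IsLift A a) (hB : IsLift B b) (ha : MapsArcs a f l r)
    (hb : MapsArcs b g l r) : Realizes q ![f, g] ![A, B] ![a, b] l r := by
  refine ⟨h, fun i => ?_, fun i => ?_⟩ <;> fin_cases i <;> assumption

/-- Every tight system of two maps is realized by a pair of matrices, which may be taken in a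
twisted free component when the rank is at least two. -/
theorem TightSystem.exists_realizes : ∀ (q : ℕ) (f g : ℤ → ℤ), TightSystem q ![f, g] →
    ∃ (A B : SL(2, ℝ)) (a b : ℝ ≃o ℝ) (l r : ℤ → ℝ), Realizes q ![f, g] ![A, B] ![a, b] l r ∧
      (2 ≤ q → ∃ F ∈ Farey.substMonoid,
        (F (FreeMonoid.of 0 * FreeMonoid.of 1)).toList.count 0 = imCard q f ∧
        (F (FreeMonoid.of 0 * FreeMonoid.of 1)).toList.count 1 = imCard q g ∧
        Farey.InTwistedFree F ![A, B]) := by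
  intro q
  induction q using Nat.strong_induction_on with
  | _ q ih =>
  intro f g h
  have hq := h.pos
  obtain rfl | rfl | h3 : q = 1 ∨ q = 2 ∨ 3 ≤ q := by omega
  · obtain ⟨A, B, a, b, l, r, hR⟩ := h.exists_realizes_one
    exact ⟨A, B, a, b, l, r, hR, fun h2 => by omega⟩
  · obtain ⟨A, B, a, b, l, r, hR, hfree⟩ := h.exists_realizes_two
    refine ⟨A, B, a, b, l, r, hR, fun _ => ⟨1, one_mem _, ?_⟩⟩
    have h1 := one_le_imCard two_pos f
    have h2 := one_le_imCard two_pos g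
    have h3 := h.imCard_add le_rfl
    refine ⟨?_, ?_, ?_⟩
    · simp; omega
    · simp; omega
    · simpa [Farey.InTwistedFree] using hfree
  · rcases h.exists_reduction h3 with ⟨q', ι, R⟩ | ⟨q', ι, R⟩
    · obtain ⟨f', g', hf', hg', h'⟩ := R.exists_system h
      obtain ⟨A, C, a, c, l', r', hR, hF⟩ := ih q' R.lt f' g' h'
      obtain ⟨l, r, arcs, ma, mb⟩ := R.exists_arcs h.deg_left h.deg_right hf' hg' hR.arcs
        (hR.isLift 0) (hR.isLift 1) (hR.maps 0) (hR.maps 1)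
      obtain ⟨F, hFm, h0, h1, hfree⟩ := hF R.two_le
      -- With `B = A⁻¹ * C` one has `A * B = C`, so evaluating `F₊ w` at `(A, B)` is evaluating `w`
      -- at `(A, C)`: the trace conditions carry over unchanged.
      refine ⟨A, A⁻¹ * C, a, c.trans a.symm, l, r,
        Realizes.pair arcs (hR.isLift 0) ((hR.isLift 0).inv.mul (hR.isLift 1)) ma mb, fun _ =>
        ⟨Farey.substPlus * F, mul_mem (Submonoid.subset_closure (by simp)) hFm, ?_, ?_, ?_⟩⟩
      · rw [monoidEnd_mul_apply, (Farey.count_substPlus _).1, h0, h1, h'.imCard_add R.two_le,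
          R.imCard_left]
      · rw [monoidEnd_mul_apply, (Farey.count_substPlus _).2, h1,
          R.imCard_right h.deg_left h.deg_right hg']
      · rw [Farey.InTwistedFree, monoidEnd_mul_apply, monoidEnd_mul_apply, Farey.lift_substPlus,
          Farey.lift_substPlus, mul_inv_cancel_left]
        exact hfree
    · obtain ⟨g', f', hg', hf', h'⟩ := R.exists_system h.swap
      -- The reduced system comes with the restriction of `g` first; it is swapped back so that the
      -- letter `b` keeps denoting the second map.
      obtain ⟨C, B, c, b, l', r', hR, hF⟩ := ih q' R.lt f' g' h'.swap
      obtain ⟨l, r, arcs, mb, ma⟩ := R.exists_arcs h.deg_right h.deg_left hg' hf' hR.arcs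
        (hR.isLift 1) (hR.isLift 0) (hR.maps 1) (hR.maps 0)
      obtain ⟨F, hFm, h0, h1, hfree⟩ := hF R.two_le
      refine ⟨B⁻¹ * C, B, c.trans b.symm, b, l, r,
        Realizes.pair arcs ((hR.isLift 1).inv.mul (hR.isLift 0)) (hR.isLift 1) ma mb, fun _ =>
        ⟨Farey.substMinus * F, mul_mem (Submonoid.subset_closure (by simp)) hFm, ?_, ?_, ?_⟩⟩
      · rw [monoidEnd_mul_apply, (Farey.count_substMinus _).1, h0,
          R.imCard_right h.deg_right h.deg_left hf']
      · rw [monoidEnd_mul_apply, (Farey.count_substMinus _).2, h0, h1,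
          h'.swap.imCard_add R.two_le, R.imCard_left]
      · rw [Farey.InTwistedFree, monoidEnd_mul_apply, monoidEnd_mul_apply, Farey.lift_substMinus,
          Farey.lift_substMinus, mul_inv_cancel_left]
        exact hfree

end

namespace RP1

open Real Topology

/-! ### The topology of the projective line -/

theorem continuous_line : Continuous line := by
  have h1 : Continuous (fun v : {v : Fin 2 → ℝ // v ≠ 0} =>
      (Projectivization.mk ℝ v.1 v.2 : RP1)) := continuous_coinduced_rng
  have h2 : Continuous fun θ => (⟨angleVec θ, angleVec_ne_zero θ⟩ : {v : Fin 2 → ℝ // v ≠ 0}) := by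
    refine Continuous.subtype_mk ?_ _
    refine continuous_pi fun i => ?_
    fin_cases i
    · exact continuous_sin
    · exact continuous_cos
  exact h1.comp h2

/-- The double angle of a line. -/
noncomputable def doubleAngle (p : RP1) : ℝ × ℝ :=
  (2 * p.rep 0 * p.rep 1 / (p.rep 0 ^ 2 + p.rep 1 ^ 2),
    (p.rep 1 ^ 2 - p.rep 0 ^ 2) / (p.rep 0 ^ 2 + p.rep 1 ^ 2))

theorem sq_add_sq_ne_zero {v : Fin 2 → ℝ} (hv : v ≠ 0) : v 0 ^ 2 + v 1 ^ 2 ≠ 0 := fun h =>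
  hv (vec_ext (by simpa using (show v 0 = 0 by nlinarith [sq_nonneg (v 0), sq_nonneg (v 1)]))
    (by simpa using (show v 1 = 0 by nlinarith [sq_nonneg (v 0), sq_nonneg (v 1)])))

theorem doubleAngle_mk {v : Fin 2 → ℝ} (hv : v ≠ 0) :
    doubleAngle (Projectivization.mk ℝ v hv) =
      (2 * v 0 * v 1 / (v 0 ^ 2 + v 1 ^ 2), (v 1 ^ 2 - v 0 ^ 2) / (v 0 ^ 2 + v 1 ^ 2)) := by
  obtain ⟨a, ha⟩ := Projectivization.exists_smul_eq_mk_rep ℝ v hv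
  have hn := sq_add_sq_ne_zero hv
  have ha0 : (a : ℝ) ≠ 0 := a.ne_zero
  have e0 : (Projectivization.mk ℝ v hv).rep 0 = a * v 0 := by rw [← ha]; rfl
  have e1 : (Projectivization.mk ℝ v hv).rep 1 = a * v 1 := by rw [← ha]; rfl
  have hn' : (a * v 0) ^ 2 + (a * v 1) ^ 2 ≠ 0 := by
    rw [show ((a : ℝ) * v 0) ^ 2 + (a * v 1) ^ 2 = (a : ℝ) ^ 2 * (v 0 ^ 2 + v 1 ^ 2) by ring]
    exact mul_ne_zero (pow_ne_zero _ ha0) hn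
  rw [doubleAngle, e0, e1, Prod.mk.injEq]
  constructor
  · rw [div_eq_div_iff hn' hn]; ring
  · rw [div_eq_div_iff hn' hn]; ring

/-- The double angle is a continuous injection into the plane. -/
instance : T2Space RP1 := by
  refine T2Space.of_injective_continuous (f := doubleAngle) ?_ ?_
  · intro p q hpq
    obtain ⟨s, rfl⟩ := line_surjective p
    obtain ⟨t, rfl⟩ := line_surjective q
    rw [line, line, doubleAngle_mk, doubleAngle_mk, Prod.mk.injEq] at hpq
    simp only [angleVec_zero, angleVec_one, sin_sq_add_cos_sq, div_one] at hpq
    have h1 := sin_sq_add_cos_sq s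
    have h2 := sin_sq_add_cos_sq t
    obtain ⟨h3, h4⟩ := hpq
    rw [line_eq_iff_sin, sin_sub]
    have : (sin s * cos t - cos s * sin t) ^ 2 = 0 := by
      have e1 : sin s ^ 2 = sin t ^ 2 := by linarith
      have e2 : cos s ^ 2 = cos t ^ 2 := by linarith
      have e3 : sin s * cos s = sin t * cos t := by linarith
      have : (sin s * cos t - cos s * sin t) ^ 2 =
        sin s ^ 2 * cos t ^ 2 + cos s ^ 2 * sin t ^ 2 - 2 * (sin s * cos s) * (sin t * cos t) := by
        ring
      rw [this, e1, e2, e3]; ring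
    exact pow_eq_zero_iff (two_ne_zero) |>.1 this
  · refine continuous_coinduced_dom.2 ?_
    have e : (doubleAngle ∘ fun v : {v : Fin 2 → ℝ // v ≠ 0} => Projectivization.mk ℝ v.1 v.2) =
        fun v => (2 * v.1 0 * v.1 1 / (v.1 0 ^ 2 + v.1 1 ^ 2),
          (v.1 1 ^ 2 - v.1 0 ^ 2) / (v.1 0 ^ 2 + v.1 1 ^ 2)) := by
      funext v
      exact doubleAngle_mk v.2
    rw [e]
    have c0 : Continuous fun v : {v : Fin 2 → ℝ // v ≠ 0} => v.1 0 :=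
      (continuous_apply 0).comp continuous_subtype_val
    have c1 : Continuous fun v : {v : Fin 2 → ℝ // v ≠ 0} => v.1 1 :=
      (continuous_apply 1).comp continuous_subtype_val
    have cn := (c0.pow 2).add (c1.pow 2)
    exact Continuous.prodMk
      (((continuous_const.mul c0).mul c1).div cn fun v => sq_add_sq_ne_zero v.2)
      (((c1.pow 2).sub (c0.pow 2)).div cn fun v => sq_add_sq_ne_zero v.2)

theorem exists_line_eq (p : RP1) (s : ℝ) : ∃ t, s ≤ t ∧ t < s + π ∧ line t = p := by
  obtain ⟨t, rfl⟩ := line_surjective p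
  refine ⟨t + ((-⌊(t - s) / π⌋ : ℤ) : ℝ) * π, ?_, ?_, line_add_mul_pi t _⟩
  · have := Int.floor_le ((t - s) / π)
    rw [le_div_iff₀ pi_pos] at this
    push_cast; linarith
  · have := Int.lt_floor_add_one ((t - s) / π)
    rw [div_lt_iff₀ pi_pos] at this
    push_cast; linarith

/-- The complement is the image of a compact part of `[0, π]`, hence closed in a Hausdorff space. -/
theorem isOpen_of_preimage {V : Set RP1} (h : IsOpen (line ⁻¹' V)) : IsOpen V := by
  rw [← isClosed_compl_iff]
  have e : Vᶜ = line '' (Set.Icc 0 π ∩ (line ⁻¹' V)ᶜ) := by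
    ext p
    constructor
    · intro hp
      obtain ⟨t, h1, h2, rfl⟩ := exists_line_eq p 0
      exact ⟨t, ⟨⟨h1, by linarith⟩, hp⟩, rfl⟩
    · rintro ⟨t, ⟨-, ht⟩, rfl⟩
      exact ht
  rw [e]
  exact ((isCompact_Icc.inter_right h.isClosed_compl).image continuous_line).isClosed

theorem isOpen_image_line {S : Set ℝ} (h : IsOpen S) : IsOpen (line '' S) := by
  refine isOpen_of_preimage ?_
  have e : line ⁻¹' (line '' S) = ⋃ k : ℤ, (fun t => t + (k : ℝ) * π) ⁻¹' S := by
    ext t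
    simp only [Set.mem_preimage, Set.mem_image, Set.mem_iUnion]
    constructor
    · rintro ⟨s, hs, hst⟩
      obtain ⟨k, rfl⟩ := line_eq_iff.1 hst
      exact ⟨k, hs⟩
    · rintro ⟨k, hk⟩
      exact ⟨_, hk, line_add_mul_pi t k⟩
  rw [e]
  exact isOpen_iUnion fun k => h.preimage (continuous_id.add continuous_const)

/-! ### Norms and lifts -/

/-- The squared Euclidean norm. -/
def normSq (v : Fin 2 → ℝ) : ℝ := v 0 ^ 2 + v 1 ^ 2

theorem normSq_smul (c : ℝ) (v : Fin 2 → ℝ) : normSq (c • v) = c ^ 2 * normSq v := by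
  simp [normSq]; ring

theorem normSq_angleVec (θ : ℝ) : normSq (angleVec θ) = 1 := sin_sq_add_cos_sq θ

theorem normSq_pos {v : Fin 2 → ℝ} (hv : v ≠ 0) : 0 < normSq v :=
  lt_of_le_of_ne (add_nonneg (sq_nonneg _) (sq_nonneg _)) (sq_add_sq_ne_zero hv).symm

theorem mulVec_ne_zero (A : SL(2, ℝ)) {v : Fin 2 → ℝ} (hv : v ≠ 0) :
    (A : Matrix (Fin 2) (Fin 2) ℝ).mulVec v ≠ 0 :=
  (smul_ne_zero_iff_ne A).mpr hv

theorem det2_mulVec (A : SL(2, ℝ)) (v w : Fin 2 → ℝ) :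
    det2 ((A : Matrix (Fin 2) (Fin 2) ℝ).mulVec v) ((A : Matrix (Fin 2) (Fin 2) ℝ).mulVec w) =
      det2 v w := by
  have h := A.2
  rw [Matrix.det_fin_two] at h
  simp only [det2, Matrix.mulVec, dotProduct, Fin.sum_univ_two]
  linear_combination (v 0 * w 1 - v 1 * w 0) * h

/-- The squared expansion of the direction of angle `θ`. -/
noncomputable def expansion (A : SL(2, ℝ)) (θ : ℝ) : ℝ :=
  normSq ((A : Matrix (Fin 2) (Fin 2) ℝ).mulVec (angleVec θ))

theorem expansion_pos (A : SL(2, ℝ)) (θ : ℝ) : 0 < expansion A θ :=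
  normSq_pos (mulVec_ne_zero A (angleVec_ne_zero θ))

theorem angleVec_add_pi (θ : ℝ) : angleVec (θ + π) = -angleVec θ :=
  vec_ext (sin_add_pi θ) (cos_add_pi θ)

theorem expansion_add_pi (A : SL(2, ℝ)) (θ : ℝ) : expansion A (θ + π) = expansion A θ := by
  rw [expansion, expansion, angleVec_add_pi, Matrix.mulVec_neg]
  simp only [normSq, Pi.neg_apply]
  ring

theorem continuous_expansion (A : SL(2, ℝ)) : Continuous (expansion A) := by
  unfold expansion normSq
  simp only [Matrix.mulVec, dotProduct, Fin.sum_univ_two, angleVec_zero, angleVec_one]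
  fun_prop

theorem IsLift.exists_factor {A : SL(2, ℝ)} {a : ℝ ≃o ℝ} (h : IsLift A a) :
    ∃ c : ℝ → ℝ, (∀ θ, (A : Matrix (Fin 2) (Fin 2) ℝ).mulVec (angleVec θ) =
      c θ • angleVec (a θ)) ∧ (∀ θ, expansion A θ = c θ ^ 2) ∧
      ∀ s t, c s * c t * sin (a s - a t) = sin (s - t) := by
  choose c hc using fun θ => exists_of_smul_line_eq (h.smul_line θ)
  refine ⟨c, hc, fun θ => ?_, fun s t => ?_⟩
  · rw [expansion, hc, normSq_smul, normSq_angleVec, mul_one]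
  · rw [← det2_angleVec s t, ← det2_mulVec A, hc, hc, ← det2_angleVec]
    simp only [det2, Pi.smul_apply, smul_eq_mul]
    ring

theorem expansion_mul {A B : SL(2, ℝ)} {b : ℝ ≃o ℝ} (hb : IsLift B b) (θ : ℝ) :
    expansion (A * B) θ = expansion A (b θ) * expansion B θ := by
  obtain ⟨c, h1, h2, -⟩ := hb.exists_factor
  rw [h2, expansion, Matrix.SpecialLinearGroup.coe_mul, ← Matrix.mulVec_mulVec, h1,
    Matrix.mulVec_smul, normSq_smul, mul_comm]
  rfl

theorem expansion_one (θ : ℝ) : expansion 1 θ = 1 := by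
  simp [expansion, normSq_angleVec]

/-! ### The quadratic form of an arc -/

/-- The quadratic form which vanishes at the ends of the arc `[l, r]`, evaluated at the unit
vector of angle `θ`. -/
noncomputable def arcForm (l r θ : ℝ) : ℝ := sin (θ - l) * sin (r - θ) / sin (r - l)

/-- The ends are moved one at a time. By the identities `i1` and `i2`, the differences, after
clearing denominators, are `sin (r' - r) * sin (θ - l) ^ 2 ≥ 0` and `sin (l - l') * sin (r' - θ) ^ 2
> 0`. -/
theorem arcForm_lt {l r l' r' θ : ℝ} (h1 : l' < l) (h2 : l ≤ θ) (h3 : θ ≤ r) (h4 : r < r')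
    (h5 : r' - l' < π) (hlr : l < r) : arcForm l r θ < arcForm l' r' θ := by
  have s1 : 0 < sin (r - l) := sin_pos_of_pos_of_lt_pi (by linarith) (by linarith)
  have s2 : 0 < sin (r' - l) := sin_pos_of_pos_of_lt_pi (by linarith) (by linarith)
  have s3 : 0 < sin (r' - l') := sin_pos_of_pos_of_lt_pi (by linarith) (by linarith)
  have s4 : 0 < sin (r' - r) := sin_pos_of_pos_of_lt_pi (by linarith) (by linarith)
  have s5 : 0 < sin (l - l') := sin_pos_of_pos_of_lt_pi (by linarith) (by linarith)
  have s6 : 0 < sin (r' - θ) := sin_pos_of_pos_of_lt_pi (by linarith) (by linarith)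
  have i1 : sin (r' - θ) * sin (r - l) - sin (r - θ) * sin (r' - l) = sin (r' - r) * sin (θ - l) := by
    simp only [sin_sub]
    ring
  have i2 : sin (θ - l') * sin (r' - l) - sin (θ - l) * sin (r' - l') =
      sin (l - l') * sin (r' - θ) := by
    simp only [sin_sub]
    ring
  refine lt_of_le_of_lt (b := arcForm l r' θ) ?_ ?_
  · rw [arcForm, arcForm, div_le_div_iff₀ s1 s2]
    have h0 : 0 ≤ sin (r' - r) * sin (θ - l) ^ 2 := by positivity
    have : sin (θ - l) * sin (r' - θ) * sin (r - l) - sin (θ - l) * sin (r - θ) * sin (r' - l) =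
      sin (r' - r) * sin (θ - l) ^ 2 := by linear_combination sin (θ - l) * i1
    linarith
  · rw [arcForm, arcForm, div_lt_div_iff₀ s2 s3]
    have h0 : 0 < sin (l - l') * sin (r' - θ) ^ 2 := by positivity
    have : sin (θ - l') * sin (r' - θ) * sin (r' - l) - sin (θ - l) * sin (r' - θ) * sin (r' - l') =
      sin (l - l') * sin (r' - θ) ^ 2 := by linear_combination sin (r' - θ) * i2
    linarith

/-- The form is `det (v, l) det (r, v) / det (r, l)`, which depends on `l` and `r` only as lines and
is preserved by `SL(2, ℝ)`. The expansion factor comes from normalizing the image of the unit vector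
`v`. -/
theorem arcForm_lift {A : SL(2, ℝ)} {a : ℝ ≃o ℝ} (h : IsLift A a) {l r : ℝ}
    (hlr : l < r) (hr : r < l + π) (θ : ℝ) :
    arcForm l r θ = expansion A θ * arcForm (a l) (a r) (a θ) := by
  obtain ⟨c, h1, h2, h3⟩ := h.exists_factor
  have s1 : 0 < sin (r - l) := sin_pos_of_pos_of_lt_pi (by linarith) (by linarith)
  have s2 := h3 r l
  have hcc : c r * c l ≠ 0 := fun h0 => by rw [h0, zero_mul] at s2; linarith
  have hs : sin (a r - a l) ≠ 0 := fun h0 => by rw [h0, mul_zero] at s2; linarith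
  have hcr := left_ne_zero_of_mul hcc
  have hcl := right_ne_zero_of_mul hcc
  rw [arcForm, arcForm, h2, ← h3 θ l, ← h3 r θ, ← s2]
  field_simp

theorem arcForm_add_pi (l r θ : ℝ) : arcForm (l + π) (r + π) (θ + π) = arcForm l r θ := by
  simp [arcForm]

theorem continuous_arcForm (l r : ℝ) : Continuous (arcForm l r) := by
  unfold arcForm; fun_prop

theorem arcForm_nonneg {l r θ : ℝ} (h1 : l ≤ θ) (h2 : θ ≤ r) (h3 : r < l + π) :
    0 ≤ arcForm l r θ :=
  div_nonneg (mul_nonneg (sin_nonneg_of_nonneg_of_le_pi (by linarith) (by linarith))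
    (sin_nonneg_of_nonneg_of_le_pi (by linarith) (by linarith)))
    (sin_nonneg_of_nonneg_of_le_pi (by linarith) (by linarith))

end RP1

section

/-! ### Expansion and contraction along words -/

open Real RP1 Topology

/-- The composition of the lifts along a word; the last letter acts first. -/
def wordLift {ι : Type*} (a : ι → ℝ ≃o ℝ) : List ι → ℝ ≃o ℝ
  | [] => OrderIso.refl ℝ
  | i :: w => (wordLift a w).trans (a i)

theorem wordLift_append {ι : Type*} (a : ι → ℝ ≃o ℝ) (v w : List ι) (θ : ℝ) :
    wordLift a (v ++ w) θ = wordLift a v (wordLift a w θ) := by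
  induction v with
  | nil => rfl
  | cons i v ih => simp [wordLift, ih]

theorem isLift_wordLift {ι : Type*} {A : ι → SL(2, ℝ)} {a : ι → ℝ ≃o ℝ}
    (h : ∀ i, IsLift (A i) (a i)) (w : List ι) : IsLift (w.map A).prod (wordLift a w) := by
  induction w with
  | nil => exact IsLift.one
  | cons i w ih => rw [List.map_cons, List.prod_cons]; exact (h i).mul ih

theorem IsArcFamily.r_lt {q : ℕ} {l r : ℤ → ℝ} (h : IsArcFamily q l r) (hq : 0 < q) (n : ℤ) :
    r n < l n + π := by
  rw [← h.l_shift]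
  exact h.r_lt_l (by omega)

theorem exists_pos_uniform {N q : ℕ} (hq : 0 < q) {P : ℝ → Fin N → ℤ → Prop}
    (hex : ∀ i n, ∃ ε > 0, P ε i n) (hmono : ∀ ε ε' i n, 0 < ε' → ε' ≤ ε → P ε i n → P ε' i n)
    (hper : ∀ ε i n, P ε i (n + q) ↔ P ε i n) : ∃ ε > 0, ∀ i n, P ε i n := by
  have : ∀ᶠ ε in 𝓝[>] (0 : ℝ), ∀ i, ∀ n ∈ Finset.Ico (0 : ℤ) q, P ε i n := by
    rw [Filter.eventually_all]
    intro i
    rw [Filter.eventually_all_finset]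
    intro n _
    obtain ⟨ε, hε, hP⟩ := hex i n
    filter_upwards [Ioc_mem_nhdsGT hε] with ε' h
    exact hmono ε ε' i n h.1 h.2 hP
  obtain ⟨ε, hε, hpos⟩ := (this.and self_mem_nhdsWithin).exists
  refine ⟨ε, hpos, fun i n => ?_⟩
  obtain ⟨k, h1, h2⟩ := exists_shift_mem hq 0 n
  have hk : P ε i (n + k * q) ↔ P ε i n := by
    have : Function.Periodic (P ε i) (q : ℤ) := fun m => propext (hper ε i m)
    exact iff_of_eq (this.int_mul k n)
  rw [← hk]
  exact hε i _ (by simp only [Finset.mem_Ico]; omega)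

namespace Realizes

variable {N q : ℕ} {f : Fin N → ℤ → ℤ} {A : Fin N → SL(2, ℝ)} {a : Fin N → ℝ ≃o ℝ} {l r : ℤ → ℝ}

theorem wordLift_mem (h : Realizes q f A a l r) (w : List (Fin N)) {n : ℤ} {θ : ℝ}
    (h1 : l n ≤ θ) (h2 : θ ≤ r n) :
    l (evalWord f w n) ≤ wordLift a w θ ∧ wordLift a w θ ≤ r (evalWord f w n) := by
  induction w with
  | nil => exact ⟨h1, h2⟩
  | cons i w ih =>
    exact ⟨((h.maps i).left _).le.trans ((a i).monotone ih.1),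
      ((a i).monotone ih.2).trans ((h.maps i).right _).le⟩

/-- Transporting the form of an arc by `A i` gives the form of the image arc, which is strictly
smaller than that of the target arc on a compact set. The last two bounds compare the form with the
norm: it is bounded above, and bounded below after one letter, even at the ends where it vanishes.
-/
theorem exists_arcForm_expansion (h : Realizes q f A a l r) (hf : ∀ i, IsDegOne q (f i))
    (hq : 0 < q) : ∃ ε > 0, ∀ i n θ, l n ≤ θ → θ ≤ r n →
      (1 + ε) * arcForm (l n) (r n) θ ≤
          expansion (A i) θ * arcForm (l (f i n)) (r (f i n)) (a i θ) ∧
        ε ≤ expansion (A i) θ * arcForm (l (f i n)) (r (f i n)) (a i θ) ∧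
        arcForm (l n) (r n) θ * ε ≤ 1 := by
  refine exists_pos_uniform hq (P := fun ε i n => ∀ θ, l n ≤ θ → θ ≤ r n →
      (1 + ε) * arcForm (l n) (r n) θ ≤
          expansion (A i) θ * arcForm (l (f i n)) (r (f i n)) (a i θ) ∧
        ε ≤ expansion (A i) θ * arcForm (l (f i n)) (r (f i n)) (a i θ) ∧
        arcForm (l n) (r n) θ * ε ≤ 1) ?_ ?_ ?_
  · intro i n
    set u := arcForm (l n) (r n) with hu
    set v : ℝ → ℝ := fun θ => expansion (A i) θ * arcForm (l (f i n)) (r (f i n)) (a i θ) with hv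
    have cu : Continuous u := continuous_arcForm _ _
    have cv : Continuous v := (continuous_expansion _).mul
      ((continuous_arcForm _ _).comp (a i).continuous)
    have hlr := h.arcs.lt n
    have hne : (Set.Icc (l n) (r n)).Nonempty := ⟨l n, le_rfl, hlr.le⟩
    have h0 : ∀ θ ∈ Set.Icc (l n) (r n), 0 ≤ u θ := fun θ hθ =>
      arcForm_nonneg hθ.1 hθ.2 (h.arcs.r_lt hq n)
    have huv : ∀ θ ∈ Set.Icc (l n) (r n), u θ < v θ := by
      intro θ hθ
      have e := arcForm_lift (h.isLift i) hlr (h.arcs.r_lt hq n) θ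
      simp only [hu, hv]
      rw [e]
      refine mul_lt_mul_of_pos_left ?_ (expansion_pos _ _)
      refine arcForm_lt ((h.maps i).left n) ((a i).monotone hθ.1) ((a i).monotone hθ.2)
        ((h.maps i).right n) ?_ ((a i).strictMono hlr)
      have := h.arcs.r_lt hq (f i n)
      linarith
    obtain ⟨x, hx, hx'⟩ := isCompact_Icc.exists_isMinOn hne (cv.sub cu).continuousOn
    obtain ⟨y, hy, hy'⟩ := isCompact_Icc.exists_isMaxOn hne cu.continuousOn
    have m0 : 0 < v x - u x := by have := huv x hx; linarith
    have U0 : 0 ≤ u y := h0 y hy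
    -- Here `x` minimizes `v - u` and `y` maximizes `u`. The three terms secure, in order, the
    -- growth factor, the lower bound of `v`, and the upper bound of `u`.
    refine ⟨min ((v x - u x) / (u y + 1)) (min (v x - u x) (1 / (u y + 1))), by positivity,
      fun θ h1 h2 => ?_⟩
    set ε := min ((v x - u x) / (u y + 1)) (min (v x - u x) (1 / (u y + 1)))
    have e1 : ε ≤ (v x - u x) / (u y + 1) := min_le_left _ _
    have e2 : ε ≤ v x - u x := (min_le_right _ _).trans (min_le_left _ _)
    have e3 : ε ≤ 1 / (u y + 1) := (min_le_right _ _).trans (min_le_right _ _)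
    have e0 : 0 < ε := by positivity
    rw [le_div_iff₀ (by linarith)] at e1 e3
    have k1 : v x - u x ≤ v θ - u θ := hx' ⟨h1, h2⟩
    have k2 : u θ ≤ u y := hy' ⟨h1, h2⟩
    have k3 := h0 θ ⟨h1, h2⟩
    change (1 + ε) * u θ ≤ v θ ∧ ε ≤ v θ ∧ u θ * ε ≤ 1
    have k4 : u θ * ε ≤ u y * ε := mul_le_mul_of_nonneg_right k2 e0.le
    refine ⟨?_, ?_, ?_⟩
    · linarith
    · linarith
    · linarith
  · intro ε ε' i n h0 hle hP θ h1 h2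
    obtain ⟨k1, k2, k3⟩ := hP θ h1 h2
    have := arcForm_nonneg h1 h2 (h.arcs.r_lt hq n)
    exact ⟨le_trans (mul_le_mul_of_nonneg_right (by linarith) this) k1, hle.trans k2,
      le_trans (mul_le_mul_of_nonneg_left hle this) k3⟩
  · intro ε i n
    have e : ∀ θ, (1 + ε) * arcForm (l (n + q)) (r (n + q)) (θ + π) ≤
          expansion (A i) (θ + π) * arcForm (l (f i (n + q))) (r (f i (n + q))) (a i (θ + π)) ∧
        ε ≤ expansion (A i) (θ + π) *
          arcForm (l (f i (n + q))) (r (f i (n + q))) (a i (θ + π)) ∧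
        arcForm (l (n + q)) (r (n + q)) (θ + π) * ε ≤ 1 ↔
        (1 + ε) * arcForm (l n) (r n) θ ≤
          expansion (A i) θ * arcForm (l (f i n)) (r (f i n)) (a i θ) ∧
        ε ≤ expansion (A i) θ * arcForm (l (f i n)) (r (f i n)) (a i θ) ∧
        arcForm (l n) (r n) θ * ε ≤ 1 := fun θ => by
      rw [(hf i).shift, h.arcs.l_shift, h.arcs.r_shift, h.arcs.l_shift, h.arcs.r_shift,
        (h.isLift i).add_pi, arcForm_add_pi, arcForm_add_pi, expansion_add_pi]
    constructor
    · intro hP θ h1 h2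
      exact (e θ).1 (hP (θ + π) (by rw [h.arcs.l_shift]; linarith)
        (by rw [h.arcs.r_shift]; linarith))
    · intro hP θ h1 h2
      rw [h.arcs.l_shift] at h1
      rw [h.arcs.r_shift] at h2
      have := (e (θ - π)).2 (hP (θ - π) (by linarith) (by linarith))
      rwa [sub_add_cancel] at this

/-- The form grows by `1 + ε` at each letter while staying comparable with the squared norm. The
letter acting first is split off, since the form may vanish at the starting direction but not at its
image. -/
theorem exists_expansion (h : Realizes q f A a l r) (hf : ∀ i, IsDegOne q (f i))
    (hq : 0 < q) : ∃ c > 0, ∃ lam > 1, ∀ (w : List (Fin N)) (n : ℤ) (θ : ℝ), l n ≤ θ → θ ≤ r n →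
      c * lam ^ w.length ≤ expansion (w.map A).prod θ := by
  obtain ⟨ε, hε, H⟩ := h.exists_arcForm_expansion hf hq
  have grow : ∀ (w : List (Fin N)) (n : ℤ) (θ : ℝ), l n ≤ θ → θ ≤ r n →
      (1 + ε) ^ w.length * arcForm (l n) (r n) θ ≤ expansion (w.map A).prod θ *
        arcForm (l (evalWord f w n)) (r (evalWord f w n)) (wordLift a w θ) := by
    intro w n θ h1 h2
    induction w with
    | nil => simp [expansion_one, evalWord, wordLift]
    | cons i w ih =>
      obtain ⟨k1, k2⟩ := h.wordLift_mem w h1 h2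
      have := (H i _ _ k1 k2).1
      rw [List.map_cons, List.prod_cons, expansion_mul (isLift_wordLift h.isLift w),
        List.length_cons, pow_succ]
      calc (1 + ε) ^ w.length * (1 + ε) * arcForm (l n) (r n) θ
          = (1 + ε) * ((1 + ε) ^ w.length * arcForm (l n) (r n) θ) := by ring
        _ ≤ (1 + ε) * (expansion (w.map A).prod θ *
          arcForm (l (evalWord f w n)) (r (evalWord f w n)) (wordLift a w θ)) := by gcongr
        _ = expansion (w.map A).prod θ * ((1 + ε) *
          arcForm (l (evalWord f w n)) (r (evalWord f w n)) (wordLift a w θ)) := by ring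
        _ ≤ expansion (w.map A).prod θ * (expansion (A i) (wordLift a w θ) *
          arcForm (l (f i (evalWord f w n))) (r (f i (evalWord f w n)))
            (a i (wordLift a w θ))) :=
          mul_le_mul_of_nonneg_left this (expansion_pos _ _).le
        _ = _ := by simp only [evalWord, wordLift, Function.comp, OrderIso.trans_apply]; ring
  -- One `ε` is the lower bound of the form after the first letter, the other its upper bound `1 /
  -- ε` at the end; the factor `1 + ε` is lost on the first letter, and `1` is for the empty word.
  refine ⟨min 1 (ε ^ 2 / (1 + ε)), by positivity, 1 + ε, by linarith, fun w n θ h1 h2 => ?_⟩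
  rcases List.eq_nil_or_concat w with rfl | ⟨v, i, rfl⟩
  · simp [expansion_one]
  · rw [List.concat_eq_append, List.map_append, List.prod_append, expansion_mul (isLift_wordLift h.isLift [i])]
    have e : wordLift a [i] θ = a i θ := rfl
    have e' : ([i].map A).prod = A i := by simp
    rw [e, e', List.length_append, List.length_singleton, pow_succ]
    obtain ⟨-, k2, -⟩ := H i n θ h1 h2
    obtain ⟨k3, k4⟩ := h.wordLift_mem [i] h1 h2
    change l (f i n) ≤ a i θ at k3
    change a i θ ≤ r (f i n) at k4
    have g := grow v (f i n) (a i θ) k3 k4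
    obtain ⟨k5, k6⟩ := h.wordLift_mem v k3 k4
    have k7 := (H i _ _ k5 k6).2.2
    have p1 := expansion_pos (v.map A).prod (a i θ)
    have p2 := expansion_pos (A i) θ
    have hL : (0 : ℝ) < (1 + ε) ^ v.length := by positivity
    set L := (1 + ε) ^ v.length
    set E := expansion (v.map A).prod (a i θ)
    set G := expansion (A i) θ
    set Q := arcForm (l (f i n)) (r (f i n)) (a i θ)
    set Q' := arcForm (l (evalWord f v (f i n))) (r (evalWord f v (f i n))) (wordLift a v (a i θ))
    calc min 1 (ε ^ 2 / (1 + ε)) * (L * (1 + ε)) ≤ ε ^ 2 / (1 + ε) * (L * (1 + ε)) := by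
          gcongr; exact min_le_right _ _
      _ = ε * (L * ε) := by field_simp
      _ ≤ ε * (L * (G * Q)) := by gcongr
      _ = ε * G * (L * Q) := by ring
      _ ≤ ε * G * (E * Q') := by gcongr
      _ = E * G * (Q' * ε) := by ring
      _ ≤ E * G * 1 := by gcongr
      _ = E * G := mul_one _

/-- Preservation of the determinant at the two ends of an arc gives sine of the image length times
the two stretching factors equal to `sin (r n - l n)`. The factors grow exponentially, so that sine
is small; the image stays inside an arc, which prevents its length from being close to `π`. -/
theorem exists_contraction (h : Realizes q f A a l r) (hf : ∀ i, IsDegOne q (f i)) (hq : 0 < q)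
    {δ : ℝ} (hδ : 0 < δ) : ∃ K : ℕ, ∀ w : List (Fin N), K ≤ w.length → ∀ n,
      wordLift a w (r n) - wordLift a w (l n) < δ := by
  obtain ⟨c, hc, lam, hlam, H⟩ := h.exists_expansion hf hq
  obtain ⟨η, hη, hη'⟩ := exists_pos_le_of_periodic hq (φ := fun n => sin (r n - l n))
    (fun n => by simp [h.arcs.l_shift, h.arcs.r_shift])
    (fun n => sin_pos_of_pos_of_lt_pi (by linarith [h.arcs.lt n])
      (by linarith [h.arcs.r_lt hq n]))
  obtain ⟨K, hK⟩ := pow_unbounded_of_one_lt (π / (η * c * δ)) hlam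
  refine ⟨K, fun w hw n => ?_⟩
  have hl := isLift_wordLift h.isLift w
  obtain ⟨C, -, hC, hC'⟩ := hl.exists_factor
  have hlr := h.arcs.lt n
  have m1 := (h.wordLift_mem w le_rfl hlr.le).1
  have m2 := (h.wordLift_mem w hlr.le le_rfl).2
  set m := evalWord f w n
  set x := wordLift a w (r n) - wordLift a w (l n) with hx
  set X := r m - l m with hX
  have x0 : 0 < x := sub_pos.2 ((wordLift a w).strictMono hlr)
  have xX : x ≤ X := by linarith
  have Xpi : X < π := by have := h.arcs.r_lt hq m; linarith
  -- Concavity of the sine on `[0, π]`: on `[0, X]` it lies above the chord, which bounds `x` by a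
  -- multiple of `sin x`.
  have conc : x * sin X ≤ π * sin x := by
    have := strictConcaveOn_sin_Icc.concaveOn.2 (⟨le_rfl, pi_pos.le⟩ : (0 : ℝ) ∈ Set.Icc 0 π)
      (⟨by linarith, Xpi.le⟩ : X ∈ Set.Icc 0 π)
      (show 0 ≤ 1 - x / X by rw [sub_nonneg, div_le_one (by linarith)]; exact xX)
      (show 0 ≤ x / X from div_nonneg x0.le (by linarith)) (by ring)
    simp only [smul_eq_mul, mul_zero, sin_zero, zero_add] at this
    rw [div_mul_cancel₀ _ (by linarith), div_mul_eq_mul_div, div_le_iff₀ (by linarith)] at this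
    have hs : 0 ≤ sin x := sin_nonneg_of_nonneg_of_le_pi x0.le (by linarith)
    nlinarith
  have e1 := hC' (r n) (l n)
  have e2 := H w n (r n) hlr.le le_rfl
  have e3 := H w n (l n) le_rfl hlr.le
  rw [hC] at e2 e3
  have e4 := sin_le_one (r n - l n)
  have e5 : 0 < sin (r n - l n) := hη.trans_le (hη' n)
  have hsx : 0 < sin x := sin_pos_of_pos_of_lt_pi x0 (by linarith)
  rw [← hx] at e1
  have hcc : 0 < C (r n) * C (l n) := by
    by_contra hcon
    nlinarith
  have hcl : 0 < c * lam ^ w.length := by positivity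
  have hpow : lam ^ K ≤ lam ^ w.length := pow_le_pow_right₀ hlam.le hw
  have e6 : c * lam ^ w.length ≤ C (r n) * C (l n) := by
    refine le_of_sq_le_sq ?_ hcc.le
    rw [mul_pow]
    nlinarith [mul_le_mul e2 e3 hcl.le (sq_nonneg _)]
  rw [div_lt_iff₀ (by positivity)] at hK
  have e7 : c * lam ^ K * sin x ≤ 1 := by
    have : c * lam ^ K * sin x ≤ C (r n) * C (l n) * sin x := by
      refine mul_le_mul_of_nonneg_right (le_trans ?_ e6) hsx.le
      exact mul_le_mul_of_nonneg_left hpow hc.le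
    linarith
  have e8 : x * η ≤ π * sin x := le_trans (mul_le_mul_of_nonneg_left (hη' m) x0.le) conc
  by_contra hcon
  have hlK : 0 < c * lam ^ K := by positivity
  have e9 : δ * η * (c * lam ^ K) ≤ π * sin x * (c * lam ^ K) := by
    refine mul_le_mul_of_nonneg_right (le_trans ?_ e8) hlK.le
    exact mul_le_mul_of_nonneg_right (not_lt.1 hcon) hη.le
  nlinarith [pi_pos]

/-- The gaps `[r n, l (n + 1)]` are again arcs, and `A i⁻¹` sends the gap `m` inside the gap `n`
with `f i n ≤ m < f i (n + 1)`, that is `n = upperAdj (f i) m`. All results on unstable directions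
thus apply to stable ones. -/
theorem dual (h : Realizes q f A a l r) (hf : TightSystem q f) :
    Realizes q (fun i => upperAdj (f i)) (fun i => (A i)⁻¹) (fun i => (a i).symm) r
      (fun n => l (n + 1)) where
  arcs := ⟨h.arcs.lt_succ, fun n => h.arcs.lt (n + 1), h.arcs.r_shift, fun n => by
    rw [add_right_comm, h.arcs.l_shift]⟩
  isLift i := (h.isLift i).inv
  maps i := by
    have gc := (hf.deg i).gc hf.pos
    refine ⟨fun m => ?_, fun m => ?_⟩
    · rw [OrderIso.lt_symm_apply]
      exact ((h.maps i).right _).trans_le (h.arcs.r_strictMono.monotone (gc.l_u_le m))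
    · rw [OrderIso.symm_apply_lt]
      refine lt_of_le_of_lt (h.arcs.l_strictMono.monotone ?_) ((h.maps i).left _)
      have := mt (gc (upperAdj (f i) m + 1) m).1 (by omega)
      omega

end Realizes

end

section

/-! ### Limit directions -/

open Real RP1 Topology

/-- The first `k` letters of an infinite word. -/
def prefixWord {α : Type*} (z : ℕ → α) (k : ℕ) : List α := (List.range k).map z

theorem length_prefixWord {α : Type*} (z : ℕ → α) (k : ℕ) : (prefixWord z k).length = k := by
  simp [prefixWord]

theorem prefixWord_succ {α : Type*} (z : ℕ → α) (k : ℕ) :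
    prefixWord z (k + 1) = prefixWord z k ++ [z k] := by
  simp [prefixWord, List.range_succ]

theorem prefixWord_succ' {α : Type*} (z : ℕ → α) (k : ℕ) :
    prefixWord z (k + 1) = z 0 :: prefixWord (fun n => z (n + 1)) k := by
  simp [prefixWord, List.range_succ_eq_map, Function.comp_def]

theorem prefixWord_congr {α : Type*} {z z' : ℕ → α} {k : ℕ} (h : ∀ i < k, z' i = z i) :
    prefixWord z' k = prefixWord z k :=
  List.map_congr_left fun i hi => h i (List.mem_range.1 hi)

/-- The images of the arcs under a word. -/
def wordArcs {ι : Type*} (a : ι → ℝ ≃o ℝ) (l r : ℤ → ℝ) (w : List ι) : Set RP1 :=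
  {p | ∃ n θ, l n ≤ θ ∧ θ ≤ r n ∧ line (wordLift a w θ) = p}

theorem IsArcFamily.l_shift_mul {q : ℕ} {l r : ℤ → ℝ} (h : IsArcFamily q l r) (n k : ℤ) :
    l (n + k * q) = l n + k * π := by
  induction k using Int.induction_on with
  | zero => simp
  | succ k ih =>
    have := h.l_shift (n + (k : ℤ) * q)
    rw [ih] at this
    rw [show n + ((k : ℤ) + 1) * q = n + (k : ℤ) * q + q by ring, this]
    push_cast; ring
  | pred k ih =>
    have := h.l_shift (n + (-(k : ℤ) - 1) * q)
    rw [show n + (-(k : ℤ) - 1) * q + q = n + (-(k : ℤ)) * q by ring, ih] at this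
    push_cast at this ⊢
    linarith

theorem IsArcFamily.dual {q : ℕ} {l r : ℤ → ℝ} (h : IsArcFamily q l r) :
    IsArcFamily q r (fun n => l (n + 1)) :=
  ⟨h.lt_succ, fun n => h.lt (n + 1), h.r_shift, fun n => by rw [add_right_comm, h.l_shift]⟩

theorem IsArcFamily.r_shift_mul {q : ℕ} {l r : ℤ → ℝ} (h : IsArcFamily q l r) (n k : ℤ) :
    r (n + k * q) = r n + k * π := h.dual.l_shift_mul n k

namespace Realizes

variable {N q : ℕ} {f : Fin N → ℤ → ℤ} {A : Fin N → SL(2, ℝ)} {a : Fin N → ℝ ≃o ℝ} {l r : ℤ → ℝ}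

theorem wordArcs_append_subset (h : Realizes q f A a l r) (v w : List (Fin N)) :
    wordArcs a l r (v ++ w) ⊆ wordArcs a l r v := by
  rintro p ⟨n, θ, h1, h2, rfl⟩
  obtain ⟨h3, h4⟩ := h.wordLift_mem w h1 h2
  exact ⟨_, _, h3, h4, by rw [wordLift_append]⟩

/-- The letters acting first, `u`, are numerous enough to bring all arcs into a single one modulo
`π`; the remaining ones, `v`, contract that arc. -/
theorem exists_wordArcs_subset (h : Realizes q f A a l r) (hs : TightSystem q f) {δ : ℝ}
    (hδ : 0 < δ) : ∃ K : ℕ, ∀ w : List (Fin N), K ≤ w.length →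
      ∃ s t, t - s < δ ∧ wordArcs a l r w ⊆ line '' Set.Icc s t := by
  obtain ⟨K₁, hK₁⟩ := h.exists_contraction hs.deg hs.pos hδ
  obtain ⟨K₂, hK₂⟩ := hs.hyp
  refine ⟨K₁ + K₂, fun w hw => ?_⟩
  obtain ⟨v, u, rfl, hv, hu⟩ : ∃ v u, w = v ++ u ∧ K₁ ≤ v.length ∧ K₂ ≤ u.length :=
    ⟨w.take K₁, w.drop K₁, (List.take_append_drop _ _).symm, by simp; omega, by simp; omega⟩
  set c := evalWord f u 0
  refine ⟨wordLift a v (l c), wordLift a v (r c), hK₁ v hv c, ?_⟩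
  rintro p ⟨n, θ, h1, h2, rfl⟩
  obtain ⟨h3, h4⟩ := h.wordLift_mem u h1 h2
  obtain ⟨k, hk⟩ := hK₂ u hu n 0
  have e : evalWord f u n = c + k * q := by linarith
  rw [e, h.arcs.l_shift_mul] at h3
  rw [e, h.arcs.r_shift_mul] at h4
  refine ⟨wordLift a v (wordLift a u θ + ((-k : ℤ) : ℝ) * π), ⟨(wordLift a v).monotone ?_,
    (wordLift a v).monotone ?_⟩, ?_⟩
  · push_cast; linarith
  · push_cast; linarith
  · rw [(isLift_wordLift h.isLift v).add_mul_pi, line_add_mul_pi, wordLift_append]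

theorem isCompact_wordArcs (h : Realizes q f A a l r) (hq : 0 < q) (w : List (Fin N)) :
    IsCompact (wordArcs a l r w) := by
  have e : wordArcs a l r w = ⋃ n ∈ Finset.Ico (0 : ℤ) q,
      (fun θ => line (wordLift a w θ)) '' Set.Icc (l n) (r n) := by
    ext p
    simp only [Set.mem_iUnion, Set.mem_image, Set.mem_Icc, exists_prop]
    constructor
    · rintro ⟨n, θ, h1, h2, rfl⟩
      obtain ⟨k, h3, h4⟩ := exists_shift_mem hq 0 n
      refine ⟨n + k * q, by simp only [Finset.mem_Ico]; omega, θ + k * π, ⟨?_, ?_⟩, ?_⟩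
      · rw [h.arcs.l_shift_mul]; linarith
      · rw [h.arcs.r_shift_mul]; linarith
      · rw [(isLift_wordLift h.isLift w).add_mul_pi, line_add_mul_pi]
    · rintro ⟨n, -, θ, ⟨h1, h2⟩, rfl⟩
      exact ⟨n, θ, h1, h2, rfl⟩
  rw [e]
  exact Finset.isCompact_biUnion _ fun n _ =>
    isCompact_Icc.image (continuous_line.comp (wordLift a w).continuous)

theorem smul_mem_wordArcs (h : Realizes q f A a l r) (i : Fin N) {w : List (Fin N)} {p : RP1}
    (hp : p ∈ wordArcs a l r w) : A i • p ∈ wordArcs a l r (i :: w) := by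
  obtain ⟨n, θ, h1, h2, rfl⟩ := hp
  exact ⟨n, θ, h1, h2, by rw [(h.isLift i).smul_line]; rfl⟩

theorem exists_limit (h : Realizes q f A a l r) (hs : TightSystem q f) :
    ∃ E : (ℕ → Fin N) → RP1, Continuous E ∧ (∀ z k, E z ∈ wordArcs a l r (prefixWord z k)) ∧
      ∀ z p, (∀ k, p ∈ wordArcs a l r (prefixWord z k)) → p = E z := by
  have hex : ∀ z : ℕ → Fin N, ∃ p, ∀ k, p ∈ wordArcs a l r (prefixWord z k) := by
    intro z
    have := IsCompact.nonempty_iInter_of_sequence_nonempty_isCompact_isClosed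
      (fun k => wordArcs a l r (prefixWord z k))
      (fun k => by rw [prefixWord_succ]; exact h.wordArcs_append_subset _ _)
      (fun k => ⟨_, 0, l 0, le_rfl, (h.arcs.lt 0).le, rfl⟩)
      (h.isCompact_wordArcs hs.pos _) (fun k => (h.isCompact_wordArcs hs.pos _).isClosed)
    obtain ⟨p, hp⟩ := this
    exact ⟨p, Set.mem_iInter.1 hp⟩
  choose E hE using hex
  refine ⟨E, ?_, hE, ?_⟩
  · rw [continuous_iff_continuousAt]
    intro z V hV
    obtain ⟨θ₀, hθ₀⟩ := line_surjective (E z)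
    rw [← hθ₀] at hV
    obtain ⟨δ, hδ, hball⟩ := Metric.mem_nhds_iff.1 (continuous_line.continuousAt hV)
    obtain ⟨K, hK⟩ := h.exists_wordArcs_subset hs hδ
    obtain ⟨s, t, hst, hsub⟩ := hK (prefixWord z K) (length_prefixWord z K).ge
    have hcyl : ∀ᶠ z' in 𝓝 z, ∀ i ∈ Finset.range K, z' i = z i := by
      rw [Filter.eventually_all_finset]
      intro i _
      exact (continuous_apply i).continuousAt.eventually
        ((isOpen_discrete {z i}).mem_nhds rfl)
    change ∀ᶠ z' in 𝓝 z, E z' ∈ V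
    filter_upwards [hcyl] with z' hz'
    have e := prefixWord_congr fun i hi => hz' i (Finset.mem_range.2 hi)
    obtain ⟨θ, ⟨h1, h2⟩, h3⟩ := hsub (hE z K)
    obtain ⟨θ', ⟨h1', h2'⟩, h3'⟩ := hsub (e ▸ hE z' K)
    rw [← hθ₀] at h3
    obtain ⟨k, rfl⟩ := line_eq_iff.1 h3.symm
    rw [← h3', ← line_add_mul_pi θ' k]
    refine hball ?_
    rw [Metric.mem_ball, Real.dist_eq, add_sub_add_right_eq_sub]
    exact abs_lt.2 ⟨by linarith, by linarith⟩
  · intro z p hp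
    obtain ⟨x, hx⟩ := line_surjective p
    obtain ⟨y, hy⟩ := line_surjective (E z)
    rw [← hx, ← hy, line_eq_iff_sin]
    by_contra hne
    obtain ⟨K, hK⟩ := h.exists_wordArcs_subset hs (abs_pos.2 hne)
    obtain ⟨s, t, hst, hsub⟩ := hK (prefixWord z K) (length_prefixWord z K).ge
    obtain ⟨θ, ⟨h1, h2⟩, h3⟩ := hsub (hp K)
    obtain ⟨θ', ⟨h1', h2'⟩, h3'⟩ := hsub (hE z K)
    obtain ⟨k, rfl⟩ := line_eq_iff.1 (hx.trans h3.symm)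
    obtain ⟨k', rfl⟩ := line_eq_iff.1 (hy.trans h3'.symm)
    have e : |sin (θ + k * π - (θ' + k' * π))| = |sin (θ - θ')| := by
      rw [show θ + k * π - (θ' + k' * π) = θ - θ' + ((k - k' : ℤ) : ℝ) * π by push_cast; ring,
        sin_add_int_mul_pi, abs_mul]
      simp
    rw [e] at hst
    have : |sin (θ - θ')| ≤ |θ - θ'| := abs_sin_le_abs
    have : |θ - θ'| ≤ t - s := abs_le.2 ⟨by linarith, by linarith⟩
    linarith

/-- The map sending an infinite word `z` to the limit of the images of the arcs under
`A (z 0) * ⋯ * A (z k)`. -/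
theorem exists_limit_map (h : Realizes q f A a l r) (hs : TightSystem q f) :
    ∃ E : (ℕ → Fin N) → RP1, Continuous E ∧ (∀ z, A (z 0) • E (fun k => z (k + 1)) = E z) ∧
      (∀ z, ∃ n θ, l n < θ ∧ θ < r n ∧ line θ = E z) ∧
      ∀ n, ∃ z θ, l n < θ ∧ θ < r n ∧ line θ = E z := by
  obtain ⟨E, hc, hE, hu⟩ := h.exists_limit hs
  -- The outermost letter maps arcs strictly inside arcs, so limit directions avoid the end points.
  have strict : ∀ z k, ∃ n θ, l n ≤ θ ∧ θ ≤ r n ∧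
      l (evalWord f (prefixWord z (k + 1)) n) < wordLift a (prefixWord z (k + 1)) θ ∧
      wordLift a (prefixWord z (k + 1)) θ < r (evalWord f (prefixWord z (k + 1)) n) ∧
      line (wordLift a (prefixWord z (k + 1)) θ) = E z := by
    intro z k
    obtain ⟨n, θ, h1, h2, h3⟩ := hE z (k + 1)
    refine ⟨n, θ, h1, h2, ?_, ?_, h3⟩
    · rw [prefixWord_succ']
      exact ((h.maps _).left _).trans_le ((a _).monotone (h.wordLift_mem _ h1 h2).1)
    · rw [prefixWord_succ']
      exact ((a _).monotone (h.wordLift_mem _ h1 h2).2).trans_lt ((h.maps _).right _)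
  refine ⟨E, hc, fun z => hu z _ fun k => ?_, fun z => ?_, fun m => ?_⟩
  · cases k with
    | zero =>
      have := h.smul_mem_wordArcs (z 0) (hE (fun k => z (k + 1)) 0)
      exact h.wordArcs_append_subset [] _ this
    | succ k =>
      rw [prefixWord_succ']
      exact h.smul_mem_wordArcs (z 0) (hE (fun k => z (k + 1)) k)
  · obtain ⟨n, θ, -, -, h1, h2, h3⟩ := strict z 0
    exact ⟨_, _, h1, h2, h3⟩
  · choose i n hin using hs.unstable
    -- To reach the arc `m`, preimages are chosen backwards: `s (k + 1)` is sent to `s k` by the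
    -- letter `z k`. Long prefixes are constant modulo `q`, hence send every arc to the arc `m`
    -- modulo `π`.
    set s : ℕ → ℤ := fun k => n^[k] m with hs'
    set z : ℕ → Fin N := fun k => i (s k) with hz
    have key : ∀ k, evalWord f (prefixWord z k) (s k) = m := by
      intro k
      induction k with
      | zero => rfl
      | succ k ih =>
        rw [prefixWord_succ, evalWord_append]
        have : evalWord f [z k] (s (k + 1)) = s k := by
          simp only [evalWord, hz, hs', Function.comp, Function.iterate_succ_apply']
          exact hin _
        rw [this, ih]
    obtain ⟨K, hK⟩ := hs.hyp
    obtain ⟨n', θ, -, -, h1, h2, h3⟩ := strict z K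
    obtain ⟨k, hk⟩ := hK (prefixWord z (K + 1)) (by rw [length_prefixWord]; omega) n' (s (K + 1))
    rw [key] at hk
    rw [show evalWord f (prefixWord z (K + 1)) n' = m + k * q by linarith] at h1 h2
    rw [h.arcs.l_shift_mul] at h1
    rw [h.arcs.r_shift_mul] at h2
    refine ⟨z, wordLift a (prefixWord z (K + 1)) θ + ((-k : ℤ) : ℝ) * π, ?_, ?_, ?_⟩
    · push_cast; linarith
    · push_cast; linarith
    · rw [line_add_mul_pi, h3]

end Realizes

end

section

/-! ### The hyperbolic splitting -/

open Real RP1 Topology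

namespace RP1

theorem mem_submodule_line {v : Fin 2 → ℝ} {θ : ℝ} :
    v ∈ (line θ).submodule ↔ ∃ c : ℝ, c • angleVec θ = v := by
  rw [line, Projectivization.submodule_mk, Submodule.mem_span_singleton]

theorem mulVec_mem_submodule (A : SL(2, ℝ)) {p : RP1} {v : Fin 2 → ℝ} (hv : v ∈ p.submodule) :
    (A : Matrix (Fin 2) (Fin 2) ℝ).mulVec v ∈ (A • p).submodule := by
  obtain ⟨θ, rfl⟩ := line_surjective p
  obtain ⟨φ, hφ⟩ := line_surjective (A • line θ)
  obtain ⟨c, rfl⟩ := mem_submodule_line.1 hv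
  obtain ⟨d, hd⟩ := exists_of_smul_line_eq hφ.symm
  rw [← hφ, mem_submodule_line, Matrix.mulVec_smul, hd]
  exact ⟨c * d, mul_smul _ _ _⟩

theorem norm_sq_le_normSq (v : Fin 2 → ℝ) : ‖v‖ ^ 2 ≤ normSq v := by
  have : ‖v‖ ≤ √(normSq v) := by
    refine (pi_norm_le_iff_of_nonneg (sqrt_nonneg _)).2 fun i => ?_
    rw [Real.norm_eq_abs]
    refine abs_le_sqrt ?_
    unfold normSq
    fin_cases i
    · simpa using sq_nonneg (v 1)
    · simpa using sq_nonneg (v 0)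
  calc ‖v‖ ^ 2 ≤ √(normSq v) ^ 2 := by gcongr
    _ = normSq v := sq_sqrt (add_nonneg (sq_nonneg _) (sq_nonneg _))

theorem normSq_le (v : Fin 2 → ℝ) : normSq v ≤ 2 * ‖v‖ ^ 2 := by
  have h : ∀ i, v i ^ 2 ≤ ‖v‖ ^ 2 := fun i => by
    rw [← sq_abs, ← Real.norm_eq_abs]
    gcongr
    exact norm_le_pi_norm v i
  have h0 := h 0
  have h1 := h 1
  unfold normSq
  linarith

theorem abs_det2_le (v w : Fin 2 → ℝ) : |det2 v w| ≤ 2 * (‖v‖ * ‖w‖) := by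
  have h : ∀ i j, |v i * w j| ≤ ‖v‖ * ‖w‖ := fun i j => by
    rw [abs_mul]
    exact mul_le_mul (norm_le_pi_norm v i) (norm_le_pi_norm w j) (abs_nonneg _) (norm_nonneg _)
  have h0 := abs_le.1 (h 0 1)
  have h1 := abs_le.1 (h 1 0)
  unfold det2
  exact abs_le.2 ⟨by linarith, by linarith⟩

end RP1

namespace SL2Cocycle

variable {N : ℕ} {A : Fin N → SL(2, ℝ)}

/-- The determinant of two vectors is invariant but would tend to `0`. Consequently a direction
contracted along a given sequence is unique, and so is the splitting. -/
theorem det2_eq_zero_of_contraction {G : ℕ → SL(2, ℝ)} {c lam c' lam' : ℝ} (hlam : 1 < lam)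
    (hlam' : 1 < lam') {v w : Fin 2 → ℝ}
    (hv : ∀ n, ‖(G n : Matrix (Fin 2) (Fin 2) ℝ).mulVec v‖ ≤ c * (lam ^ n)⁻¹ * ‖v‖)
    (hw : ∀ n, ‖(G n : Matrix (Fin 2) (Fin 2) ℝ).mulVec w‖ ≤ c' * (lam' ^ n)⁻¹ * ‖w‖) :
    det2 v w = 0 := by
  have lim : ∀ (c lam x : ℝ), 1 < lam →
      Filter.Tendsto (fun n : ℕ => c * (lam ^ n)⁻¹ * x) Filter.atTop (𝓝 0) := fun c lam x h => by
    have := ((tendsto_pow_atTop_atTop_of_one_lt h).inv_tendsto_atTop.const_mul c).mul_const x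
    simpa using this
  have l0 := (((lim c lam ‖v‖ hlam).mul (lim c' lam' ‖w‖ hlam')).const_mul 2)
  rw [mul_zero, mul_zero] at l0
  have : |det2 v w| ≤ 0 := by
    refine ge_of_tendsto' l0 fun n => ?_
    rw [← det2_mulVec (G n)]
    refine (abs_det2_le _ _).trans ?_
    gcongr
    · exact le_trans (norm_nonneg _) (hv n)
    · exact hv n
    · exact hw n
  exact abs_nonpos_iff.1 this

namespace IsHyperbolicSplitting

variable {es eu es' eu' : (ℤ → Fin N) → RP1}

theorem unique (h : IsHyperbolicSplitting A es eu) (h' : IsHyperbolicSplitting A es' eu') :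
    es = es' ∧ eu = eu' := by
  obtain ⟨c, -, lam, hlam, H⟩ := h.contraction
  obtain ⟨c', -, lam', hlam', H'⟩ := h'.contraction
  have mem : ∀ θ, angleVec θ ∈ (line θ).submodule := fun θ =>
    mem_submodule_line.2 ⟨1, one_smul _ _⟩
  constructor
  · funext x
    obtain ⟨s, hs⟩ := line_surjective (es x)
    obtain ⟨t, ht⟩ := line_surjective (es' x)
    rw [← hs, ← ht, line_eq_iff_sin, ← det2_angleVec]
    exact det2_eq_zero_of_contraction hlam hlam' (fun n => (H x n).1 _ (hs ▸ mem s))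
      fun n => (H' x n).1 _ (ht ▸ mem t)
  · funext x
    obtain ⟨s, hs⟩ := line_surjective (eu x)
    obtain ⟨t, ht⟩ := line_surjective (eu' x)
    rw [← hs, ← ht, line_eq_iff_sin, ← det2_angleVec]
    exact det2_eq_zero_of_contraction hlam hlam' (fun n => (H x n).2 _ (hs ▸ mem s))
      fun n => (H' x n).2 _ (ht ▸ mem t)

theorem Ku_eq (h : IsHyperbolicSplitting A es eu) : Ku A = Set.range eu := by
  ext p
  constructor
  · rintro ⟨es', eu', h', hp⟩
    rwa [(h.unique h').2]
  · exact fun hp => ⟨es, eu, h, hp⟩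

theorem Ks_eq (h : IsHyperbolicSplitting A es eu) : Ks A = Set.range es := by
  ext p
  constructor
  · rintro ⟨es', eu', h', hp⟩
    rwa [(h.unique h').1]
  · exact fun hp => ⟨es, eu, h, hp⟩

end IsHyperbolicSplitting

theorem backward_eq_inv (A : Fin N → SL(2, ℝ)) (x : ℤ → Fin N) (n : ℕ) :
    backward A x n = (((prefixWord (fun k => x (-((k : ℤ) + 1))) n).map A).prod)⁻¹ := by
  induction n with
  | zero => simp [backward, prefixWord]
  | succ n ih =>
    rw [prefixWord_succ, List.map_append, List.prod_append, mul_inv_rev, ← ih]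
    simp [backward]

theorem forward_eq_inv (A : Fin N → SL(2, ℝ)) (x : ℤ → Fin N) (n : ℕ) :
    forward A x n = (((prefixWord (fun k => x k) n).map fun i => (A i)⁻¹).prod)⁻¹ := by
  induction n with
  | zero => simp [forward, prefixWord]
  | succ n ih =>
    rw [prefixWord_succ, List.map_append, List.prod_append, mul_inv_rev, ← ih]
    simp [forward]

end SL2Cocycle

namespace Realizes

open SL2Cocycle

variable {N q : ℕ} {f : Fin N → ℤ → ℤ} {A : Fin N → SL(2, ℝ)} {a : Fin N → ℝ ≃o ℝ} {l r : ℤ → ℝ}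

theorem prefixWord_smul {E : (ℕ → Fin N) → RP1}
    (hE : ∀ z, A (z 0) • E (fun k => z (k + 1)) = E z) (z : ℕ → Fin N) (n : ℕ) :
    ((prefixWord z n).map A).prod • E (fun k => z (k + n)) = E z := by
  induction n generalizing z with
  | zero => simp [prefixWord]
  | succ n ih =>
    rw [prefixWord_succ', List.map_cons, List.prod_cons, mul_smul, ← hE z]
    congr 1
    simpa only [add_right_comm, add_assoc, add_comm 1 n] using ih fun k => z (k + 1)

/-- A vector of `E z` is the image, under the product of the first `n` matrices, of a vector in the
limit direction of the shifted word. That direction lies in an arc, where the product expands; so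
its inverse contracts. -/
theorem exists_limit_contraction (h : Realizes q f A a l r) (hs : TightSystem q f)
    {E : (ℕ → Fin N) → RP1} (hE : ∀ z, A (z 0) • E (fun k => z (k + 1)) = E z)
    (hE' : ∀ z, ∃ n θ, l n < θ ∧ θ < r n ∧ line θ = E z) :
    ∃ c > 0, ∃ lam > 1, ∀ z n, ∀ v ∈ (E z).submodule,
      ‖((((prefixWord z n).map A).prod⁻¹ : SL(2, ℝ)) : Matrix (Fin 2) (Fin 2) ℝ).mulVec v‖ ≤
        c * (lam ^ n)⁻¹ * ‖v‖ := by
  obtain ⟨c, hc, lam, hlam, H⟩ := h.exists_expansion hs.deg hs.pos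
  -- Square roots, because `expansion` measures squared norms; the `2` compares the Euclidean norm
  -- with the sup norm.
  refine ⟨√(2 / c), by positivity, √lam, by rw [gt_iff_lt, lt_sqrt zero_le_one]; simpa, ?_⟩
  intro z n v hv
  set Q := ((prefixWord z n).map A).prod with hQ
  have hmem := mulVec_mem_submodule Q⁻¹ hv
  rw [← prefixWord_smul hE z n, ← hQ, inv_smul_smul] at hmem
  set u := ((Q⁻¹ : SL(2, ℝ)) : Matrix (Fin 2) (Fin 2) ℝ).mulVec v with hu
  have hQu : (Q : Matrix (Fin 2) (Fin 2) ℝ).mulVec u = v := by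
    rw [hu, Matrix.mulVec_mulVec, ← Matrix.SpecialLinearGroup.coe_mul, mul_inv_cancel,
      Matrix.SpecialLinearGroup.coe_one, Matrix.one_mulVec]
  obtain ⟨m, θ, h1, h2, h3⟩ := hE' fun k => z (k + n)
  rw [← h3, mem_submodule_line] at hmem
  obtain ⟨b, hb⟩ := hmem
  have e1 : normSq u = b ^ 2 := by rw [← hb, normSq_smul, normSq_angleVec, mul_one]
  have e2 : normSq v = b ^ 2 * expansion Q θ := by
    rw [← hQu, ← hb, Matrix.mulVec_smul, normSq_smul, expansion]
  have e3 := H (prefixWord z n) m θ h1.le h2.le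
  rw [length_prefixWord] at e3
  have e4 : c * lam ^ n * ‖u‖ ^ 2 ≤ 2 * ‖v‖ ^ 2 := by
    calc c * lam ^ n * ‖u‖ ^ 2 ≤ c * lam ^ n * normSq u := by gcongr; exact norm_sq_le_normSq u
      _ = b ^ 2 * (c * lam ^ n) := by rw [e1]; ring
      _ ≤ b ^ 2 * expansion Q θ := by gcongr
      _ = normSq v := e2.symm
      _ ≤ _ := normSq_le v
  refine le_of_sq_le_sq ?_ (by positivity)
  rw [mul_pow, mul_pow, inv_pow, ← pow_mul, mul_comm n 2, pow_mul, sq_sqrt (by positivity),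
    sq_sqrt (by positivity), ← div_eq_mul_inv, div_div, div_mul_eq_mul_div,
    le_div_iff₀ (by positivity)]
  linarith

theorem disjoint_arcs (h : IsArcFamily q l r) {m n : ℤ} {s t : ℝ}
    (h1 : l m < s) (h2 : s < r m) (h3 : r n < t) (h4 : t < l (n + 1)) : line s ≠ line t := by
  intro he
  obtain ⟨k, rfl⟩ := line_eq_iff.1 he
  rw [show l m = l (m - k * q + k * q) by ring_nf, h.l_shift_mul] at h1
  rw [show r m = r (m - k * q + k * q) by ring_nf, h.r_shift_mul] at h2
  have a1 := h.l_strictMono.lt_iff_lt.1 (show l (m - k * q) < l (n + 1) by linarith)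
  have a2 := h.r_strictMono.lt_iff_lt.1 (show r n < r (m - k * q) by linarith)
  omega

/-- The splitting of a realization, with its position relative to the arcs. -/
theorem exists_splitting (h : Realizes q f A a l r) (hs : TightSystem q f) :
    ∃ es eu, IsHyperbolicSplitting A es eu ∧
      (∀ x i, ∃ y, A i • eu x = eu y) ∧
      (∀ x i, ∃ y, (A i)⁻¹ • es x = es y) ∧
      (∀ x, ∃ n θ, l n < θ ∧ θ < r n ∧ line θ = eu x) ∧
      (∀ n, ∃ x θ, l n < θ ∧ θ < r n ∧ line θ = eu x) ∧
      (∀ x, ∃ n θ, r n < θ ∧ θ < l (n + 1) ∧ line θ = es x) ∧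
      ∀ n, ∃ x θ, r n < θ ∧ θ < l (n + 1) ∧ line θ = es x := by
  obtain ⟨E, hEc, hE, hE1, hE2⟩ := h.exists_limit_map hs
  obtain ⟨F, hFc, hF, hF1, hF2⟩ := (h.dual hs).exists_limit_map hs.dual
  obtain ⟨c, hc, lam, hlam, H⟩ := h.exists_limit_contraction hs hE hE1
  obtain ⟨c', hc', lam', hlam', H'⟩ := (h.dual hs).exists_limit_contraction hs.dual hF hF1
  -- The stable direction depends on the future `x 0, x 1, …` through the inverses, the unstable one
  -- on the past read backwards, `x (-1), x (-2), …`.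
  refine ⟨fun x => F fun k => x k, fun x => E fun k => x (-((k : ℤ) + 1)),
    ⟨?_, ?_, ?_, ?_, ?_, ?_⟩, ?_, ?_, fun x => hE1 _, ?_, fun x => hF1 _, ?_⟩
  · exact hFc.comp (continuous_pi fun k => continuous_apply _)
  · exact hEc.comp (continuous_pi fun k => continuous_apply _)
  · intro x
    have := hF fun k => x k
    rw [inv_smul_eq_iff] at this
    rw [Nat.cast_zero] at this
    rw [← this]
    simp [shift]
  · intro x
    have := hE fun k => shift x (-((k : ℤ) + 1))
    rw [← this]
    simp [shift]
  · intro x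
    obtain ⟨n, θ, h1, h2, h3⟩ := hF1 fun k => x k
    obtain ⟨m, φ, k1, k2, k3⟩ := hE1 fun k => x (-((k : ℤ) + 1))
    rw [← h3, ← k3]
    exact (disjoint_arcs h.arcs k1 k2 h1 h2).symm
  · refine ⟨max c c', by positivity, min lam lam', lt_min hlam hlam', fun x n => ?_⟩
    have hl : 0 < min lam lam' := by positivity
    constructor
    · intro v hv
      rw [forward_eq_inv]
      refine (H' _ n v hv).trans ?_
      gcongr
      · exact le_max_right _ _
      · exact min_le_right _ _
    · intro v hv
      rw [backward_eq_inv]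
      refine (H _ n v hv).trans ?_
      gcongr
      · exact le_max_left _ _
      · exact min_le_left _ _
  · intro x i
    -- Applying `A i` inserts the letter `i` at place `-1` and moves the past one step back.
    refine ⟨fun j => if j = -1 then i else x (j + 1), ?_⟩
    beta_reduce
    rw [← hE fun k : ℕ => if -((k : ℤ) + 1) = -1 then i else x (-((k : ℤ) + 1) + 1)]
    simp only [Nat.cast_zero, zero_add, if_true]
    congr 2
  · intro x i
    refine ⟨fun j => if j = 0 then i else x (j - 1), ?_⟩
    beta_reduce
    rw [← hF fun k : ℕ => if (k : ℤ) = 0 then i else x ((k : ℤ) - 1)]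
    simp only [Nat.cast_zero, if_true]
    congr 2
    funext k
    rw [if_neg (by push_cast; omega)]
    congr 1
    push_cast; ring
  · intro n
    obtain ⟨z, θ, h1, h2, h3⟩ := hE2 n
    -- The letter `z k` is put at place `-(k + 1)`; the future, filled with `z 0`, does not affect
    -- `eu`.
    refine ⟨fun j => z (-j - 1).toNat, θ, h1, h2, h3.trans ?_⟩
    congr 1
    funext k
    congr 1
    omega
  · intro n
    obtain ⟨z, θ, h1, h2, h3⟩ := hF2 n
    exact ⟨fun j => z j.toNat, θ, h1, h2, h3.trans (by simp)⟩

end Realizes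

end

section

/-! ### The components of the cores -/

open Real RP1 Topology

/-- `[lo n, hi n]` is the convex hull of the part of `K` in the arc `[l n, r n]`. -/
structure IsHullFamily (K : Set RP1) (l r lo hi : ℤ → ℝ) : Prop where
  lt_lo : ∀ n, l n < lo n
  lo_le_hi : ∀ n, lo n ≤ hi n
  hi_lt : ∀ n, hi n < r n
  lo_mem : ∀ n, line (lo n) ∈ K
  hi_mem : ∀ n, line (hi n) ∈ K
  mem_Icc : ∀ n θ, l n ≤ θ → θ ≤ r n → line θ ∈ K → lo n ≤ θ ∧ θ ≤ hi n

theorem exists_isHullFamily {K : Set RP1} {l r : ℤ → ℝ} (hK : IsClosed K)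
    (hK1 : ∀ n θ, l n ≤ θ → θ ≤ r n → line θ ∈ K → l n < θ ∧ θ < r n)
    (hK2 : ∀ n, ∃ θ, l n ≤ θ ∧ θ ≤ r n ∧ line θ ∈ K) :
    ∃ lo hi, IsHullFamily K l r lo hi := by
  have hc : ∀ n, IsCompact (Set.Icc (l n) (r n) ∩ line ⁻¹' K) := fun n =>
    isCompact_Icc.inter_right (hK.preimage continuous_line)
  have hne : ∀ n, (Set.Icc (l n) (r n) ∩ line ⁻¹' K).Nonempty := fun n => by
    obtain ⟨θ, h1, h2, h3⟩ := hK2 n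
    exact ⟨θ, ⟨h1, h2⟩, h3⟩
  choose lo hlo using fun n => (hc n).exists_isLeast (hne n)
  choose hi hhi using fun n => (hc n).exists_isGreatest (hne n)
  exact ⟨lo, hi, fun n => (hK1 n _ (hlo n).1.1.1 (hlo n).1.1.2 (hlo n).1.2).1,
    fun n => (hlo n).2 (hhi n).1, fun n => (hK1 n _ (hhi n).1.1.1 (hhi n).1.1.2 (hhi n).1.2).2,
    fun n => (hlo n).1.2, fun n => (hhi n).1.2,
    fun n θ h1 h2 h3 => ⟨(hlo n).2 ⟨⟨h1, h2⟩, h3⟩, (hhi n).2 ⟨⟨h1, h2⟩, h3⟩⟩⟩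

namespace IsHullFamily

variable {q : ℕ} {K L : Set RP1} {l r lo hi : ℤ → ℝ}

theorem lo_shift (h : IsHullFamily K l r lo hi) (ha : IsArcFamily q l r) (n : ℤ) :
    lo (n + q) = lo n + π := by
  have h1 := h.lt_lo
  have h2 := h.lo_le_hi
  have h3 := h.hi_lt
  have l1 := ha.l_shift n
  have r1 := ha.r_shift n
  apply le_antisymm
  · refine (h.mem_Icc _ _ ?_ ?_ ?_).1
    · linarith [h1 n]
    · linarith [h2 n, h3 n]
    · rw [line_add_pi]; exact h.lo_mem n
  · have := (h.mem_Icc n (lo (n + q) - π) (by linarith [h1 (n + q)])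
      (by linarith [h2 (n + q), h3 (n + q)])
      (by rw [← line_add_pi, sub_add_cancel]; exact h.lo_mem _)).1
    linarith

theorem hi_shift (h : IsHullFamily K l r lo hi) (ha : IsArcFamily q l r) (n : ℤ) :
    hi (n + q) = hi n + π := by
  have h1 := h.lt_lo
  have h2 := h.lo_le_hi
  have h3 := h.hi_lt
  have l1 := ha.l_shift n
  have r1 := ha.r_shift n
  apply le_antisymm
  · have := (h.mem_Icc n (hi (n + q) - π) (by linarith [h1 (n + q), h2 (n + q)])
      (by linarith [h3 (n + q)])
      (by rw [← line_add_pi, sub_add_cancel]; exact h.hi_mem _)).2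
    linarith
  · refine (h.mem_Icc _ _ ?_ ?_ ?_).2
    · linarith [h1 n, h2 n]
    · linarith [h3 n]
    · rw [line_add_pi]; exact h.hi_mem n

theorem hi_lt_lo (h : IsHullFamily K l r lo hi) (ha : IsArcFamily q l r) {m n : ℤ} (hmn : m < n) :
    hi m < lo n :=
  (h.hi_lt m).trans ((ha.r_lt_l hmn).trans (h.lt_lo n))

theorem lo_strictMono (h : IsHullFamily K l r lo hi) (ha : IsArcFamily q l r) : StrictMono lo :=
  fun m _ hmn => (h.lo_le_hi m).trans_lt (h.hi_lt_lo ha hmn)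

theorem hi_strictMono (h : IsHullFamily K l r lo hi) (ha : IsArcFamily q l r) : StrictMono hi :=
  fun _ n hmn => (h.hi_lt_lo ha hmn).trans_le (h.lo_le_hi n)

theorem shift_mul (h : IsHullFamily K l r lo hi) (ha : IsArcFamily q l r) (n k : ℤ) :
    lo (n + k * q) = lo n + k * π ∧ hi (n + k * q) = hi n + k * π := by
  induction k using Int.induction_on with
  | zero => simp
  | succ k ih =>
    have e1 := h.lo_shift ha (n + k * q)
    have e2 := h.hi_shift ha (n + k * q)
    rw [show n + ((k : ℤ) + 1) * q = n + k * q + q by ring, e1, e2, ih.1, ih.2]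
    push_cast
    constructor <;> ring
  | pred k ih =>
    have e1 := h.lo_shift ha (n + (-(k : ℤ) - 1) * q)
    have e2 := h.hi_shift ha (n + (-(k : ℤ) - 1) * q)
    rw [show n + (-(k : ℤ) - 1) * q + q = n + (-(k : ℤ)) * q by ring] at e1 e2
    rw [ih.1] at e1
    rw [ih.2] at e2
    push_cast at *
    constructor <;> linarith

/-- The hull containing a given angle, in terms of its projection. -/
theorem exists_of_line_mem (h : IsHullFamily K l r lo hi) (ha : IsArcFamily q l r) {n : ℤ} {t : ℝ}
    (ht : line t ∈ line '' Set.Icc (lo n) (hi n)) :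
    ∃ k : ℤ, lo (n + k * q) ≤ t ∧ t ≤ hi (n + k * q) := by
  obtain ⟨s, ⟨h1, h2⟩, h3⟩ := ht
  obtain ⟨k, rfl⟩ := line_eq_iff.1 h3.symm
  refine ⟨k, ?_, ?_⟩
  · rw [(h.shift_mul ha n k).1]; linarith
  · rw [(h.shift_mul ha n k).2]; linarith

theorem image_shift (h : IsHullFamily K l r lo hi) (ha : IsArcFamily q l r) (n k : ℤ) :
    line '' Set.Icc (lo (n + k * q)) (hi (n + k * q)) = line '' Set.Icc (lo n) (hi n) := by
  rw [(h.shift_mul ha n k).1, (h.shift_mul ha n k).2]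
  ext p
  constructor
  · rintro ⟨s, ⟨h1, h2⟩, rfl⟩
    refine ⟨s - k * π, ⟨by linarith, by linarith⟩, ?_⟩
    rw [← line_add_mul_pi _ k, sub_add_cancel]
  · rintro ⟨s, ⟨h1, h2⟩, rfl⟩
    exact ⟨s + k * π, ⟨by linarith, by linarith⟩, line_add_mul_pi s k⟩

theorem exists_mem_of_line_mem (h : IsHullFamily K l r lo hi) (ha : IsArcFamily q l r)
    (hK : ∀ p ∈ K, ∃ n θ, l n < θ ∧ θ < r n ∧ line θ = p) {t : ℝ} (ht : line t ∈ K) :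
    ∃ n, lo n ≤ t ∧ t ≤ hi n := by
  obtain ⟨n, θ, h1, h2, h3⟩ := hK _ ht
  obtain ⟨h4, h5⟩ := h.mem_Icc n θ h1.le h2.le (h3 ▸ ht)
  obtain ⟨k, hk⟩ := h.exists_of_line_mem ha (n := n) (t := t) ⟨θ, ⟨h4, h5⟩, h3⟩
  exact ⟨_, hk⟩

theorem not_mem_gap (h : IsHullFamily K l r lo hi) (ha : IsArcFamily q l r) {m n : ℤ} {t : ℝ}
    (h1 : lo m ≤ t) (h2 : t ≤ hi m) (h3 : hi n < t) (h4 : t < lo (n + 1)) : False := by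
  have a1 := (h.lo_strictMono ha).lt_iff_lt.1 (h1.trans_lt h4)
  have a2 := (h.hi_strictMono ha).lt_iff_lt.1 (h3.trans_le h2)
  omega

/-- An open interval between consecutive hulls misses `K`, while both its ends are in `K`. So it is
connected, and open arcs separate it from the rest of the complement. -/
theorem connectedComponentIn_compl (h : IsHullFamily K l r lo hi) (ha : IsArcFamily q l r)
    (hq : 0 < q) (hK : ∀ p ∈ K, ∃ n θ, l n < θ ∧ θ < r n ∧ line θ = p) {n : ℤ} {t : ℝ}
    (h1 : hi n < t) (h2 : t < lo (n + 1)) :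
    connectedComponentIn Kᶜ (line t) = line '' Set.Ioo (hi n) (lo (n + 1)) := by
  have hsub : line '' Set.Ioo (hi n) (lo (n + 1)) ⊆ Kᶜ := by
    rintro _ ⟨s, ⟨s1, s2⟩, rfl⟩ hs
    obtain ⟨m, m1, m2⟩ := h.exists_mem_of_line_mem ha hK hs
    exact h.not_mem_gap ha m1 m2 s1 s2
  have hmem : line t ∈ line '' Set.Ioo (hi n) (lo (n + 1)) := ⟨t, ⟨h1, h2⟩, rfl⟩
  apply Set.Subset.antisymm
  · have hlen : lo (n + 1) ≤ hi n + π := by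
      have := (h.lo_strictMono ha).monotone (show n + 1 ≤ n + q by omega)
      rw [h.lo_shift ha] at this
      linarith [h.lo_le_hi n]
    refine isPreconnected_connectedComponentIn.subset_left_of_subset_union
      (isOpen_image_line isOpen_Ioo) (isOpen_image_line isOpen_Ioo)
      (v := line '' Set.Ioo (lo (n + 1)) (hi n + π)) ?_ ?_
      ⟨line t, mem_connectedComponentIn (hsub hmem), hmem⟩
    · rw [Set.disjoint_left]
      rintro _ ⟨s, ⟨s1, s2⟩, rfl⟩ ⟨s', ⟨s3, s4⟩, e⟩
      have := line_injOn e (abs_lt.2 ⟨by linarith, by linarith⟩)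
      linarith
    · intro p hp
      have hpK : p ∉ K := connectedComponentIn_subset _ _ hp
      obtain ⟨s, s1, s2, rfl⟩ := exists_line_eq p (hi n)
      have n1 : s ≠ hi n := fun e => hpK (e ▸ h.hi_mem n)
      have n2 : s ≠ lo (n + 1) := fun e => hpK (e ▸ h.lo_mem _)
      rcases lt_or_gt_of_ne n2 with h3 | h3
      · exact Or.inl ⟨s, ⟨lt_of_le_of_ne s1 n1.symm, h3⟩, rfl⟩
      · exact Or.inr ⟨s, ⟨h3, s2⟩, rfl⟩
  · exact (isPreconnected_Ioo.image _ continuous_line.continuousOn).subset_connectedComponentIn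
      hmem hsub

theorem exists_le_lt (h : IsHullFamily K l r lo hi) (ha : IsArcFamily q l r) (t : ℝ) :
    ∃ n, lo n ≤ t ∧ t < lo (n + 1) := by
  have step : ∀ (k : ℕ) (t : ℝ), lo 0 ≤ t → t < lo k → ∃ n, lo n ≤ t ∧ t < lo (n + 1) := by
    intro k t h1
    induction k with
    | zero => intro h2; exact absurd h1 (not_le.2 (by simpa using h2))
    | succ k ih =>
      intro h2
      rcases lt_or_ge t (lo k) with h3 | h3
      · exact ih h3
      · exact ⟨k, h3, by exact_mod_cast h2⟩
  obtain ⟨s, s1, s2, s3⟩ := exists_line_eq (line t) (lo 0)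
  have e := h.lo_shift ha 0
  rw [zero_add] at e
  obtain ⟨n, n1, n2⟩ := step q s s1 (by rw [e]; exact s2)
  obtain ⟨k, rfl⟩ := line_eq_iff.1 s3.symm
  refine ⟨n + k * q, ?_, ?_⟩
  · rw [(h.shift_mul ha n k).1]; linarith
  · rw [add_right_comm, (h.shift_mul ha (n + 1) k).1]; linarith

/-- Every interval between consecutive hulls contains a point of `L`, and `L` has no other points;
so exactly these intervals are removed. The components of the complement of `K` inside a hull do not
meet `L` and are filled in. -/
theorem fill_eq (h : IsHullFamily K l r lo hi) (ha : IsArcFamily q l r) (hq : 0 < q)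
    (hK : ∀ p ∈ K, ∃ n θ, l n < θ ∧ θ < r n ∧ line θ = p)
    (hL : ∀ p ∈ L, ∃ n θ, r n < θ ∧ θ < l (n + 1) ∧ line θ = p)
    (hL' : ∀ n, ∃ θ, r n < θ ∧ θ < l (n + 1) ∧ line θ ∈ L) :
    fill K L = ⋃ n, line '' Set.Icc (lo n) (hi n) := by
  ext p
  rw [fill, Set.mem_compl_iff, Set.mem_iUnion₂, Set.mem_iUnion]
  constructor
  · intro hp
    obtain ⟨t, rfl⟩ := line_surjective p
    obtain ⟨n, n1, n2⟩ := h.exists_le_lt ha t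
    refine ⟨n, t, ⟨n1, ?_⟩, rfl⟩
    by_contra hcon
    obtain ⟨θ, h1, h2, h3⟩ := hL' n
    refine hp ⟨line θ, h3, ?_⟩
    rw [h.connectedComponentIn_compl ha hq hK ((h.hi_lt n).trans h1) (h2.trans (h.lt_lo _))]
    exact ⟨t, ⟨not_le.1 hcon, n2⟩, rfl⟩
  · rintro ⟨n, hn⟩ ⟨p', hp', hpp'⟩
    obtain ⟨m, θ, h1, h2, rfl⟩ := hL p' hp'
    rw [h.connectedComponentIn_compl ha hq hK ((h.hi_lt m).trans h1) (h2.trans (h.lt_lo _))]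
      at hpp'
    obtain ⟨t, ⟨t1, t2⟩, rfl⟩ := hpp'
    obtain ⟨k, k1, k2⟩ := h.exists_of_line_mem ha hn
    exact h.not_mem_gap ha k1 k2 t1 t2

/-- A hull is connected, and the open arc `(l n, r n)` around it isolates it from the other hulls.
-/
theorem components_fill (h : IsHullFamily K l r lo hi) (ha : IsArcFamily q l r) (hq : 0 < q)
    (hK : ∀ p ∈ K, ∃ n θ, l n < θ ∧ θ < r n ∧ line θ = p)
    (hL : ∀ p ∈ L, ∃ n θ, r n < θ ∧ θ < l (n + 1) ∧ line θ = p)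
    (hL' : ∀ n, ∃ θ, r n < θ ∧ θ < l (n + 1) ∧ line θ ∈ L) :
    components (fill K L) = Set.range fun n => line '' Set.Icc (lo n) (hi n) := by
  rw [h.fill_eq ha hq hK hL hL']
  have key : ∀ n, ∀ p ∈ line '' Set.Icc (lo n) (hi n),
      connectedComponentIn (⋃ n, line '' Set.Icc (lo n) (hi n)) p =
        line '' Set.Icc (lo n) (hi n) := by
    intro n p hp
    have hsub := Set.subset_iUnion (fun n => line '' Set.Icc (lo n) (hi n)) n
    apply Set.Subset.antisymm
    · have hV : connectedComponentIn (⋃ n, line '' Set.Icc (lo n) (hi n)) p ⊆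
          line '' Set.Ioo (l n) (r n) := by
        have i1 : line '' Set.Icc (lo n) (hi n) ⊆ line '' Set.Ioo (l n) (r n) :=
          Set.image_mono fun s hs => ⟨(h.lt_lo n).trans_le hs.1, hs.2.trans_lt (h.hi_lt n)⟩
        refine isPreconnected_connectedComponentIn.subset_left_of_subset_union
          (isOpen_image_line isOpen_Ioo) (isOpen_image_line isOpen_Ioo)
          (v := line '' Set.Ioo (r n) (l n + π)) ?_ ?_
          ⟨p, mem_connectedComponentIn (hsub hp), i1 hp⟩
        · rw [Set.disjoint_left]
          rintro _ ⟨s, ⟨s1, s2⟩, rfl⟩ ⟨s', ⟨s3, s4⟩, e⟩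
          have := line_injOn e (abs_lt.2 ⟨by linarith, by linarith⟩)
          linarith
        · intro p' hp'
          obtain ⟨m, hm⟩ := Set.mem_iUnion.1 (connectedComponentIn_subset _ _ hp')
          obtain ⟨k, k1, k2⟩ := exists_shift_mem hq n m
          change p' ∈ line '' Set.Icc (lo m) (hi m) at hm
          rw [← h.image_shift ha m k] at hm
          rcases eq_or_lt_of_le k1 with h3 | h3
          · rw [← h3] at hm
            exact Or.inl (i1 hm)
          · refine Or.inr (Set.image_mono (fun s (hs : s ∈ Set.Icc _ _) => Set.mem_Ioo.2 ⟨?_, ?_⟩) hm)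
            · exact (ha.r_lt_l h3).trans ((h.lt_lo _).trans_le hs.1)
            · rw [← ha.l_shift]
              exact (hs.2.trans_lt (h.hi_lt _)).trans (ha.r_lt_l k2)
      intro p' hp'
      obtain ⟨m, hm⟩ := Set.mem_iUnion.1 (connectedComponentIn_subset _ _ hp')
      obtain ⟨t, ⟨t1, t2⟩, rfl⟩ := hV hp'
      obtain ⟨k, k1, k2⟩ := h.exists_of_line_mem ha hm
      have a1 : ¬ n < m + k * q := fun hlt => by
        have := ha.r_lt_l hlt
        linarith [h.lt_lo (m + k * q)]
      have a2 : ¬ m + k * q < n := fun hlt => by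
        have := ha.r_lt_l hlt
        linarith [h.hi_lt (m + k * q)]
      obtain rfl : n = m + k * q := by omega
      exact ⟨t, ⟨k1, k2⟩, rfl⟩
    · exact (isPreconnected_Icc.image _ continuous_line.continuousOn).subset_connectedComponentIn
        hp hsub
  ext c
  constructor
  · rintro ⟨p, hp, rfl⟩
    obtain ⟨n, hn⟩ := Set.mem_iUnion.1 hp
    exact ⟨n, (key n p hn).symm⟩
  · rintro ⟨n, rfl⟩
    have hp : line (lo n) ∈ line '' Set.Icc (lo n) (hi n) := ⟨_, ⟨le_rfl, h.lo_le_hi n⟩, rfl⟩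
    exact ⟨_, Set.mem_iUnion.2 ⟨n, hp⟩, (key n _ hp).symm⟩

end IsHullFamily

end

/-! ### Indexing a pair of multicones and lifting monotonic correspondences -/

theorem exists_antidifference (g : ℤ → ℤ) (c : ℤ) :
    ∃ X : ℤ → ℤ, X 0 = c ∧ ∀ k, X (k + 1) = X k + g k := by
  refine ⟨fun k => c + ∑ i ∈ Finset.range k.toNat, g i -
    ∑ i ∈ Finset.range (-k).toNat, g (-((i : ℤ) + 1)), by simp, fun k => ?_⟩
  rcases le_or_gt 0 k with hk | hk
  · lift k to ℕ using hk
    have e1 : ((k : ℤ) + 1).toNat = k + 1 := by omega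
    have e2 : (-((k : ℤ) + 1)).toNat = 0 := by omega
    have e3 : (-(k : ℤ)).toNat = 0 := by omega
    simp only [e1, e2, e3, Int.toNat_natCast, Finset.sum_range_succ]
    simp; ring
  · obtain ⟨n, rfl⟩ : ∃ n : ℕ, k = -((n : ℤ) + 1) := ⟨(-k - 1).toNat, by omega⟩
    have e1 : (-((n : ℤ) + 1) + 1).toNat = 0 := by omega
    have e2 : (-(-((n : ℤ) + 1) + 1)).toNat = n := by omega
    have e3 : (-((n : ℤ) + 1)).toNat = 0 := by omega
    have e4 : (-(-((n : ℤ) + 1))).toNat = n + 1 := by omega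
    simp only [e1, e2, e3, e4, Finset.sum_range_succ]
    simp only [Finset.range_zero, Finset.sum_empty]
    ring

theorem eq_zero_of_succ {g : ℤ → ℤ} (h : ∀ k, g (k + 1) = g k) (k : ℤ) : g k = g 0 := by
  have : Function.Periodic g 1 := h
  simpa using this.int_mul_eq k

theorem Equiv.Perm.IsCycleOn.zpow_apply_eq_iff {α : Type*} [Finite α] {σ : Equiv.Perm α}
    (h : σ.IsCycleOn _root_.Set.univ) (x : α) (m n : ℤ) :
    (σ ^ m) x = (σ ^ n) x ↔ (Nat.card α : ℤ) ∣ m - n := by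
  have := Fintype.ofFinite α
  have h' : σ.IsCycleOn (Finset.univ : Finset α) := by simpa using h
  rw [h'.zpow_apply_eq_zpow_apply (Finset.mem_univ x), Finset.card_univ, Nat.card_eq_fintype_card,
    Int.modEq_iff_dvd, dvd_sub_comm]

namespace MulticonePair

variable {M : Type*} [Finite M] {P : MulticonePair M}

/-- An enumeration of `M` along its cyclic order; the unstable elements have even index. -/
structure IsIndexing (P : MulticonePair M) (idx : ℤ → M) : Prop where
  succ : ∀ j, idx (j + 1) = P.next (idx j)
  surjective : Function.Surjective idx
  eq_iff : ∀ i j, idx i = idx j ↔ 2 * (P.rank : ℤ) ∣ i - j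
  mem_stable : ∀ j, idx j ∈ P.stable ↔ Odd j

theorem card_eq (P : MulticonePair M) : Nat.card M = 2 * P.rank := by
  have h : P.next '' P.stable = P.stableᶜ := by
    ext y
    constructor
    · rintro ⟨x, hx, rfl⟩ hy
      exact (P.alternate x).1 hy hx
    · intro hy
      refine ⟨P.next.symm y, ?_, P.next.apply_symm_apply y⟩
      by_contra hx
      have := (P.alternate _).2 hx
      rw [Equiv.apply_symm_apply] at this
      exact hy this
  rw [← Set.ncard_add_ncard_compl P.stable, ← h, Set.ncard_image_of_injective _ P.next.injective,
    rank, two_mul]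

theorem exists_isIndexing {x₀ : M} (hx : x₀ ∈ P.unstable) : ∃ idx, IsIndexing P idx := by
  refine ⟨fun j => (P.next ^ j) x₀, ?_, ?_, ?_, ?_⟩
  · intro j
    rw [add_comm, zpow_one_add]; rfl
  · intro y
    exact P.isCycleOn_next.2 (Set.mem_univ x₀) (Set.mem_univ y)
  · intro i j
    rw [P.isCycleOn_next.zpow_apply_eq_iff, card_eq]
    push_cast; rfl
  · have hodd : ∀ j : ℤ, ¬ Odd j ↔ Odd (j + 1) := fun j => by
      rw [← Int.not_even_iff_odd, ← Int.not_even_iff_odd, Int.even_add_one]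
    intro j
    induction j using Int.induction_on with
    | zero => simpa [unstable] using hx
    | succ j ih =>
      rw [add_comm, zpow_one_add, Equiv.Perm.mul_apply, P.alternate, ih, add_comm]
      exact hodd j
    | pred j ih =>
      have := P.alternate ((P.next ^ (-(j : ℤ) - 1)) x₀)
      rw [← Equiv.Perm.mul_apply, ← zpow_one_add, add_sub_cancel, ih] at this
      have h2 := hodd (-(j : ℤ) - 1)
      rw [sub_add_cancel] at h2
      tauto

namespace IsIndexing

variable {idx : ℤ → M}

theorem mem_unstable (h : IsIndexing P idx) (j : ℤ) : idx j ∈ P.unstable ↔ Even j := by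
  rw [unstable, Set.mem_compl_iff, h.mem_stable, Int.not_odd_iff_even]

theorem rank_pos (h : IsIndexing P idx) : 0 < P.rank :=
  (Set.ncard_pos P.stable.toFinite).2 ⟨idx 1, (h.mem_stable 1).2 odd_one⟩

theorem exists_even (h : IsIndexing P idx) {x : M} (hx : x ∈ P.unstable) :
    ∃ n, idx (2 * n) = x := by
  obtain ⟨j, rfl⟩ := h.surjective x
  obtain ⟨n, rfl⟩ := (h.mem_unstable j).1 hx
  exact ⟨n, by rw [two_mul]⟩

theorem exists_odd (h : IsIndexing P idx) {x : M} (hx : x ∈ P.stable) :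
    ∃ n, idx (2 * n + 1) = x := by
  obtain ⟨j, rfl⟩ := h.surjective x
  obtain ⟨n, rfl⟩ := (h.mem_stable j).1 hx
  exact ⟨n, rfl⟩

theorem even_mem (h : IsIndexing P idx) (n : ℤ) : idx (2 * n) ∈ P.unstable :=
  (h.mem_unstable _).2 (even_two_mul n)

theorem odd_mem (h : IsIndexing P idx) (n : ℤ) : idx (2 * n + 1) ∈ P.stable :=
  (h.mem_stable _).2 (odd_two_mul_add_one n)

theorem even_eq_iff (h : IsIndexing P idx) (m n : ℤ) :
    idx (2 * m) = idx (2 * n) ↔ (P.rank : ℤ) ∣ m - n := by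
  rw [h.eq_iff, ← mul_sub]
  exact mul_dvd_mul_iff_left two_ne_zero

theorem odd_eq_iff (h : IsIndexing P idx) (m n : ℤ) :
    idx (2 * m + 1) = idx (2 * n + 1) ↔ (P.rank : ℤ) ∣ m - n := by
  rw [h.eq_iff, add_sub_add_right_eq_sub, ← mul_sub]
  exact mul_dvd_mul_iff_left two_ne_zero

end IsIndexing

/-- The correspondence is a disjoint union of two graphs, one parametrized by its second coordinate
in the stable part, the other by its first coordinate in the unstable part. -/
theorem IsMonotonic.card_eq {C : Correspondence M} (hC : P.IsMonotonic C) :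
    Nat.card {p : M × M // C.Rel p.1 p.2} = 2 * P.rank := by
  classical
  rw [← P.card_eq]
  refine Nat.card_eq_of_bijective (fun p => if p.1.1 ∈ P.stable then p.1.2 else p.1.1) ⟨?_, ?_⟩
  · rintro ⟨⟨x, y⟩, h⟩ ⟨⟨x', y'⟩, h'⟩ e
    dsimp only at h h' e
    rcases hC.subset _ _ h with ⟨h1, h2⟩ | ⟨h1, h2⟩ <;>
      rcases hC.subset _ _ h' with ⟨h3, h4⟩ | ⟨h3, h4⟩
    · rw [if_pos h1, if_pos h3] at e
      subst e
      obtain rfl := (hC.stable_map y h2).unique ⟨h1, h⟩ ⟨h3, h'⟩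
      rfl
    · rw [if_pos h1, if_neg h3] at e
      exact absurd (e ▸ h2) h3
    · rw [if_neg h1, if_pos h3] at e
      exact absurd (e ▸ h4) h1
    · rw [if_neg h1, if_neg h3] at e
      subst e
      obtain rfl := (hC.unstable_map x h1).unique ⟨h2, h⟩ ⟨h4, h'⟩
      rfl
  · intro z
    by_cases hz : z ∈ P.stable
    · obtain ⟨x, ⟨hx, hxz⟩, -⟩ := hC.stable_map z hz
      exact ⟨⟨(x, z), hxz⟩, if_pos hx⟩
    · obtain ⟨y, ⟨-, hzy⟩, -⟩ := hC.unstable_map z hz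
      exact ⟨⟨(z, y), hzy⟩, if_neg hz⟩

/-- A lift of a monotonic correspondence to a monotone map of degree one. -/
structure Represents (P : MulticonePair M) (idx : ℤ → M) (C : Correspondence M) (F : ℤ → ℤ) :
    Prop where
  deg : IsDegOne P.rank F
  unstable : ∀ n m, C.Rel (idx (2 * n)) (idx (2 * m)) ↔ (P.rank : ℤ) ∣ m - F n
  stable : ∀ n m, C.Rel (idx (2 * n + 1)) (idx (2 * m + 1)) ↔ (P.rank : ℤ) ∣ n - upperAdj F m

/-- The elements of a monotonic correspondence form a periodic path in the plane. -/
theorem IsMonotonic.exists_path {C : Correspondence M} (hC : P.IsMonotonic C) {idx : ℤ → M}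
    (h : IsIndexing P idx) : ∃ X Y : ℤ → ℤ, Monotone X ∧ Monotone Y ∧
      (∀ k, X (k + 2 * P.rank) = X k + 2 * P.rank) ∧
      (∀ k, Y (k + 2 * P.rank) = Y k + 2 * P.rank) ∧
      (∀ k, C.Rel (idx (X k)) (idx (Y k))) ∧
      (∀ i j, C.Rel (idx i) (idx j) → ∃ k, X k = i ∧ 2 * (P.rank : ℤ) ∣ j - Y k) ∧
      ∀ k k', idx (X k) = idx (X k') → idx (Y k) = idx (Y k') → 2 * (P.rank : ℤ) ∣ k - k' := by
  obtain ⟨σ, hσ, hstep⟩ := hC.cyclic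
  obtain ⟨y₀, ⟨hy₀, hr₀⟩, -⟩ := hC.unstable_map _ (h.even_mem 0)
  obtain ⟨j₀, rfl⟩ := h.surjective y₀
  set p₀ : {p : M × M // C.Rel p.1 p.2} := ⟨(idx (2 * 0), idx j₀), hr₀⟩
  -- Each step along the cyclic ordering of the correspondence advances the two indices by `d` and
  -- `e` with `d + e = 2`; summing these increments lifts the cycle to a path in `ℤ × ℤ`.
  have hd : ∀ p, ∃ d e : ℤ, 0 ≤ d ∧ 0 ≤ e ∧ d + e = 2 ∧
      ∀ i j, (idx (i + d) = (σ p).1.1 ∧ idx (j + e) = (σ p).1.2) ↔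
        (idx i = p.1.1 ∧ idx j = p.1.2) := by
    have h2 : ∀ i, idx (i + 2) = P.next (P.next (idx i)) := fun i => by
      rw [show i + 2 = i + 1 + 1 by ring, h.succ, h.succ]
    intro p
    rcases hstep p with hp | hp | hp
    · exact ⟨2, 0, by norm_num, by norm_num, by norm_num, fun i j => by simp [hp, h2]⟩
    · exact ⟨1, 1, by norm_num, by norm_num, by norm_num, fun i j => by simp [hp, h.succ]⟩
    · exact ⟨0, 2, by norm_num, by norm_num, by norm_num, fun i j => by simp [hp, h2]⟩
  choose d e hd0 he0 hde hidx using hd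
  obtain ⟨X, hX0, hX⟩ := exists_antidifference (fun k => d ((σ ^ k) p₀)) (2 * 0)
  obtain ⟨Y, hY0, hY⟩ := exists_antidifference (fun k => e ((σ ^ k) p₀)) j₀
  have hXm : Monotone X := monotone_int_of_le_succ fun k => by
    rw [hX]; linarith [hd0 ((σ ^ k) p₀)]
  have hYm : Monotone Y := monotone_int_of_le_succ fun k => by
    rw [hY]; linarith [he0 ((σ ^ k) p₀)]
  have hpow : ∀ k : ℤ, (σ ^ (k + 1)) p₀ = σ ((σ ^ k) p₀) := fun k => by
    rw [add_comm, zpow_one_add]; rfl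
  have hXY : ∀ k, idx (X k) = ((σ ^ k) p₀).1.1 ∧ idx (Y k) = ((σ ^ k) p₀).1.2 := by
    have step : ∀ k, (idx (X (k + 1)) = ((σ ^ (k + 1)) p₀).1.1 ∧
        idx (Y (k + 1)) = ((σ ^ (k + 1)) p₀).1.2) ↔
        (idx (X k) = ((σ ^ k) p₀).1.1 ∧ idx (Y k) = ((σ ^ k) p₀).1.2) := fun k => by
      rw [hX, hY, hpow]
      exact hidx _ _ _
    intro k
    induction k using Int.induction_on with
    | zero => rw [hX0, hY0]; exact ⟨rfl, rfl⟩
    | succ k ih => exact (step k).2 ih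
    | pred k ih =>
      refine (step _).1 ?_
      rw [sub_add_cancel]
      exact ih
  have hper : ∀ k k' : ℤ, (σ ^ k) p₀ = (σ ^ k') p₀ ↔ 2 * (P.rank : ℤ) ∣ k - k' := fun k k' => by
    rw [hσ.zpow_apply_eq_iff, hC.card_eq]
    push_cast; rfl
  have hper' : ∀ k : ℤ, (σ ^ (k + 2 * P.rank)) p₀ = (σ ^ k) p₀ := fun k => by
    rw [hper]; simp
  have hrel : ∀ k, C.Rel (idx (X k)) (idx (Y k)) := fun k => by
    rw [(hXY k).1, (hXY k).2]; exact ((σ ^ k) p₀).2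
  have hcov : ∀ x y, C.Rel x y → ∃ k, idx (X k) = x ∧ idx (Y k) = y := fun x y hxy => by
    obtain ⟨k, hk⟩ := hσ.2 (Set.mem_univ p₀) (Set.mem_univ ⟨(x, y), hxy⟩)
    refine ⟨k, ?_⟩
    rw [(hXY k).1, (hXY k).2, hk]
    exact ⟨rfl, rfl⟩
  have hq := h.rank_pos
  have hdX : ∀ k, X (k + 2 * P.rank) - X k = X (2 * P.rank) - X 0 := fun k => by
    have := eq_zero_of_succ (g := fun k => X (k + 2 * P.rank) - X k) (fun k => by
      rw [add_right_comm, hX, hX, hper']; ring) k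
    simpa using this
  have hdY : ∀ k, Y (k + 2 * P.rank) - Y k = Y (2 * P.rank) - Y 0 := fun k => by
    have := eq_zero_of_succ (g := fun k => Y (k + 2 * P.rank) - Y k) (fun k => by
      rw [add_right_comm, hY, hY, hper']; ring) k
    simpa using this
  have hsum : X (2 * P.rank) + Y (2 * P.rank) - 2 * (2 * P.rank) = X 0 + Y 0 := by
    have := eq_zero_of_succ (g := fun k => X k + Y k - 2 * k) (fun k => by
      rw [hX, hY]; linarith [hde ((σ ^ k) p₀)]) (2 * P.rank)
    simpa using this
  have hconst : ∀ Z : ℤ → ℤ, Monotone Z → (∀ k, Z (k + 2 * P.rank) - Z k = 0) →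
      ∀ k, Z k = Z 0 := fun Z hZ hZ' => eq_zero_of_succ fun k => by
    refine le_antisymm ?_ (hZ (by omega))
    have := hZ (show k + 1 ≤ k + 2 * P.rank by omega)
    linarith [hZ' k]
  -- Neither coordinate of the path is constant, since the correspondence contains both stable and
  -- unstable pairs.
  obtain ⟨x₁, ⟨hx₁, hr₁⟩, -⟩ := hC.stable_map _ (h.odd_mem 0)
  obtain ⟨k₁, hk₁, hk₁'⟩ := hcov _ _ hr₁
  have hXpos : X (2 * P.rank) - X 0 ≠ 0 := fun h0 => by
    rw [hconst X hXm (fun k => by rw [hdX, h0]), hX0] at hk₁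
    exact h.even_mem 0 (hk₁ ▸ hx₁)
  have hYpos : Y (2 * P.rank) - Y 0 ≠ 0 := fun h0 => by
    rw [hconst Y hYm (fun k => by rw [hdY, h0]), hY0] at hk₁'
    exact hy₀ (hk₁' ▸ h.odd_mem 0)
  -- Over one period the two coordinates advance by `4 * P.rank` in total, the first by a multiple
  -- of `2 * P.rank`, and both by a positive amount. Hence each advances by exactly `2 * P.rank`:
  -- the degree is one.
  have hX2 : X (2 * P.rank) - X 0 = 2 * P.rank := by
    have h1 : idx (X (2 * P.rank)) = idx (X 0) := by
      have := hper' 0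
      rw [zero_add] at this
      rw [(hXY _).1, (hXY _).1, this]
    obtain ⟨a, ha⟩ := (h.eq_iff _ _).1 h1
    have h2 := hXm (show 0 ≤ 2 * (P.rank : ℤ) by omega)
    have h3 := hYm (show 0 ≤ 2 * (P.rank : ℤ) by omega)
    have hq' : (0 : ℤ) < 2 * P.rank := by omega
    have a1 : 0 < a := by
      by_contra hcon
      have : 2 * (P.rank : ℤ) * a ≤ 0 := mul_nonpos_of_nonneg_of_nonpos hq'.le (not_lt.1 hcon)
      omega
    have a2 : a < 2 := by
      by_contra hcon
      have : 2 * (P.rank : ℤ) * 2 ≤ 2 * P.rank * a := mul_le_mul_of_nonneg_left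
        (not_lt.1 hcon) hq'.le
      omega
    obtain rfl : a = 1 := by omega
    rw [ha, mul_one]
  have hY2 : Y (2 * P.rank) - Y 0 = 2 * P.rank := by omega
  have hXs : ∀ k, X (k + 2 * P.rank) = X k + 2 * P.rank := fun k => by linarith [hdX k]
  have hYs : ∀ k, Y (k + 2 * P.rank) = Y k + 2 * P.rank := fun k => by linarith [hdY k]
  have hmul : ∀ Z : ℤ → ℤ, (∀ k, Z (k + 2 * P.rank) = Z k + 2 * P.rank) →
      ∀ k a, Z (k + a * (2 * P.rank)) = Z k + a * (2 * P.rank) := fun Z hZ k a => by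
    have hp : Function.Periodic (fun k => Z k - k) (2 * P.rank : ℤ) := fun k => by
      simp only [hZ]; ring
    have := hp.int_mul a k
    simp only [Int.cast_id] at this
    linarith
  refine ⟨X, Y, hXm, hYm, hXs, hYs, hrel, ?_, ?_⟩
  · intro i j hij
    obtain ⟨k, h1, h2⟩ := hcov _ _ hij
    obtain ⟨a, ha⟩ := (h.eq_iff _ _).1 h1
    obtain ⟨b, hb⟩ := (h.eq_iff _ _).1 h2
    refine ⟨k + (-a) * (2 * P.rank), ?_, -a - b + 2 * a, ?_⟩
    · rw [hmul X hXs]; linarith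
    · rw [hmul Y hYs]; linarith
  · intro k k' h1 h2
    rw [← hper]
    refine Subtype.ext (Prod.ext ?_ ?_)
    · rw [← (hXY k).1, ← (hXY k').1, h1]
    · rw [← (hXY k).2, ← (hXY k').2, h2]

/-- The path meets each even column `2 n` exactly once, at a height `2 F n`, because `C_u` is a map.
Monotonicity and degree of `F` are those of the path. -/
theorem IsMonotonic.exists_represents {C : Correspondence M} (hC : P.IsMonotonic C) {idx : ℤ → M}
    (h : IsIndexing P idx) : ∃ F, Represents P idx C F := by
  obtain ⟨X, Y, hXm, hYm, hXs, hYs, hrel, hcov, huniq⟩ := hC.exists_path h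
  have hq := h.rank_pos
  have hXa : ∀ k a, X (k + 2 * P.rank * a) = X k + 2 * P.rank * a := fun k a => by
    have hp : Function.Periodic (fun k => X k - k) (2 * P.rank : ℤ) := fun k => by
      simp only [hXs]; ring
    have := hp.int_mul a k
    simp only [Int.cast_id] at this
    rw [mul_comm]; linarith
  have hYa : ∀ k a, Y (k + 2 * P.rank * a) = Y k + 2 * P.rank * a := fun k a => by
    have hp : Function.Periodic (fun k => Y k - k) (2 * P.rank : ℤ) := fun k => by
      simp only [hYs]; ring
    have := hp.int_mul a k
    simp only [Int.cast_id] at this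
    rw [mul_comm]; linarith
  have hpar : ∀ k, Even (X k) ↔ Even (Y k) := fun k => by
    have := hC.subset _ _ (hrel k)
    rw [h.mem_stable, h.mem_stable, h.mem_unstable, h.mem_unstable, ← Int.not_even_iff_odd,
      ← Int.not_even_iff_odd] at this
    tauto
  have huX : ∀ k k', Even (X k) → X k = X k' → k = k' := fun k k' he hk => by
    have hu := (h.mem_unstable _).2 he
    have e : idx (Y k) = idx (Y k') := (hC.unstable_map _ hu).unique
      ⟨(h.mem_unstable _).2 ((hpar k).1 he), hrel k⟩
      ⟨(h.mem_unstable _).2 ((hpar k').1 (hk ▸ he)), hk ▸ hrel k'⟩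
    obtain ⟨a, ha⟩ := huniq k k' (by rw [hk]) e
    obtain rfl : k = k' + 2 * P.rank * a := by linarith
    rw [hXa] at hk
    linarith
  have hexX : ∀ n, ∃ k, X k = 2 * n := fun n => by
    obtain ⟨y, ⟨-, hy⟩, -⟩ := hC.unstable_map _ (h.even_mem n)
    obtain ⟨j, rfl⟩ := h.surjective y
    obtain ⟨k, hk, -⟩ := hcov _ _ hy
    exact ⟨k, hk⟩
  choose κ hκ using hexX
  have hF : ∀ n, ∃ m, Y (κ n) = 2 * m := fun n => by
    obtain ⟨m, hm⟩ := (hpar (κ n)).1 (by rw [hκ]; exact even_two_mul n)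
    exact ⟨m, by omega⟩
  choose F hF using hF
  have hκm : ∀ {n k}, 2 * n < X k → κ n < k := fun {n k} hlt => by
    by_contra hcon
    have := hXm (not_lt.1 hcon)
    rw [hκ] at this
    omega
  have hκm' : ∀ {n k}, X k < 2 * n → k < κ n := fun {n k} hlt => by
    by_contra hcon
    have := hXm (not_lt.1 hcon)
    rw [hκ] at this
    omega
  have hdeg : IsDegOne P.rank F := by
    refine ⟨monotone_int_of_le_succ fun n => ?_, fun n => ?_⟩
    · have := hYm (hκm' (n := n + 1) (k := κ n) (by rw [hκ]; omega)).le
      rw [hF, hF] at this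
      omega
    · have e : κ (n + P.rank) = κ n + 2 * P.rank := by
        refine huX _ _ (by rw [hκ]; exact even_two_mul _) ?_
        rw [hXs, hκ, hκ]; ring
      have := hF (n + P.rank)
      rw [e, hYs, hF] at this
      omega
  have gc := hdeg.gc hq
  -- At height `2 m + 1` the path is between the columns `2 n` and `2 (n + 1)` for which `F n ≤ m <
  -- F (n + 1)`. This is why `C_s` is the upper adjoint of `F`.
  have hgap : ∀ k m, Y k = 2 * m + 1 → X k = 2 * upperAdj F m + 1 := fun k m hk => by
    have hodd : ¬ Even (X k) := by
      rw [hpar, hk, Int.not_even_iff_odd]; exact odd_two_mul_add_one m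
    obtain ⟨n, hn⟩ := Int.not_even_iff_odd.1 hodd
    have h1 := hYm (hκm (n := n) (k := k) (by omega)).le
    have h2 := hYm (hκm' (n := n + 1) (k := k) (by omega)).le
    rw [hF, hk] at h1 h2
    have h3 : n ≤ upperAdj F m := (gc _ _).1 (by omega)
    have h4 : ¬ n + 1 ≤ upperAdj F m := fun hc => by
      have := (gc _ _).2 hc
      omega
    omega
  have hexY : ∀ m, ∃ k, Y k = 2 * m + 1 := fun m => by
    obtain ⟨x, ⟨-, hx⟩, -⟩ := hC.stable_map _ (h.odd_mem m)
    obtain ⟨i, rfl⟩ := h.surjective x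
    obtain ⟨k, -, a, ha⟩ := hcov _ _ hx
    refine ⟨k + 2 * P.rank * a, ?_⟩
    rw [hYa]; linarith
  refine ⟨F, hdeg, fun n m => ⟨fun hr => ?_, fun hd => ?_⟩, fun n m => ⟨fun hr => ?_, fun hd => ?_⟩⟩
  · obtain ⟨k, hk, hd⟩ := hcov _ _ hr
    obtain rfl : k = κ n := huX _ _ (by rw [hk]; exact even_two_mul n) (by rw [hk, hκ])
    rw [hF, ← mul_sub] at hd
    exact (mul_dvd_mul_iff_left two_ne_zero).1 hd
  · have := hrel (κ n)
    rw [hκ, hF] at this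
    rwa [(h.even_eq_iff m (F n)).2 hd]
  · obtain ⟨k, hk, a, ha⟩ := hcov _ _ hr
    have e := hgap k (m - P.rank * a) (by linarith)
    have e2 := (hdeg.upperAdj hq).shift_mul (m - P.rank * a) a
    rw [show m - (P.rank : ℤ) * a + a * P.rank = m by ring] at e2
    exact ⟨-a, by rw [hk] at e; linarith⟩
  · obtain ⟨k, hk⟩ := hexY m
    have := hrel k
    rw [hk, hgap k m hk] at this
    rwa [(h.odd_eq_iff n (upperAdj F m)).2 hd]

end MulticonePair

/-! ### The system of a tight hyperbolic morphism -/

namespace MulticonePair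

variable {M : Type*} [Finite M] {P : MulticonePair M} {idx : ℤ → M} {N : ℕ}

namespace IsIndexing

theorem imUnstable_eq (h : IsIndexing P idx) {C : Correspondence M} {F : ℤ → ℤ}
    (hF : Represents P idx C F) : P.imUnstable C = Set.range fun n => idx (2 * F n) := by
  ext y
  constructor
  · rintro ⟨hy, x, hx, hxy⟩
    obtain ⟨n, rfl⟩ := h.exists_even hx
    obtain ⟨m, rfl⟩ := h.exists_even hy
    exact ⟨n, ((h.even_eq_iff m (F n)).2 ((hF.unstable n m).1 hxy)).symm⟩
  · rintro ⟨n, rfl⟩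
    exact ⟨h.even_mem _, idx (2 * n), h.even_mem _, (hF.unstable _ _).2 (by simp)⟩

theorem ncard_imUnstable (h : IsIndexing P idx) {C : Correspondence M} {F : ℤ → ℤ}
    (hF : Represents P idx C F) : (P.imUnstable C).ncard = imCard P.rank F := by
  rw [h.imUnstable_eq hF, imCard]
  have e : Setoid.ker (fun n => idx (2 * F n)) = Setoid.ker fun n => (F n : ZMod P.rank) := by
    ext m n
    rw [Setoid.ker_def, Setoid.ker_def, h.even_eq_iff, dvd_sub_comm,
      ← ZMod.intCast_eq_intCast_iff_dvd_sub]
  rw [← Nat.card_coe_set_eq, ← Nat.card_coe_set_eq,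
    ← Nat.card_congr (Setoid.quotientKerEquivRange fun n => idx (2 * F n)),
    ← Nat.card_congr (Setoid.quotientKerEquivRange fun n => (F n : ZMod P.rank)), e]

/-- Correspondences compose with the first letter acting first, `evalWord` with the last one acting
first; hence the reversal. -/
theorem rel_word (h : IsIndexing P idx) {Φ : FreeMonoid (Fin N) →* Correspondence M}
    (hΦ : P.IsMonotonicMorphism Φ) {f : Fin N → ℤ → ℤ}
    (hf : ∀ i, Represents P idx (Φ (FreeMonoid.of i)) (f i)) (w : List (Fin N)) (n m : ℤ) :
    (Φ (FreeMonoid.ofList w)).Rel (idx (2 * n)) (idx (2 * m)) ↔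
      (P.rank : ℤ) ∣ m - evalWord f w.reverse n := by
  induction w generalizing n with
  | nil =>
    rw [FreeMonoid.ofList_nil, map_one, List.reverse_nil]
    change idx (2 * n) = idx (2 * m) ↔ _
    rw [h.even_eq_iff, dvd_sub_comm]
    rfl
  | cons i w ih =>
    rw [FreeMonoid.ofList_cons, map_mul, List.reverse_cons, evalWord_append]
    change (∃ y, (Φ (FreeMonoid.of i)).Rel (idx (2 * n)) y ∧
      (Φ (FreeMonoid.ofList w)).Rel y (idx (2 * m))) ↔
        (P.rank : ℤ) ∣ m - evalWord f w.reverse (f i n)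
    rw [← ih]
    constructor
    · rintro ⟨y, h1, h2⟩
      rcases (hΦ _).subset _ _ h1 with ⟨h3, -⟩ | ⟨-, h3⟩
      · exact absurd h3 (h.even_mem n)
      · obtain ⟨k, rfl⟩ := h.exists_even h3
        rwa [(h.even_eq_iff k (f i n)).2 (((hf i).unstable n k).1 h1)] at h2
    · intro h1
      exact ⟨_, ((hf i).unstable n _).2 (by simp), h1⟩

theorem exists_tightSystem (h : IsIndexing P idx) {Φ : FreeMonoid (Fin N) →* Correspondence M}
    (hΦ : P.IsMonotonicMorphism Φ) (hyp : P.IsHyperbolic Φ) (tight : P.IsTight Φ) :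
    ∃ f : Fin N → ℤ → ℤ, TightSystem P.rank f ∧
      ∀ i, Represents P idx (Φ (FreeMonoid.of i)) (f i) := by
  choose f hf using fun i => (hΦ (FreeMonoid.of i)).exists_represents h
  refine ⟨f, ⟨h.rank_pos, fun i => (hf i).deg, ?_, ?_, ?_⟩, hf⟩
  · intro n
    have hn := h.odd_mem n
    rw [← tight.2, Set.mem_iUnion] at hn
    obtain ⟨i, -, y, hy, hr⟩ := hn
    obtain ⟨m, rfl⟩ := h.exists_odd hy
    obtain ⟨b, hb⟩ := ((hf i).stable n m).1 hr
    have e := ((hf i).deg.upperAdj h.rank_pos).shift_mul m b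
    have gc := (hf i).deg.gc h.rank_pos
    rw [mul_comm, sub_eq_iff_eq_add'] at hb
    rw [← hb] at e
    -- That `n` is the value of the adjoint at `m + b * P.rank` means `f i n ≤ m + b * P.rank < f i
    -- (n + 1)`, so the gap after `n` is a jump.
    refine ⟨i, lt_of_le_of_lt ((gc _ _).2 e.ge) (not_le.1 fun hc => ?_)⟩
    have := (gc _ _).1 hc
    omega
  · intro m
    have hm := h.even_mem m
    rw [← tight.1, Set.mem_iUnion] at hm
    obtain ⟨i, -, x, hx, hr⟩ := hm
    obtain ⟨n, rfl⟩ := h.exists_even hx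
    obtain ⟨b, hb⟩ := ((hf i).unstable n m).1 hr
    refine ⟨i, n + b * P.rank, ?_⟩
    rw [(hf i).deg.shift_mul]
    linarith
  · obtain ⟨k, -, hk⟩ := hyp
    refine ⟨k, fun w hw x y => ?_⟩
    obtain ⟨as, has, au, hau, hc⟩ := hk (FreeMonoid.ofList w.reverse) (by
      simpa [FreeMonoid.length] using hw)
    obtain ⟨m, rfl⟩ := h.exists_even hau
    have key : ∀ x, (P.rank : ℤ) ∣ m - evalWord f w x := fun x => by
      have := (h.rel_word hΦ hf w.reverse x m).1 ((hc _ _).2 (Or.inl ⟨h.even_mem x, rfl⟩))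
      rwa [List.reverse_reverse] at this
    have := dvd_sub (key y) (key x)
    rwa [sub_sub_sub_cancel_left] at this

end IsIndexing

end MulticonePair

section

/-! ### The cyclic order and the induced morphism -/

open Real RP1 Topology

namespace RP1

theorem cyclicLT_mk {u v w : Fin 2 → ℝ} (hu : u ≠ 0) (hv : v ≠ 0) (hw : w ≠ 0) :
    CyclicLT (Projectivization.mk ℝ u hu) (Projectivization.mk ℝ v hv)
      (Projectivization.mk ℝ w hw) ↔ 0 < det2 u v * det2 v w * det2 w u := by
  obtain ⟨a, ha⟩ := Projectivization.exists_smul_eq_mk_rep ℝ u hu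
  obtain ⟨b, hb⟩ := Projectivization.exists_smul_eq_mk_rep ℝ v hv
  obtain ⟨c, hc⟩ := Projectivization.exists_smul_eq_mk_rep ℝ w hw
  rw [CyclicLT, ← ha, ← hb, ← hc]
  have e : det2 (a • u) (b • v) * det2 (b • v) (c • w) * det2 (c • w) (a • u) =
      ((a : ℝ) * b * c) ^ 2 * (det2 u v * det2 v w * det2 w u) := by
    simp only [det2, Units.smul_def, Pi.smul_apply, smul_eq_mul]
    ring
  have : (0 : ℝ) < ((a : ℝ) * b * c) ^ 2 := by
    have := a.ne_zero
    have := b.ne_zero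
    have := c.ne_zero
    positivity
  rw [e, mul_pos_iff_of_pos_left this]

theorem cyclicLT_line {s t u : ℝ} :
    CyclicLT (line s) (line t) (line u) ↔ 0 < sin (s - t) * sin (t - u) * sin (u - s) := by
  rw [line, line, line, cyclicLT_mk, det2_angleVec, det2_angleVec, det2_angleVec]

theorem not_cyclicLT_line {s t u : ℝ} (h1 : s ≤ u) (h2 : u ≤ t) (h3 : t ≤ s + π) :
    ¬ CyclicLT (line s) (line t) (line u) := by
  rw [cyclicLT_line, not_lt]
  have e1 : sin (s - t) ≤ 0 := sin_nonpos_of_nonpos_of_neg_pi_le (by linarith) (by linarith)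
  have e2 : 0 ≤ sin (t - u) := sin_nonneg_of_nonneg_of_le_pi (by linarith) (by linarith)
  have e3 : 0 ≤ sin (u - s) := sin_nonneg_of_nonneg_of_le_pi (by linarith) (by linarith)
  exact mul_nonpos_of_nonpos_of_nonneg (mul_nonpos_of_nonpos_of_nonneg e1 e2) e3

end RP1

namespace Realizes

open SL2Cocycle

variable {N q : ℕ} {f : Fin N → ℤ → ℤ} {A : Fin N → SL(2, ℝ)} {a : Fin N → ℝ ≃o ℝ} {l r : ℤ → ℝ}

/-- The image of the hull `n` lies in the arc `f i n`, which meets no hull but its own. Conversely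
the end `lo n` belongs to `K`, so its image is a point of `K` in that arc, hence in its hull. -/
theorem image_hull_inter_nonempty_iff (h : Realizes q f A a l r) {K : Set RP1} {lo hi : ℤ → ℝ}
    (hK : IsHullFamily K l r lo hi) {i : Fin N} (hA : ∀ p ∈ K, A i • p ∈ K) (n m : ℤ) :
    (((fun p => A i • p) '' (line '' Set.Icc (lo n) (hi n))) ∩
      line '' Set.Icc (lo m) (hi m)).Nonempty ↔ (q : ℤ) ∣ m - f i n := by
  have hpos : ∀ t, lo n ≤ t → t ≤ hi n → l (f i n) < a i t ∧ a i t < r (f i n) :=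
    fun t h1 h2 => ⟨((h.maps i).left n).trans_le ((a i).monotone ((hK.lt_lo n).le.trans h1)),
      ((a i).monotone (h2.trans (hK.hi_lt n).le)).trans_lt ((h.maps i).right n)⟩
  constructor
  · rintro ⟨_, ⟨_, ⟨t, ⟨h1, h2⟩, rfl⟩, rfl⟩, h3⟩
    change A i • line t ∈ _ at h3
    rw [(h.isLift i).smul_line] at h3
    obtain ⟨k, k1, k2⟩ := hK.exists_of_line_mem h.arcs h3
    obtain ⟨p1, p2⟩ := hpos t h1 h2
    have a1 : ¬ f i n < m + k * q := fun hlt => by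
      have := h.arcs.r_lt_l hlt
      linarith [hK.lt_lo (m + k * q)]
    have a2 : ¬ m + k * q < f i n := fun hlt => by
      have := h.arcs.r_lt_l hlt
      linarith [hK.hi_lt (m + k * q)]
    exact ⟨-k, by linarith [show f i n = m + k * q by omega]⟩
  · rintro ⟨k, hk⟩
    obtain rfl : m = f i n + k * q := by linarith
    rw [hK.image_shift h.arcs]
    obtain ⟨p1, p2⟩ := hpos (lo n) le_rfl (hK.lo_le_hi n)
    have hmem := hA _ (hK.lo_mem n)
    rw [(h.isLift i).smul_line] at hmem
    exact ⟨_, ⟨_, ⟨lo n, ⟨le_rfl, hK.lo_le_hi n⟩, rfl⟩, (h.isLift i).smul_line _⟩,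
      ⟨_, hK.mem_Icc _ _ p1.le p2.le hmem, rfl⟩⟩

theorem _root_.IsArcFamily.strict_of_line_mem (ha : IsArcFamily q l r) {K : Set RP1}
    (hK : ∀ p ∈ K, ∃ n θ, l n < θ ∧ θ < r n ∧ line θ = p) (n : ℤ) (θ : ℝ) (h1 : l n ≤ θ)
    (h2 : θ ≤ r n) (hθ : line θ ∈ K) : l n < θ ∧ θ < r n := by
  obtain ⟨m, t, t1, t2, t3⟩ := hK _ hθ
  obtain ⟨k, rfl⟩ := line_eq_iff.1 t3.symm
  have e1 := ha.l_shift_mul m k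
  have e2 := ha.r_shift_mul m k
  have a1 : ¬ n < m + k * q := fun hlt => by
    have := ha.r_lt_l hlt
    linarith
  have a2 : ¬ m + k * q < n := fun hlt => by
    have := ha.r_lt_l hlt
    linarith
  obtain rfl : n = m + k * q := by omega
  exact ⟨by linarith, by linarith⟩

theorem _root_.IsHullFamily.image_eq_iff (ha : IsArcFamily q l r) {K : Set RP1} {lo hi : ℤ → ℝ}
    (hK : IsHullFamily K l r lo hi) (m n : ℤ) :
    line '' Set.Icc (lo m) (hi m) = line '' Set.Icc (lo n) (hi n) ↔ (q : ℤ) ∣ m - n := by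
  constructor
  · intro he
    have hmem : line (lo m) ∈ line '' Set.Icc (lo m) (hi m) := ⟨_, ⟨le_rfl, hK.lo_le_hi m⟩, rfl⟩
    rw [he] at hmem
    obtain ⟨k, k1, k2⟩ := hK.exists_of_line_mem ha hmem
    have a1 : ¬ m < n + k * q := fun hlt => by
      have := hK.hi_lt_lo ha hlt
      linarith [hK.lo_le_hi m]
    have a2 : ¬ n + k * q < m := fun hlt => by
      have := hK.hi_lt_lo ha hlt
      linarith
    exact ⟨k, by linarith [show m = n + k * q by omega]⟩
  · rintro ⟨k, hk⟩
    obtain rfl : m = n + k * q := by linarith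
    exact hK.image_shift ha n k

theorem exists_interlaced {α : Type*} (u v : ℤ → α) :
    ∃ t : ℤ → α, (∀ n, t (2 * n) = u n) ∧ ∀ n, t (2 * n + 1) = v n := by
  refine ⟨fun j => if Even j then u (j / 2) else v (j / 2), fun n => ?_, fun n => ?_⟩
  · simp
  · have : (2 * n + 1) / 2 = n := by omega
    simp [this]

theorem induces {M : Type*} [Finite M] {P : MulticonePair M} {idx : ℤ → M}
    (hidx : P.IsIndexing idx) {Φ : FreeMonoid (Fin N) →* Correspondence M}
    (hΦ : P.IsMonotonicMorphism Φ)
    (hf : ∀ i, P.Represents idx (Φ (FreeMonoid.of i)) (f i))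
    (hs : TightSystem P.rank f) (h : Realizes P.rank f A a l r) : Induces A P Φ := by
  obtain ⟨es, eu, hsp, iu, is, u1, u2, s1, s2⟩ := h.exists_splitting hs
  have hq := hidx.rank_pos
  have hd := h.dual hs
  have cu : IsClosed (Set.range eu) := (isCompact_range hsp.continuous_eu).isClosed
  have cs : IsClosed (Set.range es) := (isCompact_range hsp.continuous_es).isClosed
  have hKu : ∀ p ∈ Set.range eu, ∃ n θ, l n < θ ∧ θ < r n ∧ line θ = p := by
    rintro _ ⟨x, rfl⟩; exact u1 x
  have hKs : ∀ p ∈ Set.range es, ∃ n θ, r n < θ ∧ θ < l (n + 1) ∧ line θ = p := by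
    rintro _ ⟨x, rfl⟩; exact s1 x
  have hKu2 : ∀ n, ∃ θ, l n < θ ∧ θ < r n ∧ line θ ∈ Set.range eu := fun n => by
    obtain ⟨x, θ, h1, h2, h3⟩ := u2 n; exact ⟨θ, h1, h2, x, h3.symm⟩
  have hKs2 : ∀ n, ∃ θ, r n < θ ∧ θ < l (n + 1) ∧ line θ ∈ Set.range es := fun n => by
    obtain ⟨x, θ, h1, h2, h3⟩ := s2 n; exact ⟨θ, h1, h2, x, h3.symm⟩
  obtain ⟨lo, hi, hU⟩ := exists_isHullFamily cu (h.arcs.strict_of_line_mem hKu) fun n => by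
    obtain ⟨θ, h1, h2, h3⟩ := hKu2 n; exact ⟨θ, h1.le, h2.le, h3⟩
  obtain ⟨lo', hi', hS⟩ := exists_isHullFamily cs (hd.arcs.strict_of_line_mem hKs) fun n => by
    obtain ⟨θ, h1, h2, h3⟩ := hKs2 n; exact ⟨θ, h1.le, h2.le, h3⟩
  have compU : components (unstableCore A) = Set.range fun n => line '' Set.Icc (lo n) (hi n) := by
    rw [unstableCore, hsp.Ku_eq, hsp.Ks_eq]
    exact hU.components_fill h.arcs hq hKu hKs hKs2
  have compS : components (stableCore A) = Set.range fun n => line '' Set.Icc (lo' n) (hi' n) := by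
    rw [stableCore, hsp.Ku_eq, hsp.Ks_eq]
    refine hS.components_fill hd.arcs hq hKs (fun p hp => ?_) fun n => hKu2 (n + 1)
    obtain ⟨n, θ, hn⟩ := hKu p hp
    -- In the dual family the arc `[l n, r n]` is the gap that follows `[r (n - 1), l n]`.
    exact ⟨n - 1, θ, by simpa using hn⟩
  have relU : ∀ i n m, (((fun p => A i • p) '' (line '' Set.Icc (lo n) (hi n))) ∩
      line '' Set.Icc (lo m) (hi m)).Nonempty ↔ (P.rank : ℤ) ∣ m - f i n := fun i =>
    h.image_hull_inter_nonempty_iff hU (by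
      rintro _ ⟨x, rfl⟩
      obtain ⟨y, hy⟩ := iu x i
      exact ⟨y, hy.symm⟩)
  -- `A i` sends a point of `x` into `y` exactly when `A i⁻¹` sends a point of `y` into `x`, so the
  -- stable side follows from the dual realization.
  have relS : ∀ i n m, (((fun p => A i • p) '' (line '' Set.Icc (lo' n) (hi' n))) ∩
      line '' Set.Icc (lo' m) (hi' m)).Nonempty ↔ (P.rank : ℤ) ∣ n - upperAdj (f i) m :=
    fun i n m => by
    rw [← hd.image_hull_inter_nonempty_iff hS (i := i) (by
      rintro _ ⟨x, rfl⟩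
      obtain ⟨y, hy⟩ := is x i
      exact ⟨y, hy.symm⟩)]
    constructor
    · rintro ⟨_, ⟨p, hp, rfl⟩, hp'⟩
      exact ⟨p, ⟨_, hp', inv_smul_smul _ _⟩, hp⟩
    · rintro ⟨_, ⟨p, hp, rfl⟩, hp'⟩
      exact ⟨p, ⟨_, hp', smul_inv_smul _ _⟩, hp⟩
  obtain ⟨J, hJ0, hJ1⟩ := exists_interlaced (fun n => line '' Set.Icc (lo n) (hi n))
    fun n => line '' Set.Icc (lo' n) (hi' n)
  have cases_idx : ∀ x, ∃ n, x = idx (2 * n) ∨ x = idx (2 * n + 1) := fun x => by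
    by_cases hx : x ∈ P.stable
    · obtain ⟨n, rfl⟩ := hidx.exists_odd hx; exact ⟨n, Or.inr rfl⟩
    · obtain ⟨n, rfl⟩ := hidx.exists_even hx; exact ⟨n, Or.inl rfl⟩
  have mixed : ∀ m n, line '' Set.Icc (lo m) (hi m) ≠ line '' Set.Icc (lo' n) (hi' n) :=
    fun m n he => by
    have hmem : line (lo m) ∈ line '' Set.Icc (lo m) (hi m) := ⟨_, ⟨le_rfl, hU.lo_le_hi m⟩, rfl⟩
    rw [he] at hmem
    obtain ⟨t, ⟨t1, t2⟩, t3⟩ := hmem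
    exact disjoint_arcs h.arcs (hU.lt_lo m) ((hU.lo_le_hi m).trans_lt (hU.hi_lt m))
      ((hS.lt_lo n).trans_le t1) (t2.trans_lt (hS.hi_lt n)) t3.symm
  have mixed_idx : ∀ m n, idx (2 * m) ≠ idx (2 * n + 1) := fun m n he =>
    hidx.even_mem m (he ▸ hidx.odd_mem n)
  obtain ⟨e, he0, he1⟩ : ∃ e : M → Set RP1, (∀ n, e (idx (2 * n)) = line '' Set.Icc (lo n) (hi n)) ∧
      ∀ n, e (idx (2 * n + 1)) = line '' Set.Icc (lo' n) (hi' n) := by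
    choose j hj using hidx.surjective
    refine ⟨fun x => J (j x), fun n => ?_, fun n => ?_⟩
    · have := hj (idx (2 * n))
      rcases Int.even_or_odd' (j (idx (2 * n))) with ⟨m, hm | hm⟩
      · rw [hm, hidx.even_eq_iff] at this
        change J (j _) = _
        rw [hm, hJ0]
        exact (hU.image_eq_iff h.arcs m n).2 this
      · rw [hm] at this
        exact absurd this.symm (mixed_idx _ _)
    · have := hj (idx (2 * n + 1))
      rcases Int.even_or_odd' (j (idx (2 * n + 1))) with ⟨m, hm | hm⟩
      · rw [hm] at this
        exact absurd this (mixed_idx _ _)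
      · rw [hm, hidx.odd_eq_iff] at this
        change J (j _) = _
        rw [hm, hJ1]
        exact (hS.image_eq_iff hd.arcs m n).2 this
  refine ⟨⟨es, eu, hsp⟩, e, ?_, ?_, ?_, ?_, ?_⟩
  · intro x y hxy
    obtain ⟨m, rfl | rfl⟩ := cases_idx x <;> obtain ⟨n, rfl | rfl⟩ := cases_idx y
    · rw [he0, he0, hU.image_eq_iff h.arcs] at hxy
      exact (hidx.even_eq_iff m n).2 hxy
    · rw [he0, he1] at hxy
      exact absurd hxy (mixed _ _)
    · rw [he0, he1] at hxy
      exact absurd hxy.symm (mixed _ _)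
    · rw [he1, he1, hS.image_eq_iff hd.arcs] at hxy
      exact (hidx.odd_eq_iff m n).2 hxy
  · rw [compS]
    ext c
    constructor
    · rintro ⟨x, hx, rfl⟩
      obtain ⟨n, rfl⟩ := hidx.exists_odd hx
      exact ⟨n, (he1 n).symm⟩
    · rintro ⟨n, rfl⟩
      exact ⟨_, hidx.odd_mem n, he1 n⟩
  · rw [compU]
    ext c
    constructor
    · rintro ⟨x, hx, rfl⟩
      obtain ⟨n, rfl⟩ := hidx.exists_even hx
      exact ⟨n, (he0 n).symm⟩
    · rintro ⟨n, rfl⟩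
      exact ⟨_, hidx.even_mem n, he0 n⟩
  · obtain ⟨t, ht0, ht1⟩ := exists_interlaced lo lo'
    have hmem : ∀ j, line (t j) ∈ e (idx j) := fun j => by
      rcases Int.even_or_odd' j with ⟨m, rfl | rfl⟩
      · rw [he0, ht0]; exact ⟨_, ⟨le_rfl, hU.lo_le_hi m⟩, rfl⟩
      · rw [he1, ht1]; exact ⟨_, ⟨le_rfl, hS.lo_le_hi m⟩, rfl⟩
    have hmono : Monotone t := monotone_int_of_le_succ fun j => by
      rcases Int.even_or_odd' j with ⟨m, rfl | rfl⟩
      · rw [ht0, ht1]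
        linarith [hU.lo_le_hi m, hU.hi_lt m, hS.lt_lo m]
      · rw [show 2 * m + 1 + 1 = 2 * (m + 1) by ring, ht0, ht1]
        linarith [hS.lo_le_hi m, hS.hi_lt m, hU.lt_lo (m + 1)]
    have hshift : ∀ j, t (j + 2 * P.rank) = t j + π := fun j => by
      rcases Int.even_or_odd' j with ⟨m, rfl | rfl⟩
      · rw [← mul_add, ht0, ht0, hU.lo_shift h.arcs]
      · rw [add_right_comm, ← mul_add, ht1, ht1, hS.lo_shift hd.arcs]
    intro x y hc
    obtain ⟨j, rfl⟩ := hidx.surjective x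
    obtain ⟨k, rfl⟩ := hidx.surjective y
    -- The index of `y` is moved into `[j + 1, j + 2 * P.rank]`. The chosen angles then satisfy `t j
    -- ≤ t (j + 1) ≤ t k ≤ t j + π` for the moved index `k`, so `y` does not come strictly between
    -- `x` and its successor.
    obtain ⟨b, b1, b2⟩ := exists_shift_mem (q := 2 * P.rank) (by omega) (j + 1) k
    push_cast at b1 b2
    have hk : idx k = idx (k + b * (2 * P.rank)) := (hidx.eq_iff _ _).2 ⟨-b, by ring⟩
    rw [hk, ← hidx.succ] at hc
    refine not_cyclicLT_line (hmono (by omega)) (hmono b1) ?_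
      (hc _ (hmem j) _ (hmem _) _ (hmem (j + 1)))
    rw [← hshift]
    exact hmono (by omega)
  · intro i x y
    have hsub := (hΦ (FreeMonoid.of i)).subset x y
    obtain ⟨m, rfl | rfl⟩ := cases_idx x <;> obtain ⟨n, rfl | rfl⟩ := cases_idx y
    · rw [he0, he0, relU, (hf i).unstable]
      exact ⟨fun hr => ⟨Or.inr ⟨hidx.even_mem m, hidx.even_mem n⟩, hr⟩, And.right⟩
    · refine ⟨fun hr => ?_, fun hr => ?_⟩
      · rcases hsub hr with h1 | h1
        · exact absurd h1.1 (hidx.even_mem m)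
        · exact absurd (hidx.odd_mem n) h1.2
      · rcases hr.1 with h1 | h1
        · exact absurd h1.1 (hidx.even_mem m)
        · exact absurd (hidx.odd_mem n) h1.2
    · refine ⟨fun hr => ?_, fun hr => ?_⟩
      · rcases hsub hr with h1 | h1
        · exact absurd h1.2 (hidx.even_mem n)
        · exact absurd (hidx.odd_mem m) h1.1
      · rcases hr.1 with h1 | h1
        · exact absurd h1.2 (hidx.even_mem n)
        · exact absurd (hidx.odd_mem m) h1.1
    · rw [he1, he1, relS, (hf i).stable]
      exact ⟨fun hr => ⟨Or.inl ⟨hidx.odd_mem m, hidx.odd_mem n⟩, hr⟩, And.right⟩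

end Realizes

end

/-! ### Assembly of the proof -/

theorem FreeMonoid.length_eq_count_add_count (w : FreeMonoid (Fin 2)) :
    w.length = w.toList.count 0 + w.toList.count 1 := by
  induction w using FreeMonoid.inductionOn' with
  | one => rfl
  | of_mul i w ih =>
    rw [FreeMonoid.length_mul, ih, FreeMonoid.toList_mul, List.count_append, List.count_append]
    fin_cases i <;> simp <;> omega

theorem proposition5p5 {M : Type*} [Finite M] (P : MulticonePair M)
    (Φ : FreeMonoid (Fin 2) →* Correspondence M)
    (hΦ : P.IsMonotonicMorphism Φ) (hyp : P.IsHyperbolic Φ) (tight : P.IsTight Φ) :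
    ∃ A : Fin 2 → SL(2, ℝ),
      SL2Cocycle.UniformlyHyperbolic A ∧
      SL2Cocycle.Induces A P Φ ∧
      (2 ≤ P.rank → ∃ F ∈ Farey.substMonoid,
        Farey.HasFraction F (P.imUnstable (Φ (FreeMonoid.of 1))).ncard P.rank ∧
        Farey.InTwistedFree F A) := by
  obtain ⟨k, -, hk⟩ := id hyp
  -- A constant correspondence comes with an unstable element; this makes `M` nonempty and gives a
  -- starting point for the indexing.
  obtain ⟨-, -, x₀, hx₀, -⟩ := hk (FreeMonoid.ofList (List.replicate k 0)) (by
    simp [FreeMonoid.length])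
  obtain ⟨idx, hidx⟩ := MulticonePair.exists_isIndexing hx₀
  obtain ⟨f, hs, hf⟩ := hidx.exists_tightSystem hΦ hyp tight
  obtain ⟨f₀, f₁, rfl⟩ : ∃ f₀ f₁, f = ![f₀, f₁] := ⟨f 0, f 1, by ext i; fin_cases i <;> rfl⟩
  obtain ⟨A, B, a, b, l, r, hR, hF⟩ := hs.exists_realizes
  have hind := hR.induces hidx hΦ hf hs
  refine ⟨![A, B], hind.1, hind, fun hq => ?_⟩
  obtain ⟨F, hFm, h0, h1, hfree⟩ := hF hq
  refine ⟨F, hFm, ⟨?_, ?_⟩, hfree⟩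
  · rw [FreeMonoid.length_eq_count_add_count, h0, h1, hs.imCard_add hq]
  · rw [h1, hidx.ncard_imUnstable (hf 1)]
    rfl
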